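/- Let $0\le\gamma\le 1$ and $0\le\rho<1$. Let $\nu:\mathbb R^3\to\mathbb R$ be differentiable and let $k:\mathbb R^3\times\mathbb R^3\to\mathbb R$ be measurable and differentiable in $v$ for $v\ne v_*$, and suppose that there are constants $c_0,C_0>0$ such that (Property A), for all $v,v_*\in\mathbb R^3$ with $v\neq v_*$, $$c_0(1+|v|)^\gamma\le\nu(v)\le C_0(1+|v|)^\gamma,\qquad |\nabla\nu(v)|\le C_0(1+|v|)^{\gamma-1},$$ $$|k(v,v_*)|\le \frac{C_0}{|v-v_*|(1+|v|+|v_*|)^{1-\gamma}}\,E(v,v_*),\qquad |\nabla_vk(v,v_*)|\le \frac{C_0(1+|v|)}{|v-v_*|^2(1+|v|+|v_*|)^{1-\gamma}}\,E(v,v_*),$$ where $E(v,v_*)=\exp\Big(-\frac{1-\rho}{4}\Big(|v-v_*|^2+\Big(\frac{|v|^2-|v_*|^2}{|v-v_*|}\Big)^2\Big)\Big)$. Let $0\le\alpha<(1-\rho)/2$. For a bounded domain $\Omega\subset\mathbb R^3$ with $C^2$ boundary and outward unit normal $n$ put $\tau_{x,v}=\inf\{s\ge 0: x-sv\notin\Omega\}$,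 $q(x,v)=x-\tau_{x,v}v$, $N(x,v)=-n(q(x,v))\cdot\frac{v}{|v|}$, $w(x,v)=\frac{|v|}{|v|+1}N(x,v)$, $$|f|_{\infty,\alpha}=\operatorname*{ess\,sup}_{(x,v)\in\Omega\times\mathbb R^3}e^{\alpha|v|^2}|f(x,v)|,\qquad \|f\|_{\infty,\alpha}=|f|_{\infty,\alpha}+|w\nabla_xf|_{\infty,\alpha}+|w\nabla_vf|_{\infty,\alpha},$$ with weak gradients on $\Omega\times\mathbb R^3$ ($\|f\|_{\infty,\alpha}=\infty$ if they do not exist), let $\hat L^\infty_\alpha=\{f:\|f\|_{\infty,\alpha}<\infty\}$, and put $$Kf(x,v)=\int_{\mathbb R^3}k(v,v_*)f(x,v_*)\,dv_*,\qquad S_\Omega f(x,v)=\int_0^{\tau_{x,v}}e^{-\nu(v)s}f(x-sv,v)\,ds.$$ Then there is a constant $C\ge 0$, depending only on $\gamma,\rho,\alpha,\nu,k$, such that the following holds. Let $\Omega\subset\mathbb R^3$ be a bounded domain with $C^2$ boundary of positive Gaussian curvature, and let $R,r>0$ be such that every $x\in\partial\Omega$ lies on the boundary of a ball of radius $R$ whose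 closure contains $\overline\Omega$, and on the boundary of a ball of radius $r$ whose closure is contained in $\overline\Omega$. Then for every $h\in\hat L^\infty_\alpha$ the integrals defining $Kh(x,v)$ and $S_\Omega Kh(x,v)$ converge absolutely for almost every $(x,v)\in\Omega\times\mathbb R^3$, and $$\|S_\Omega Kh\|_{\infty,\alpha}\le C\Big((1+\operatorname{diam}\Omega)\,|h|_{\infty,\alpha}+(Rr)^{1/2}\Big(1+\frac Rr\Big)\|h\|_{\infty,\alpha}\Big);$$ in particular $S_\Omega Kh\in\hat L^\infty_\alpha$. -/

import Mathlib

open MeasureTheory Set Filter Topology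
open scoped ENNReal NNReal Gradient

noncomputable section

namespace KineticBoltzmann

/-- Euclidean three-space; it serves both as position space and as velocity space. -/
abbrev E3 := EuclideanSpace ℝ (Fin 3)

/-! ### Domains with `C²` boundary -/

/-- `ψ` is a `C²` defining function of `Ω` near the point `p`. -/
structure IsDefiningFunctionAt (Ω : Set E3) (p : E3) (ψ : E3 → ℝ) : Prop where
  contDiffAt : ContDiffAt ℝ 2 ψ p
  eq_zero : ψ p = 0
  gradient_ne_zero : ∇ ψ p ≠ 0
  mem_iff : ∀ᶠ x in 𝓝 p, (x ∈ Ω ↔ ψ x < 0)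

open Classical in
/-- The outward unit normal `n(p)` at a boundary point: the normalized gradient of a defining
function (see `outwardNormal_eq` for the independence of the choice). -/
def outwardNormal (Ω : Set E3) (p : E3) : E3 :=
  if hp : ∃ ψ : E3 → ℝ, IsDefiningFunctionAt Ω p ψ then
    ‖∇ hp.choose p‖⁻¹ • ∇ hp.choose p
  else 0

lemma eventually_neg_of_inner_neg {ψ : E3 → ℝ} {p e : E3} (hd : DifferentiableAt ℝ ψ p)
    (h0 : ψ p = 0) (he : inner ℝ (∇ ψ p) e < 0) :
    ∀ᶠ t : ℝ in 𝓝[>] 0, ψ (p + t • e) < 0 := by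
  have hline : HasDerivAt (fun t : ℝ => p + t • e) e 0 := by
    simpa using ((hasDerivAt_id (0 : ℝ)).smul_const e).const_add p
  have hψ : HasFDerivAt ψ (fderiv ℝ ψ p) (p + (0 : ℝ) • e) := by
    simpa using hd.hasFDerivAt
  have hder : HasDerivAt (fun t : ℝ => ψ (p + t • e)) (fderiv ℝ ψ p e) 0 :=
    hψ.comp_hasDerivAt (0 : ℝ) hline
  have hval : fderiv ℝ ψ p e < 0 := by
    have : inner ℝ (∇ ψ p) e = fderiv ℝ ψ p e := by
      simp [gradient]
    rwa [← this]
  have hs := hder.tendsto_slope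
  have hev : ∀ᶠ t : ℝ in 𝓝[≠] 0, slope (fun t : ℝ => ψ (p + t • e)) 0 t < 0 :=
    hs.eventually (gt_mem_nhds hval)
  have hev' : ∀ᶠ t : ℝ in 𝓝[>] 0, slope (fun t : ℝ => ψ (p + t • e)) 0 t < 0 :=
    hev.filter_mono (nhdsWithin_mono _ (fun t ht => ne_of_gt ht))
  filter_upwards [hev', self_mem_nhdsWithin] with t ht htpos
  have htpos' : (0 : ℝ) < t := htpos
  rw [slope_def_field] at ht
  simp only [zero_smul, add_zero, h0, sub_zero] at ht
  by_contra hcon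
  exact absurd ht (not_lt.mpr (div_nonneg (not_lt.mp hcon) htpos'.le))

lemma normalized_gradient_unique {Ω : Set E3} {p : E3} {ψ χ : E3 → ℝ}
    (hψ : IsDefiningFunctionAt Ω p ψ) (hχ : IsDefiningFunctionAt Ω p χ) :
    ‖∇ ψ p‖⁻¹ • ∇ ψ p = ‖∇ χ p‖⁻¹ • ∇ χ p := by
  by_contra hne
  set a := ‖∇ ψ p‖⁻¹ • ∇ ψ p with ha
  set b := ‖∇ χ p‖⁻¹ • ∇ χ p with hb
  have hψ0 : 0 < ‖∇ ψ p‖ := norm_pos_iff.mpr hψ.gradient_ne_zero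
  have hχ0 : 0 < ‖∇ χ p‖ := norm_pos_iff.mpr hχ.gradient_ne_zero
  have na : ‖a‖ = 1 := by rw [ha, norm_smul, norm_inv, norm_norm, inv_mul_cancel₀ hψ0.ne']
  have nb : ‖b‖ = 1 := by rw [hb, norm_smul, norm_inv, norm_norm, inv_mul_cancel₀ hχ0.ne']
  have hab : inner ℝ a b < 1 := inner_lt_one_iff_real_of_norm_eq_one na nb |>.mpr hne
  have ea : ∇ ψ p = ‖∇ ψ p‖ • a := by rw [ha, smul_smul, mul_inv_cancel₀ hψ0.ne', one_smul]
  have eb : ∇ χ p = ‖∇ χ p‖ • b := by rw [hb, smul_smul, mul_inv_cancel₀ hχ0.ne', one_smul]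
  have h1 : inner ℝ (∇ ψ p) (b - a) < 0 := by
    rw [ea, real_inner_smul_left, inner_sub_right, real_inner_self_eq_norm_sq, na]
    nlinarith
  have h2 : inner ℝ (∇ (fun x => - χ x) p) (b - a) < 0 := by
    have hg : ∇ (fun x => - χ x) p = - ∇ χ p := by
      simp [gradient, fderiv_fun_neg]
    rw [hg, inner_neg_left, eb, real_inner_smul_left, inner_sub_right,
      real_inner_self_eq_norm_sq, nb, real_inner_comm]
    nlinarith
  have d1 := hψ.contDiffAt.differentiableAt (by norm_num)
  have d2 := hχ.contDiffAt.differentiableAt (by norm_num)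
  have e1 := eventually_neg_of_inner_neg d1 hψ.eq_zero h1
  have e2 := eventually_neg_of_inner_neg (ψ := fun x => - χ x) d2.neg (by simp [hχ.eq_zero]) h2
  have hcont : Tendsto (fun t : ℝ => p + t • (b - a)) (𝓝[>] 0) (𝓝 p) := by
    have : Continuous (fun t : ℝ => p + t • (b - a)) := by fun_prop
    simpa using (this.tendsto 0).mono_left nhdsWithin_le_nhds
  have m1 := hcont.eventually hψ.mem_iff
  have m2 := hcont.eventually hχ.mem_iff
  obtain ⟨t, ht1, ht2, hm1, hm2⟩ := (e1.and (e2.and (m1.and m2))).exists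
  have := hm2.mp (hm1.mpr ht1)
  linarith

lemma outwardNormal_eq {Ω : Set E3} {p : E3} {ψ : E3 → ℝ} (hψ : IsDefiningFunctionAt Ω p ψ) :
    outwardNormal Ω p = ‖∇ ψ p‖⁻¹ • ∇ ψ p := by
  have hp : ∃ ψ : E3 → ℝ, IsDefiningFunctionAt Ω p ψ := ⟨ψ, hψ⟩
  rw [outwardNormal, dif_pos hp]
  exact normalized_gradient_unique hp.choose_spec hψ

/-- The Hessian matrix of `ψ` at `p`. -/
def hessianMatrix (ψ : E3 → ℝ) (p : E3) : Matrix (Fin 3) (Fin 3) ℝ :=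
  Matrix.of fun i j =>
    fderiv ℝ (fderiv ℝ ψ) p (EuclideanSpace.single i 1) (EuclideanSpace.single j 1)

/-- The Gaussian curvature at `p` of the level surface of `ψ` through `p`, that is
`(∇ψ)ᵀ adj(Hess ψ) ∇ψ / |∇ψ|⁴`. It does not depend on the defining function (nor on the
orientation), and equals `1 / a²` on a sphere of radius `a`. -/
def levelSetGaussianCurvature (ψ : E3 → ℝ) (p : E3) : ℝ :=
  (∇ ψ p).ofLp ⬝ᵥ ((hessianMatrix ψ p).adjugate.mulVec (∇ ψ p).ofLp) / ‖∇ ψ p‖ ^ 4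

/-- A bounded domain with `C²` boundary of positive Gaussian curvature. -/
structure AssumptionOmega (Ω : Set E3) : Prop where
  isOpen : IsOpen Ω
  isConnected : IsConnected Ω
  isBounded : Bornology.IsBounded Ω
  boundary : ∀ p ∈ frontier Ω, ∃ ψ : E3 → ℝ,
    IsDefiningFunctionAt Ω p ψ ∧ 0 < levelSetGaussianCurvature ψ p

/-- `R` is a uniform circumscribed radius of `Ω`. -/
def IsUniformCircumscribedRadius (Ω : Set E3) (R : ℝ) : Prop :=
  0 < R ∧ ∀ x ∈ frontier Ω, ∃ c : E3, x ∈ Metric.sphere c R ∧ closure Ω ⊆ Metric.closedBall c R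

/-- `r` is a uniform interior radius of `Ω`. -/
def IsUniformInteriorRadius (Ω : Set E3) (r : ℝ) : Prop :=
  0 < r ∧ ∀ x ∈ frontier Ω, ∃ c : E3, x ∈ Metric.sphere c r ∧ Metric.closedBall c r ⊆ closure Ω

/-! ### Backward exit time, exit point and the weight -/

/-- The backward exit time `τ_{x,v}` (with value `0` for `v = 0`, `x ∈ Ω`, a null set). -/
def exitTime (Ω : Set E3) (x v : E3) : ℝ := sInf {s : ℝ | 0 ≤ s ∧ x - s • v ∈ Ωᶜ}

/-- The backward exit point `q(x,v)`. -/
def exitPoint (Ω : Set E3) (x v : E3) : E3 := x - exitTime Ω x v • v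

/-- `N(x,v) = - n(q(x,v)) · v / |v|`. -/
def exitCos (Ω : Set E3) (x v : E3) : ℝ :=
  - inner ℝ (outwardNormal Ω (exitPoint Ω x v)) (‖v‖⁻¹ • v)

/-- The weight `w(x,v) = |v| N(x,v) / (|v| + 1)`. -/
def weight (Ω : Set E3) (z : E3 × E3) : ℝ := ‖z.2‖ / (‖z.2‖ + 1) * exitCos Ω z.1 z.2

/-! ### Norms -/

/-- Lebesgue measure on `Ω × ℝ³`. -/
def phaseMeasure (Ω : Set E3) : Measure (E3 × E3) := volume.restrict (Ω ×ˢ univ)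

/-- `|f|_{∞,α}`, the essential supremum over `Ω × ℝ³` of `exp(α|v|²) |f(x,v)|`, for scalar- or
vector-valued `f`. -/
def supNorm {F : Type*} [NormedAddCommGroup F] (Ω : Set E3) (α : ℝ) (f : E3 × E3 → F) : ℝ≥0∞ :=
  essSup (fun z => ENNReal.ofReal (Real.exp (α * ‖z.2‖ ^ 2)) * ‖f z‖ₑ) (phaseMeasure Ω)

/-- `|f|_{∞,α,w} = |w f|_{∞,α}`. -/
def weightedSupNorm {F : Type*} [NormedAddCommGroup F] [NormedSpace ℝ F] (Ω : Set E3) (α : ℝ)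
    (f : E3 × E3 → F) : ℝ≥0∞ :=
  supNorm Ω α (fun z => weight Ω z • f z)

/-- `G` and `H` are the weak gradients `∇ₓ f` and `∇ᵥ f` of `f` on the open set `Ω × ℝ³`. -/
structure HasWeakGradients (Ω : Set E3) (f : E3 × E3 → ℝ) (G H : E3 × E3 → E3) : Prop where
  locallyIntegrable : LocallyIntegrableOn f (Ω ×ˢ univ) volume
  locallyIntegrable_x : LocallyIntegrableOn G (Ω ×ˢ univ) volume
  locallyIntegrable_v : LocallyIntegrableOn H (Ω ×ˢ univ) volume
  weak_x : ∀ φ : E3 × E3 → ℝ, ContDiff ℝ (⊤ : ℕ∞) φ → HasCompactSupport φ → tsupport φ ⊆ Ω ×ˢ univ →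
    ∀ e : E3, ∫ z in Ω ×ˢ univ, f z * fderiv ℝ φ z (e, 0) =
      - ∫ z in Ω ×ˢ univ, inner ℝ (G z) e * φ z
  weak_v : ∀ φ : E3 × E3 → ℝ, ContDiff ℝ (⊤ : ℕ∞) φ → HasCompactSupport φ → tsupport φ ⊆ Ω ×ˢ univ →
    ∀ e : E3, ∫ z in Ω ×ˢ univ, f z * fderiv ℝ φ z (0, e) =
      - ∫ z in Ω ×ˢ univ, inner ℝ (H z) e * φ z

/-- `‖f‖_{∞,α} = |f|_{∞,α} + |∇ₓ f|_{∞,α,w} + |∇ᵥ f|_{∞,α,w}`. Weak gradients are unique almost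
everywhere, so for `Ω` open the infimum is over a single value; it is `∞` if `f` has no weak
gradients. -/
def fullNorm (Ω : Set E3) (α : ℝ) (f : E3 × E3 → ℝ) : ℝ≥0∞ :=
  ⨅ (G : E3 × E3 → E3) (H : E3 × E3 → E3) (_ : HasWeakGradients Ω f G H),
    supNorm Ω α f + weightedSupNorm Ω α G + weightedSupNorm Ω α H

/-- Membership in the space of all `f` with `‖f‖_{∞,α} < ∞`. -/
def MemHatLInfty (Ω : Set E3) (α : ℝ) (f : E3 × E3 → ℝ) : Prop := fullNorm Ω α f < ⊤

/-! ### The collision frequency, the collision kernel and the operators -/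

/-- The factor `exp(-(1-ρ)/4 (|v-v*|² + ((|v|²-|v*|²)/|v-v*|)²))`. -/
def kernelGaussian (ρ : ℝ) (v u : E3) : ℝ :=
  Real.exp (-((1 - ρ) / 4) *
    (‖v - u‖ ^ 2 + ((‖v‖ ^ 2 - ‖u‖ ^ 2) / ‖v - u‖) ^ 2))

/-- The bounds on the collision frequency `ν` and on the kernel `k` of the linearized collision
operator `L f = -ν f + K f`, for hard potentials with exponent `γ`. The kernel may be singular on
the diagonal. -/
structure PropertyA (γ ρ : ℝ) (ν : E3 → ℝ) (k : E3 → E3 → ℝ) : Prop where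
  gamma_nonneg : 0 ≤ γ
  gamma_le_one : γ ≤ 1
  rho_nonneg : 0 ≤ ρ
  rho_lt_one : ρ < 1
  nu_differentiable : Differentiable ℝ ν
  nu_lower : ∃ c : ℝ, 0 < c ∧ ∀ v, c * (1 + ‖v‖) ^ γ ≤ ν v
  nu_upper : ∃ C : ℝ, ∀ v, ν v ≤ C * (1 + ‖v‖) ^ γ
  nu_gradient : ∃ C : ℝ, ∀ v, ‖∇ ν v‖ ≤ C * (1 + ‖v‖) ^ (γ - 1)
  k_measurable : Measurable (Function.uncurry k)
  k_differentiable : ∀ v u, v ≠ u → DifferentiableAt ℝ (fun v' => k v' u) v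
  k_bound : ∃ C : ℝ, ∀ v u, v ≠ u →
    |k v u| ≤ C * (1 / (‖v - u‖ * (1 + ‖v‖ + ‖u‖) ^ (1 - γ)) * kernelGaussian ρ v u)
  k_gradient : ∃ C : ℝ, ∀ v u, v ≠ u →
    ‖∇ (fun v' => k v' u) v‖ ≤
      C * ((1 + ‖v‖) / (‖v - u‖ ^ 2 * (1 + ‖v‖ + ‖u‖) ^ (1 - γ)) * kernelGaussian ρ v u)

/-- `K f(x,v) = ∫ k(v,v*) f(x,v*) dv*`. -/
def opK (k : E3 → E3 → ℝ) (f : E3 × E3 → ℝ) : E3 × E3 → ℝ :=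
  fun z => ∫ u, k z.2 u * f (z.1, u)

/-- `S_Ω f(x,v) = ∫₀^τ exp(-ν(v)s) f(x - s v, v) ds` with `τ = τ_{x,v}`. -/
def opS (Ω : Set E3) (ν : E3 → ℝ) (f : E3 × E3 → ℝ) : E3 × E3 → ℝ :=
  fun z => ∫ s in (0 : ℝ)..(exitTime Ω z.1 z.2), Real.exp (-ν z.2 * s) * f (z.1 - s • z.2, z.2)

end KineticBoltzmann

end

/-! The operator K gains regularity in velocity, and S_Ω integrates away the loss of spatial
regularity at the boundary. In velocity, |∇_v k| is singular like |v - v_*|⁻², which is integrable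
in three dimensions, so K h is Lipschitz in v with a constant governed by |h|_{∞,α} alone; no
velocity derivative of h is needed. In space, ∇_x K h is formally ∫ k ∇_x h, and |∇_x h(x,u)| is
controlled by w(x,u)⁻¹ e^{-α|u|²}. Write d for the distance to the complement of Ω. The
circumscribed ball at the exit point gives d(x) ≤ R N(x,u)² for every u (`infDist_le_exitCos`), so
1/w is at most √R d(x)^{-1/2} up to a factor singular like 1/|u|, and that factor is integrable
against k (`exists_integral_singular_le`). The condition α < (1-ρ)/2 allows e^{-α|u|²} to be
exchanged for e^{-α|v|²} with Gaussian decay in v - u to spare.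

Hence the spatial Lipschitz constant of K h grows at most like √R d^{-1/2}. On a chord of length l,
the point at fraction σ satisfies d ≥ min(σ, 1-σ) l² / J² with J = 3 √r (1 + R/r)
(`infDist_chord_ge`): the interior ball gives linear growth of d near the exit point, and concavity
of d on the convex set Ω gives the rest. The length cancels, so the time integral of d^{-1/2} along
a chord is at most 4J/|v|. The product √R · J is the factor (Rr)^{1/2}(1 + R/r). Differentiating the
exit time in a direction (a,b) costs (|a| + τ|b|)/(|v| N), which the weight compensates; the damping
e^{-νs} supplies a factor 1/(1+τ) and absorbs (1+|v|)^γ, while w τ ≤ diam Ω produces the term 1 +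
diam Ω.

Since ∇_x h is only a weak gradient, nothing is differentiated under the integral. Mollification in
x, tested against averages along segments, yields an almost everywhere equal representative of K h
with pointwise Lipschitz bounds (`exists_regularSource`). A finite-difference estimate
(`abs_opS_sub_le`) makes its image under S_Ω locally Lipschitz away from v = 0; Rademacher's theorem
and passage to the limit in difference quotients give the weighted derivative bound
(`abs_fderiv_opS_le`). The set v = 0 has codimension three and is removable for integration by
parts. -/

noncomputable section

namespace KineticBoltzmann

/-! ### Geometry of uniformly convex domains -/

/-- An open bounded convex set with circumscribed balls of radius `R` and interior balls of radius
`r` at each boundary point, expressed through the outward normal. -/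
structure IsRollingDomain (Ω : Set E3) (R r : ℝ) : Prop where
  isOpen : IsOpen Ω
  nonempty : Ω.Nonempty
  isBounded : Bornology.IsBounded Ω
  convex : Convex ℝ Ω
  R_pos : 0 < R
  r_pos : 0 < r
  norm_normal : ∀ q ∈ frontier Ω, ‖outwardNormal Ω q‖ = 1
  subset_closedBall : ∀ q ∈ frontier Ω,
    closure Ω ⊆ Metric.closedBall (q - R • outwardNormal Ω q) R
  ball_subset : ∀ q ∈ frontier Ω, Metric.ball (q - r • outwardNormal Ω q) r ⊆ Ω

lemma inner_nonneg_of_mem_closedBall {c q y : E3} {R : ℝ} (hq : q ∈ Metric.sphere c R)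
    (hy : y ∈ Metric.closedBall c R) : inner ℝ (y - q) (q - c) ≤ 0 := by
  rw [mem_sphere_iff_norm] at hq
  rw [mem_closedBall_iff_norm] at hy
  have h : ‖y - c‖ ^ 2 = ‖y - q‖ ^ 2 + 2 * inner ℝ (y - q) (q - c) + ‖q - c‖ ^ 2 := by
    rw [← norm_add_sq_real]; simp
  have h2 : ‖y - c‖ ^ 2 ≤ R ^ 2 := pow_le_pow_left₀ (norm_nonneg _) hy 2
  rw [hq] at h
  nlinarith [sq_nonneg ‖y - q‖]

/-- A segment missing the frontier would be split by the disjoint open sets `interior Ω` and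
`(closure Ω)ᶜ`, against connectedness. -/
lemma exists_mem_frontier_segment {Ω : Set E3} {x y : E3} (hx : x ∈ Ω) (hy : y ∉ Ω) :
    ∃ p ∈ frontier Ω, p ∈ segment ℝ x y := by
  by_contra! hcon
  have hnot : ∀ p ∈ segment ℝ x y, p ∉ frontier Ω := fun p hp hpf => hcon p hpf hp
  have hsub : segment ℝ x y ⊆ interior Ω ∪ (closure Ω)ᶜ := by
    intro p hp
    by_cases hpc : p ∈ closure Ω
    · exact Or.inl (by_contra fun h => hnot p hp ⟨hpc, h⟩)
    · exact Or.inr hpc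
  have hxs := left_mem_segment ℝ x y
  have hys := right_mem_segment ℝ x y
  obtain ⟨p, -, hp1, hp2⟩ := (convex_segment x y).isPreconnected _ _ isOpen_interior
    isClosed_closure.isOpen_compl hsub
    ⟨x, hxs, (hsub hxs).resolve_right fun h => h (subset_closure hx)⟩
    ⟨y, hys, (hsub hys).resolve_left fun h => hy (interior_subset h)⟩
  exact hp2 (subset_closure (interior_subset hp1))

/-- Equality at y would be violated at the nearby point y + t m, which still lies in the open set.
-/
lemma inner_neg_of_forall_inner_nonpos {Ω : Set E3} (ho : IsOpen Ω) {p m : E3} (hm : m ≠ 0)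
    (h : ∀ y ∈ Ω, inner ℝ (y - p) m ≤ 0) {y : E3} (hy : y ∈ Ω) : inner ℝ (y - p) m < 0 := by
  have hev : ∀ᶠ t : ℝ in 𝓝[>] 0, y + t • m ∈ Ω := by
    have : Continuous (fun t : ℝ => y + t • m) := by fun_prop
    have ht := (this.tendsto 0).mono_left (nhdsWithin_le_nhds (s := Ioi 0))
    simp only [zero_smul, add_zero] at ht
    exact ht.eventually (ho.mem_nhds hy)
  obtain ⟨t, ht, ht0⟩ := (hev.and self_mem_nhdsWithin).exists
  have ht0' : (0 : ℝ) < t := ht0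
  have h1 := h _ ht
  have h2 : inner ℝ (y + t • m - p) m = inner ℝ (y - p) m + t * ‖m‖ ^ 2 := by
    rw [add_sub_right_comm, inner_add_left, real_inner_smul_left, real_inner_self_eq_norm_sq]
  rw [h2] at h1
  have : 0 < t * ‖m‖ ^ 2 := by positivity
  linarith

/-- The circumscribed ball supplies a strict supporting half-space at each frontier point. If a
segment between points a, b of Ω left Ω, it would contain a frontier point p; but p is a convex
combination of a and b, which both lie strictly on one side of the plane through p. -/
lemma convex_of_circumscribed {Ω : Set E3} {R : ℝ} (ho : IsOpen Ω)
    (hR : IsUniformCircumscribedRadius Ω R) : Convex ℝ Ω := by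
  obtain ⟨hR0, hR⟩ := hR
  have key : ∀ p ∈ frontier Ω, ∃ m : E3, ∀ y ∈ Ω, inner ℝ (y - p) m < 0 := by
    intro p hp
    obtain ⟨c, hc, hsub⟩ := hR p hp
    refine ⟨p - c, fun y hy => inner_neg_of_forall_inner_nonpos ho ?_ (fun y hy => ?_) hy⟩
    · intro h0
      rw [mem_sphere_iff_norm, h0, norm_zero] at hc
      exact hR0.ne hc
    · exact inner_nonneg_of_mem_closedBall hc (hsub (subset_closure hy))
  rw [convex_iff_segment_subset]
  intro a ha b hb z hz
  by_contra hzΩ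
  obtain ⟨p, hp, hpseg⟩ := exists_mem_frontier_segment ha hzΩ
  obtain ⟨m, hm⟩ := key p hp
  have hp' : p ∈ segment ℝ a b :=
    (convex_segment a b).segment_subset (left_mem_segment ℝ a b) hz hpseg
  obtain ⟨s, t, hs, ht, hst, rfl⟩ := hp'
  have h1 := hm a ha
  have h2 := hm b hb
  have h3 : s * inner ℝ (a - (s • a + t • b)) m + t * inner ℝ (b - (s • a + t • b)) m = 0 := by
    rw [← real_inner_smul_left, ← real_inner_smul_left, ← inner_add_left]
    have : s • (a - (s • a + t • b)) + t • (b - (s • a + t • b)) = 0 := by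
      have : t = 1 - s := by linarith
      subst this; module
    rw [this, inner_zero_left]
  rcases hs.lt_or_eq with hs0 | hs0
  · nlinarith [mul_neg_of_pos_of_neg hs0 h1]
  · subst hs0
    have : t = 1 := by linarith
    subst this
    simp at h3
    simp at h2

/-- If the normalized gradient a differed from b, the direction b - a would have negative product
with a, hence enter Ω, and positive product with b, hence leave the half-space containing Ω. -/
lemma outwardNormal_eq_of_forall_inner_nonpos {Ω : Set E3} {p b : E3} (hb : ‖b‖ = 1)
    (hsub : ∀ y ∈ Ω, inner ℝ (y - p) b ≤ 0)
    (hψ : ∃ ψ : E3 → ℝ, IsDefiningFunctionAt Ω p ψ) : outwardNormal Ω p = b := by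
  obtain ⟨ψ, hψ⟩ := hψ
  rw [outwardNormal_eq hψ]
  by_contra hne
  set a := ‖∇ ψ p‖⁻¹ • ∇ ψ p with ha
  have hψ0 : 0 < ‖∇ ψ p‖ := norm_pos_iff.mpr hψ.gradient_ne_zero
  have na : ‖a‖ = 1 := by rw [ha, norm_smul, norm_inv, norm_norm, inv_mul_cancel₀ hψ0.ne']
  have hab : inner ℝ a b < 1 := inner_lt_one_iff_real_of_norm_eq_one na hb |>.mpr hne
  have ea : ∇ ψ p = ‖∇ ψ p‖ • a := by rw [ha, smul_smul, mul_inv_cancel₀ hψ0.ne', one_smul]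
  have h1 : inner ℝ (∇ ψ p) (b - a) < 0 := by
    rw [ea, real_inner_smul_left, inner_sub_right, real_inner_self_eq_norm_sq, na]
    nlinarith
  have e1 := eventually_neg_of_inner_neg (hψ.contDiffAt.differentiableAt (by norm_num))
    hψ.eq_zero h1
  have hcont : Tendsto (fun t : ℝ => p + t • (b - a)) (𝓝[>] 0) (𝓝 p) := by
    have : Continuous (fun t : ℝ => p + t • (b - a)) := by fun_prop
    simpa using (this.tendsto 0).mono_left nhdsWithin_le_nhds
  obtain ⟨t, ht1, hm1, ht0⟩ :=
    (e1.and ((hcont.eventually hψ.mem_iff).and self_mem_nhdsWithin)).exists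
  have ht0' : (0 : ℝ) < t := ht0
  have := hsub _ (hm1.mpr ht1)
  rw [add_sub_cancel_left, real_inner_smul_left, inner_sub_left, real_inner_self_eq_norm_sq, hb]
    at this
  nlinarith

lemma AssumptionOmega.isRollingDomain {Ω : Set E3} {R r : ℝ} (hΩ : AssumptionOmega Ω)
    (hR : IsUniformCircumscribedRadius Ω R) (hr : IsUniformInteriorRadius Ω r) :
    IsRollingDomain Ω R r := by
  have hconv := convex_of_circumscribed hΩ.isOpen hR
  obtain ⟨hR0, hR⟩ := hR
  obtain ⟨hr0, hr⟩ := hr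
  have hdef : ∀ q ∈ frontier Ω, ∃ ψ : E3 → ℝ, IsDefiningFunctionAt Ω q ψ := fun q hq =>
    let ⟨ψ, hψ, _⟩ := hΩ.boundary q hq
    ⟨ψ, hψ⟩
  have key : ∀ q ∈ frontier Ω, ‖outwardNormal Ω q‖ = 1 ∧
      closure Ω ⊆ Metric.closedBall (q - R • outwardNormal Ω q) R := by
    intro q hq
    obtain ⟨c, hc, hsub⟩ := hR q hq
    have hc' := hc
    rw [mem_sphere_iff_norm] at hc'
    have hn : outwardNormal Ω q = R⁻¹ • (q - c) := by
      refine outwardNormal_eq_of_forall_inner_nonpos ?_ (fun y hy => ?_) (hdef q hq)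
      · rw [norm_smul, hc', Real.norm_of_nonneg (by positivity), inv_mul_cancel₀ hR0.ne']
      · rw [real_inner_smul_right]
        exact mul_nonpos_of_nonneg_of_nonpos (by positivity)
          (inner_nonneg_of_mem_closedBall hc (hsub (subset_closure hy)))
    have hcq : q - R • outwardNormal Ω q = c := by
      rw [hn, smul_smul, mul_inv_cancel₀ hR0.ne', one_smul, sub_sub_cancel]
    refine ⟨?_, hcq ▸ hsub⟩
    rw [hn, norm_smul, hc', Real.norm_of_nonneg (by positivity), inv_mul_cancel₀ hR0.ne']
  refine ⟨hΩ.isOpen, hΩ.isConnected.nonempty, hΩ.isBounded, hconv, hR0, hr0,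
    fun q hq => (key q hq).1, fun q hq => (key q hq).2, fun q hq => ?_⟩
  obtain ⟨c, hc, hsub⟩ := hr q hq
  obtain ⟨hn1, hball⟩ := key q hq
  set n := outwardNormal Ω q with hn
  have hc' := hc
  rw [mem_sphere_iff_norm] at hc'
  -- the point of the interior ball furthest in the direction `n` lies in the half-space
  have hhalf : ∀ y ∈ closure Ω, inner ℝ (y - q) n ≤ 0 := by
    intro y hy
    have hqs : q ∈ Metric.sphere (q - R • n) R := by
      rw [mem_sphere_iff_norm, sub_sub_cancel, norm_smul, hn1, Real.norm_of_nonneg hR0.le, mul_one]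
    have := inner_nonneg_of_mem_closedBall hqs (hball hy)
    rw [sub_sub_cancel, real_inner_smul_right] at this
    by_contra hcon
    push Not at hcon
    nlinarith [mul_pos hR0 hcon]
  -- Equality case of Cauchy–Schwarz: the half-space bound at c + r n gives r ≤ ⟨q - c, n⟩, while |q
  -- - c| = r and |n| = 1. So the interior ball touches q along the same normal.
  have hcn : c = q - r • n := by
    have h1 := hhalf (c + r • n) (hsub (by
      rw [mem_closedBall_iff_norm, add_sub_cancel_left, norm_smul, hn1,
        Real.norm_of_nonneg hr0.le, mul_one]))
    have h2 : ‖q - c - r • n‖ ^ 2 ≤ 0 := by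
      rw [norm_sub_sq_real, hc', norm_smul, hn1, Real.norm_of_nonneg hr0.le, mul_one,
        real_inner_smul_right]
      have h3 : inner ℝ (c + r • n - q) n = r - inner ℝ (q - c) n := by
        have : c + r • n - q = r • n - (q - c) := by abel
        rw [this, inner_sub_left, real_inner_smul_left, real_inner_self_eq_norm_sq, hn1]; ring
      rw [h3] at h1
      nlinarith
    have h4 : q - c - r • n = 0 := by
      rw [← norm_eq_zero]
      exact pow_eq_zero_iff (two_ne_zero) |>.mp (le_antisymm h2 (sq_nonneg _))
    have h5 : q - r • n - c = 0 := by rw [← h4]; abel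
    exact (sub_eq_zero.mp h5).symm
  rw [← hcn]
  -- The interior ball is only known to lie in `closure Ω`; convexity and openness bring its
  -- interior back into Ω.
  have hint : interior (closure Ω) = Ω := by
    rw [hconv.interior_closure_eq_interior_of_nonempty_interior
      (by rw [hΩ.isOpen.interior_eq]; exact hΩ.isConnected.nonempty), hΩ.isOpen.interior_eq]
  rw [← hint]
  exact interior_maximal (Metric.ball_subset_closedBall.trans hsub) Metric.isOpen_ball

namespace IsRollingDomain

variable {Ω : Set E3} {R r : ℝ}

/-! ### The backward exit time -/

lemma exitSet_nonempty (hΩ : IsRollingDomain Ω R r) (x : E3) {v : E3} (hv : v ≠ 0) :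
    {s : ℝ | 0 ≤ s ∧ x - s • v ∈ Ωᶜ}.Nonempty := by
  obtain ⟨B, hB⟩ := hΩ.isBounded.exists_norm_le
  have hv' : 0 < ‖v‖ := norm_pos_iff.mpr hv
  have hB0 : 0 ≤ B := (norm_nonneg _).trans (hB _ hΩ.nonempty.some_mem)
  refine ⟨(B + ‖x‖ + 1) / ‖v‖, by positivity, fun hmem => ?_⟩
  have h1 := hB _ hmem
  have h2 : ‖((B + ‖x‖ + 1) / ‖v‖) • v‖ = B + ‖x‖ + 1 := by
    rw [norm_smul, Real.norm_of_nonneg (by positivity), div_mul_cancel₀ _ hv'.ne']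
  have h3 := norm_sub_norm_le (((B + ‖x‖ + 1) / ‖v‖) • v) x
  rw [norm_sub_rev] at h3
  linarith

lemma exitTime_nonneg (x v : E3) : 0 ≤ exitTime Ω x v :=
  Real.sInf_nonneg fun _ hs => hs.1

lemma exitTime_le {x v : E3} {s : ℝ} (hs : 0 ≤ s) (h : x - s • v ∉ Ω) : exitTime Ω x v ≤ s :=
  csInf_le ⟨0, fun _ ht => ht.1⟩ ⟨hs, h⟩

lemma sub_smul_mem_of_lt_exitTime {x v : E3} {s : ℝ} (hs : 0 ≤ s) (h : s < exitTime Ω x v) :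
    x - s • v ∈ Ω := by
  by_contra hcon
  exact absurd (exitTime_le hs hcon) (not_le.mpr h)

lemma exitPoint_notMem (hΩ : IsRollingDomain Ω R r) (x : E3) {v : E3} (hv : v ≠ 0) :
    exitPoint Ω x v ∉ Ω := by
  have hclosed : IsClosed {s : ℝ | 0 ≤ s ∧ x - s • v ∈ Ωᶜ} := by
    have h1 : Continuous fun s : ℝ => x - s • v := by fun_prop
    exact isClosed_Ici.inter (hΩ.isOpen.isClosed_compl.preimage h1)
  exact (hclosed.csInf_mem (hΩ.exitSet_nonempty x hv) ⟨0, fun _ ht => ht.1⟩).2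

lemma exitTime_pos (hΩ : IsRollingDomain Ω R r) {x v : E3} (hx : x ∈ Ω) (hv : v ≠ 0) :
    0 < exitTime Ω x v := by
  refine (exitTime_nonneg x v).lt_of_ne fun h => hΩ.exitPoint_notMem x hv ?_
  rw [exitPoint, ← h, zero_smul, sub_zero]
  exact hx

lemma exitPoint_mem_closure (hΩ : IsRollingDomain Ω R r) {x v : E3} (hx : x ∈ Ω) (hv : v ≠ 0) :
    exitPoint Ω x v ∈ closure Ω := by
  have hpos := hΩ.exitTime_pos hx hv
  have h1 : Continuous fun s : ℝ => x - s • v := by fun_prop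
  refine mem_closure_of_tendsto
    ((h1.tendsto (exitTime Ω x v)).mono_left (nhdsWithin_le_nhds (s := Iio (exitTime Ω x v)))) ?_
  filter_upwards [Ioo_mem_nhdsLT hpos] with s hs
  exact sub_smul_mem_of_lt_exitTime hs.1.le hs.2

lemma exitPoint_mem_frontier (hΩ : IsRollingDomain Ω R r) {x v : E3} (hx : x ∈ Ω) (hv : v ≠ 0) :
    exitPoint Ω x v ∈ frontier Ω := by
  rw [hΩ.isOpen.frontier_eq]
  exact ⟨hΩ.exitPoint_mem_closure hx hv, hΩ.exitPoint_notMem x hv⟩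

lemma compl_nonempty (hΩ : IsRollingDomain Ω R r) : Ωᶜ.Nonempty := by
  obtain ⟨x, hx⟩ := hΩ.nonempty
  exact ⟨_, hΩ.exitPoint_notMem x (v := EuclideanSpace.single 0 1) (by
    simp)⟩

lemma infDist_pos (hΩ : IsRollingDomain Ω R r) {x : E3} (hx : x ∈ Ω) :
    0 < Metric.infDist x Ωᶜ :=
  (hΩ.isOpen.isClosed_compl.notMem_iff_infDist_pos hΩ.compl_nonempty).mp (fun h => h hx)

lemma exitTime_mul_norm_le_diam (hΩ : IsRollingDomain Ω R r) {x v : E3} (hx : x ∈ Ω)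
    (hv : v ≠ 0) : exitTime Ω x v * ‖v‖ ≤ Metric.diam Ω := by
  have h := Metric.dist_le_diam_of_mem (hΩ.isBounded.closure) (subset_closure hx)
    (hΩ.exitPoint_mem_closure hx hv)
  rw [Metric.diam_closure, exitPoint, dist_eq_norm, sub_sub_cancel, norm_smul,
    Real.norm_of_nonneg (exitTime_nonneg x v)] at h
  exact h

lemma inner_normal_eq {x v : E3} (hv : v ≠ 0) :
    inner ℝ v (outwardNormal Ω (exitPoint Ω x v)) = -(‖v‖ * exitCos Ω x v) := by
  have hv' : ‖v‖ ≠ 0 := norm_ne_zero_iff.mpr hv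
  rw [exitCos, real_inner_smul_right, real_inner_comm v]
  field_simp

/-- Power of a point with respect to the ball of radius a tangent at the exit point. Both ball
conditions are exploited through this identity, with a = R and with a = r. -/
lemma norm_sub_center_sq (hΩ : IsRollingDomain Ω R r) {x v : E3} (hx : x ∈ Ω) (hv : v ≠ 0)
    (a t : ℝ) :
    ‖exitPoint Ω x v + t • v - (exitPoint Ω x v - a • outwardNormal Ω (exitPoint Ω x v))‖ ^ 2 =
      a ^ 2 - (t * ‖v‖) * (2 * a * exitCos Ω x v - t * ‖v‖) := by
  set q := exitPoint Ω x v with hq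
  set n := outwardNormal Ω q with hn
  have hn1 : ‖n‖ = 1 := hΩ.norm_normal q (hΩ.exitPoint_mem_frontier hx hv)
  have hvn : inner ℝ v n = -(‖v‖ * exitCos Ω x v) := inner_normal_eq hv
  have : q + t • v - (q - a • n) = t • v + a • n := by abel
  rw [this, norm_add_sq_real, norm_smul, norm_smul, real_inner_smul_left, real_inner_smul_right,
    hvn, hn1, mul_one, Real.norm_eq_abs, Real.norm_eq_abs, mul_pow, sq_abs, sq_abs]
  ring

lemma exitPoint_add (x v : E3) : exitPoint Ω x v + exitTime Ω x v • v = x := by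
  simp [exitPoint]

/-- The chord of Ω is contained in the chord of the circumscribed ball through the exit point, whose
length is 2RN. -/
lemma exitTime_mul_norm_le (hΩ : IsRollingDomain Ω R r) {x v : E3} (hx : x ∈ Ω) (hv : v ≠ 0) :
    exitTime Ω x v * ‖v‖ ≤ 2 * R * exitCos Ω x v := by
  have h1 := hΩ.subset_closedBall _ (hΩ.exitPoint_mem_frontier hx hv) (subset_closure hx)
  rw [mem_closedBall_iff_norm] at h1
  have h2 := hΩ.norm_sub_center_sq hx hv R (exitTime Ω x v)
  rw [exitPoint_add] at h2
  have h3 := pow_le_pow_left₀ (norm_nonneg _) h1 2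
  rw [h2] at h3
  have h4 : 0 < exitTime Ω x v * ‖v‖ :=
    mul_pos (hΩ.exitTime_pos hx hv) (norm_pos_iff.mpr hv)
  by_contra hcon
  push Not at hcon
  nlinarith [mul_pos h4 (sub_pos.mpr hcon)]

lemma exitCos_pos (hΩ : IsRollingDomain Ω R r) {x v : E3} (hx : x ∈ Ω) (hv : v ≠ 0) :
    0 < exitCos Ω x v := by
  have h1 := hΩ.exitTime_mul_norm_le hx hv
  have h4 : 0 < exitTime Ω x v * ‖v‖ :=
    mul_pos (hΩ.exitTime_pos hx hv) (norm_pos_iff.mpr hv)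
  have := hΩ.R_pos
  by_contra hcon
  push Not at hcon
  nlinarith

lemma exitCos_le_one (hΩ : IsRollingDomain Ω R r) {x v : E3} (hx : x ∈ Ω) (hv : v ≠ 0) :
    exitCos Ω x v ≤ 1 := by
  have hn1 := hΩ.norm_normal _ (hΩ.exitPoint_mem_frontier hx hv)
  have h := abs_real_inner_le_norm (outwardNormal Ω (exitPoint Ω x v)) (‖v‖⁻¹ • v)
  rw [hn1, norm_smul, norm_inv, norm_norm, inv_mul_cancel₀ (norm_ne_zero_iff.mpr hv),
    one_mul] at h
  rw [exitCos]
  exact (neg_le_abs _).trans h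

/-! ### Distance to the boundary: comparison with tangent balls, concavity, growth along chords. -/

lemma ball_infDist_subset (x : E3) : Metric.ball x (Metric.infDist x Ωᶜ) ⊆ Ω := by
  intro y hy
  by_contra hcon
  have := Metric.infDist_le_dist_of_mem (x := x) (s := Ωᶜ) hcon
  rw [Metric.mem_ball, dist_comm] at hy
  linarith

lemma le_infDist_of_ball_subset (hΩ : IsRollingDomain Ω R r) {x : E3} {a : ℝ}
    (h : Metric.ball x a ⊆ Ω) : a ≤ Metric.infDist x Ωᶜ := by
  rw [Metric.le_infDist hΩ.compl_nonempty]
  intro y hy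
  by_contra hcon
  push Not at hcon
  exact hy (h (by rwa [Metric.mem_ball, dist_comm]))

/-- Moving y radially away from the centre by any amount below its distance to the complement stays
in Ω, hence in the circumscribed ball. -/
lemma infDist_add_norm_le (hΩ : IsRollingDomain Ω R r) {y q : E3} (hy : y ∈ Ω)
    (hq : q ∈ frontier Ω) :
    Metric.infDist y Ωᶜ + ‖y - (q - R • outwardNormal Ω q)‖ ≤ R := by
  set c := q - R • outwardNormal Ω q with hc
  have hn1 := hΩ.norm_normal q hq
  obtain ⟨e, he1, he⟩ : ∃ e : E3, ‖e‖ = 1 ∧ y - c = ‖y - c‖ • e := by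
    by_cases h0 : y - c = 0
    · exact ⟨outwardNormal Ω q, hn1, by rw [h0]; simp⟩
    · have h0' : ‖y - c‖ ≠ 0 := norm_ne_zero_iff.mpr h0
      refine ⟨‖y - c‖⁻¹ • (y - c), ?_, ?_⟩
      · rw [norm_smul, norm_inv, norm_norm, inv_mul_cancel₀ h0']
      · rw [smul_smul, mul_inv_cancel₀ h0', one_smul]
  suffices h : ∀ a, 0 ≤ a → a < Metric.infDist y Ωᶜ → a + ‖y - c‖ ≤ R by
    have h1 := hΩ.infDist_pos hy
    refine le_of_forall_lt_imp_le_of_dense fun b hb => ?_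
    by_cases hb' : 0 ≤ b - ‖y - c‖
    · have := h (b - ‖y - c‖) hb' (by linarith)
      linarith
    · have := h 0 le_rfl h1
      linarith
  intro a ha hlt
  have hmem : y + a • e ∈ Ω := ball_infDist_subset y (by
    rw [mem_ball_iff_norm, add_sub_cancel_left, norm_smul, he1, Real.norm_of_nonneg ha, mul_one]
    exact hlt)
  have h1 := hΩ.subset_closedBall q hq (subset_closure hmem)
  rw [mem_closedBall_iff_norm, ← hc, add_sub_right_comm, he, ← add_smul, norm_smul, he1, mul_one,
    Real.norm_of_nonneg (by positivity)] at h1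
  linarith

/-- The normal component at the exit point controls the distance to the boundary. -/
lemma infDist_le_exitCos (hΩ : IsRollingDomain Ω R r) {x v : E3} (hx : x ∈ Ω) (hv : v ≠ 0) :
    Metric.infDist x Ωᶜ ≤ R * exitCos Ω x v ^ 2 := by
  have h1 := hΩ.infDist_add_norm_le hx (hΩ.exitPoint_mem_frontier hx hv)
  have h2 := hΩ.norm_sub_center_sq hx hv R (exitTime Ω x v)
  rw [exitPoint_add] at h2
  set d := Metric.infDist x Ωᶜ
  set m := ‖x - (exitPoint Ω x v - R • outwardNormal Ω (exitPoint Ω x v))‖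
  set t := exitTime Ω x v * ‖v‖
  set N := exitCos Ω x v
  have hR := hΩ.R_pos
  have hd : 0 ≤ d := Metric.infDist_nonneg
  have hm : 0 ≤ m := norm_nonneg _
  have h3 : m ^ 2 ≤ (R - d) ^ 2 := pow_le_pow_left₀ hm (by linarith) 2
  -- Completing the square gives m² ≥ R²(1 - N²), so 2Rd - d² ≤ R²N²; and d ≤ R makes the left side
  -- at least Rd.
  have h4 : R * d ≤ R * (R * N ^ 2) := by nlinarith [sq_nonneg (t - R * N)]
  exact le_of_mul_le_mul_left h4 hR

/-- Concavity of the distance to the boundary. -/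
lemma infDist_combo_ge (hΩ : IsRollingDomain Ω R r) {x y : E3} (hx : x ∈ Ω) (hy : y ∈ Ω)
    {a b : ℝ} (ha : 0 ≤ a) (hb : 0 ≤ b) (hab : a + b = 1) :
    a * Metric.infDist x Ωᶜ + b * Metric.infDist y Ωᶜ ≤ Metric.infDist (a • x + b • y) Ωᶜ := by
  refine hΩ.le_infDist_of_ball_subset fun z hz => ?_
  have hdx := hΩ.infDist_pos hx
  have hdy := hΩ.infDist_pos hy
  set dx := Metric.infDist x Ωᶜ
  set dy := Metric.infDist y Ωᶜ
  set m := a * dx + b * dy with hm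
  rw [mem_ball_iff_norm] at hz
  set e := z - (a • x + b • y) with he
  have hm0 : 0 < m := (norm_nonneg _).trans_lt hz
  -- The displacement e is shared between x and y in proportion to their distances to the
  -- complement, so that each shifted point stays in its own ball.
  have hz' : z = a • (x + (dx / m) • e) + b • (y + (dy / m) • e) := by
    have h1 : a • (x + (dx / m) • e) + b • (y + (dy / m) • e)
        = (a • x + b • y) + ((a * dx + b * dy) / m) • e := by
      module
    rw [h1, ← hm, div_self hm0.ne', one_smul, he]; abel
  rw [hz']
  refine hΩ.convex (ball_infDist_subset x ?_) (ball_infDist_subset y ?_) ha hb hab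
  · rw [mem_ball_iff_norm, add_sub_cancel_left, norm_smul, Real.norm_of_nonneg (by positivity)]
    rw [div_mul_eq_mul_div, div_lt_iff₀ hm0]
    exact mul_lt_mul_of_pos_left hz hdx
  · rw [mem_ball_iff_norm, add_sub_cancel_left, norm_smul, Real.norm_of_nonneg (by positivity)]
    rw [div_mul_eq_mul_div, div_lt_iff₀ hm0]
    exact mul_lt_mul_of_pos_left hz hdy

lemma min_infDist_le_of_mem_segment (hΩ : IsRollingDomain Ω R r) {x y z : E3} (hx : x ∈ Ω)
    (hy : y ∈ Ω) (hz : z ∈ segment ℝ x y) :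
    min (Metric.infDist x Ωᶜ) (Metric.infDist y Ωᶜ) ≤ Metric.infDist z Ωᶜ := by
  obtain ⟨a, b, ha, hb, hab, rfl⟩ := hz
  refine le_trans ?_ (hΩ.infDist_combo_ge hx hy ha hb hab)
  set dx := Metric.infDist x Ωᶜ
  set dy := Metric.infDist y Ωᶜ
  have h1 := min_le_left dx dy
  have h2 := min_le_right dx dy
  have h3 : a = 1 - b := by linarith
  subst h3
  nlinarith [mul_le_mul_of_nonneg_left h1 ha, mul_le_mul_of_nonneg_left h2 hb]

/-- Near the exit point the distance to the boundary grows linearly along the ray. -/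
lemma infDist_ray_ge (hΩ : IsRollingDomain Ω R r) {x v : E3} (hx : x ∈ Ω) (hv : v ≠ 0) {t : ℝ}
    (ht : 0 ≤ t) (htN : t * ‖v‖ ≤ r * exitCos Ω x v) :
    t * ‖v‖ * exitCos Ω x v / 2 ≤ Metric.infDist (exitPoint Ω x v + t • v) Ωᶜ := by
  set q := exitPoint Ω x v with hq
  set n := outwardNormal Ω q with hn
  set N := exitCos Ω x v with hN
  have hr := hΩ.r_pos
  have h1 := hΩ.norm_sub_center_sq hx hv r t
  have hb := hΩ.ball_subset q (hΩ.exitPoint_mem_frontier hx hv)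
  rw [← hq, ← hn, ← hN] at h1
  rw [← hn] at hb
  set m := ‖q + t • v - (q - r • n)‖ with hm
  have hm0 : 0 ≤ m := norm_nonneg _
  have htv : 0 ≤ t * ‖v‖ := by positivity
  have h2 : Metric.ball (q + t • v) (r - m) ⊆ Ω := by
    refine subset_trans (Metric.ball_subset_ball' ?_) hb
    rw [dist_eq_norm, ← hm]; linarith
  refine le_trans ?_ (hΩ.le_infDist_of_ball_subset h2)
  -- With l = t|v|, the difference of the two sides is l(rN - l) + (lN/2)².
  have h3 : (r - t * ‖v‖ * N / 2) ^ 2 ≥ m ^ 2 := by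
    nlinarith [mul_nonneg htv (sub_nonneg.mpr htN), sq_nonneg (t * ‖v‖ * N / 2)]
  have hNle := hΩ.exitCos_le_one hx hv
  have hNp := hΩ.exitCos_pos hx hv
  rw [← hN] at hNle hNp
  have h4 : t * ‖v‖ * N / 2 ≤ r := by
    nlinarith [mul_le_mul_of_nonneg_right htN hNp.le, mul_le_mul hNle hNle hNp.le zero_le_one]
  have h5 : m ≤ r - t * ‖v‖ * N / 2 := by
    refine le_of_sq_le_sq ?_ ?_ <;> linarith
  linarith

/-- The constant in the chord estimate for the distance to the boundary. -/
def chordConst (R r : ℝ) : ℝ := 3 * (Real.sqrt r * (1 + R / r))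

lemma chordConst_pos (hΩ : IsRollingDomain Ω R r) : 0 < chordConst R r := by
  have := hΩ.R_pos
  have := hΩ.r_pos
  unfold chordConst
  positivity

lemma sub_smul_exitTime (x v : E3) (σ : ℝ) :
    x - (σ * exitTime Ω x v) • v = exitPoint Ω x v + ((1 - σ) * exitTime Ω x v) • v := by
  rw [exitPoint]; module

lemma chord_mem {x v : E3} (hΩ : IsRollingDomain Ω R r) (hx : x ∈ Ω) (hv : v ≠ 0) {σ : ℝ}
    (h0 : 0 ≤ σ) (h1 : σ < 1) : x - (σ * exitTime Ω x v) • v ∈ Ω := by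
  have := hΩ.exitTime_pos hx hv
  exact sub_smul_mem_of_lt_exitTime (by positivity) (by nlinarith)

/-- Along the chord from `x` back to its exit point, the inverse square root of the distance to the
boundary has an integrable majorant whose size does not depend on `x` and `v`. -/
lemma infDist_chord_ge (hΩ : IsRollingDomain Ω R r) {x v : E3} (hx : x ∈ Ω) (hv : v ≠ 0) {σ : ℝ}
    (h0 : 0 < σ) (h1 : σ < 1) :
    min σ (1 - σ) * (exitTime Ω x v * ‖v‖) ^ 2 ≤
      chordConst R r ^ 2 * Metric.infDist (x - (σ * exitTime Ω x v) • v) Ωᶜ := by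
  have hR := hΩ.R_pos
  have hr := hΩ.r_pos
  have hτ := hΩ.exitTime_pos hx hv
  have hN := hΩ.exitCos_pos hx hv
  have hvp : 0 < ‖v‖ := norm_pos_iff.mpr hv
  have hl := hΩ.exitTime_mul_norm_le hx hv
  rw [sub_smul_exitTime]
  set τ := exitTime Ω x v with hτdef
  set N := exitCos Ω x v with hNdef
  set q := exitPoint Ω x v with hqdef
  have hJ : chordConst R r ^ 2 = 9 * (r + 2 * R + R ^ 2 / r) := by
    rw [chordConst, mul_pow, mul_pow, Real.sq_sqrt hr.le]; field_simp; ring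
  -- `hJ1` serves points within rN of the exit point, `hJ2` the points farther along the chord.
  have hJ1 : 4 * R ≤ chordConst R r ^ 2 := by
    rw [hJ]; have : 0 ≤ R ^ 2 / r := by positivity
    linarith
  have hJ2 : 8 * R ^ 2 ≤ chordConst R r ^ 2 * r := by
    have : (r + 2 * R + R ^ 2 / r) * r = r ^ 2 + 2 * R * r + R ^ 2 := by field_simp
    rw [hJ, mul_assoc, this]
    have := mul_pos hR hr
    nlinarith [sq_nonneg R, sq_nonneg r]
  have hl0 : 0 < τ * ‖v‖ := by positivity
  set l := τ * ‖v‖ with hldef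
  rcases le_or_gt ((1 - σ) * l) (r * N) with hc | hc
  · have h2 := hΩ.infDist_ray_ge hx hv (t := (1 - σ) * τ) (by nlinarith)
      (by rw [mul_assoc]; exact hc)
    rw [← hqdef, ← hNdef, mul_assoc (1 - σ), ← hldef] at h2
    calc min σ (1 - σ) * l ^ 2 ≤ (1 - σ) * l * l := by
          rw [mul_assoc, ← sq]
          exact mul_le_mul_of_nonneg_right (min_le_right _ _) (by positivity)
      _ ≤ (1 - σ) * l * (2 * R * N) :=
          mul_le_mul_of_nonneg_left hl (mul_nonneg (by linarith) hl0.le)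
      _ = 4 * R * ((1 - σ) * l * N / 2) := by ring
      _ ≤ chordConst R r ^ 2 * ((1 - σ) * l * N / 2) :=
          mul_le_mul_of_nonneg_right hJ1
            (div_nonneg (mul_nonneg (mul_nonneg (by linarith) hl0.le) hN.le) (by norm_num))
      _ ≤ _ := mul_le_mul_of_nonneg_left h2 (by positivity)
  · -- the point lies between `q + t₀ v` and `x`
    set t₀ := r * N / ‖v‖ with ht₀
    have ht₀v : t₀ * ‖v‖ = r * N := by rw [ht₀, div_mul_cancel₀ _ hvp.ne']
    have ht₀p : 0 < t₀ := by positivity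
    have h2 := hΩ.infDist_ray_ge hx hv (t := t₀) ht₀p.le ht₀v.le
    rw [ht₀v, ← hqdef, ← hNdef] at h2
    have hlt : t₀ < (1 - σ) * τ := by
      refine lt_of_mul_lt_mul_right ?_ hvp.le
      rw [ht₀v, mul_assoc]; exact hc
    have hττ : t₀ < τ := by nlinarith
    have hmem : q + t₀ • v ∈ Ω := by
      have : q + t₀ • v = x - (τ - t₀) • v := by rw [hqdef, exitPoint]; module
      rw [this]
      exact sub_smul_mem_of_lt_exitTime (by linarith) (by linarith)
    -- Barycentric weight of q + t₀ v in the point considered; it is at least σ because τ - t₀ ≤ τ.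
    -- Concavity is then used with the contribution of x discarded.
    set a := σ * τ / (τ - t₀) with hadef
    have hd : 0 < τ - t₀ := by linarith
    have ha0 : 0 ≤ a := by positivity
    have ha1 : a ≤ 1 := by rw [hadef, div_le_one hd]; linarith
    have haσ : σ ≤ a := by
      rw [hadef, le_div_iff₀ hd]; nlinarith
    have h3 := hΩ.infDist_combo_ge hmem hx ha0 (sub_nonneg.mpr ha1) (by ring)
    have h4 : a • (q + t₀ • v) + (1 - a) • x = q + ((1 - σ) * τ) • v := by
      have hx' : x = q + τ • v := (exitPoint_add x v).symm
      have hc : a * t₀ + (1 - a) * τ = (1 - σ) * τ := by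
        have : a * (τ - t₀) = σ * τ := by rw [hadef, div_mul_cancel₀ _ hd.ne']
        linarith
      calc a • (q + t₀ • v) + (1 - a) • x
          = a • (q + t₀ • v) + (1 - a) • (q + τ • v) := by rw [← hx']
        _ = q + (a * t₀ + (1 - a) * τ) • v := by module
        _ = _ := by rw [hc]
    rw [h4] at h3
    have h5 : σ * (r * N * N / 2) ≤ Metric.infDist (q + ((1 - σ) * τ) • v) Ωᶜ := by
      refine le_trans ?_ h3
      have := mul_nonneg (sub_nonneg.mpr ha1) (Metric.infDist_nonneg (x := x) (s := Ωᶜ))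
      have h6 : σ * (r * N * N / 2) ≤ a * Metric.infDist (q + t₀ • v) Ωᶜ :=
        mul_le_mul haσ h2 (by positivity) ha0
      linarith
    calc min σ (1 - σ) * l ^ 2 ≤ σ * (2 * R * N) ^ 2 :=
          mul_le_mul (min_le_left _ _) (pow_le_pow_left₀ hl0.le hl 2) (by positivity) h0.le
      _ = 8 * R ^ 2 * (σ * (N * N / 2)) := by ring
      _ ≤ chordConst R r ^ 2 * r * (σ * (N * N / 2)) :=
          mul_le_mul_of_nonneg_right hJ2 (by positivity)
      _ = chordConst R r ^ 2 * (σ * (r * N * N / 2)) := by ring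
      _ ≤ _ := mul_le_mul_of_nonneg_left h5 (by positivity)

/-- Square root of the chord estimate. The factor τ is the Jacobian of s = στ, and it cancels
against the chord length. -/
lemma div_sqrt_infDist_chord_le (hΩ : IsRollingDomain Ω R r) {x v : E3} (hx : x ∈ Ω)
    (hv : v ≠ 0) {σ : ℝ} (h0 : 0 < σ) (h1 : σ < 1) :
    exitTime Ω x v * (Real.sqrt (Metric.infDist (x - (σ * exitTime Ω x v) • v) Ωᶜ))⁻¹ ≤
      chordConst R r / ‖v‖ * ((Real.sqrt σ)⁻¹ + (Real.sqrt (1 - σ))⁻¹) := by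
  have hJ := hΩ.chordConst_pos
  have hvp : 0 < ‖v‖ := norm_pos_iff.mpr hv
  have hτ := hΩ.exitTime_pos hx hv
  have h := hΩ.infDist_chord_ge hx hv h0 h1
  have hd := hΩ.infDist_pos (hΩ.chord_mem hx hv h0.le h1)
  set d := Metric.infDist (x - (σ * exitTime Ω x v) • v) Ωᶜ
  set τ := exitTime Ω x v
  have hm : 0 < min σ (1 - σ) := lt_min h0 (by linarith)
  have hs := Real.sqrt_le_sqrt h
  rw [Real.sqrt_mul hm.le, Real.sqrt_sq (by positivity), Real.sqrt_mul (by positivity),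
    Real.sqrt_sq hJ.le] at hs
  have h2 : τ * (Real.sqrt d)⁻¹ ≤ chordConst R r / ‖v‖ * (Real.sqrt (min σ (1 - σ)))⁻¹ := by
    have hsd := Real.sqrt_pos.mpr hd
    have hsm := Real.sqrt_pos.mpr hm
    rw [← div_eq_mul_inv, ← div_eq_mul_inv, div_div, div_le_div_iff₀ hsd (by positivity)]
    linarith
  refine h2.trans (mul_le_mul_of_nonneg_left ?_ (by positivity))
  rcases min_choice σ (1 - σ) with hc | hc <;> rw [hc]
  · exact le_add_of_nonneg_right (by positivity)
  · exact le_add_of_nonneg_left (by positivity)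

/-! ### Regularity of the exit time -/

lemma inner_normal_nonpos (hΩ : IsRollingDomain Ω R r) {q y : E3} (hq : q ∈ frontier Ω)
    (hy : y ∈ closure Ω) : inner ℝ (y - q) (outwardNormal Ω q) ≤ 0 := by
  have hR := hΩ.R_pos
  have hqs : q ∈ Metric.sphere (q - R • outwardNormal Ω q) R := by
    rw [mem_sphere_iff_norm, sub_sub_cancel, norm_smul, hΩ.norm_normal q hq,
      Real.norm_of_nonneg hR.le, mul_one]
  have := inner_nonneg_of_mem_closedBall hqs (hΩ.subset_closedBall q hq hy)
  rw [sub_sub_cancel, real_inner_smul_right] at this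
  exact nonpos_of_mul_nonpos_right this hR

/-- The backward ray from (x', v') must exit before it crosses the supporting plane at the old exit
point. The smallness of v' - v keeps its speed towards that plane at least |v|N/2. The bound is
one-sided, but asks nothing of the new exit point. -/
lemma exitTime_sub_le (hΩ : IsRollingDomain Ω R r) {x v : E3} (hx : x ∈ Ω) (hv : v ≠ 0)
    (x' : E3) {v' : E3} (hv' : ‖v' - v‖ ≤ ‖v‖ * exitCos Ω x v / 2) :
    exitTime Ω x' v' - exitTime Ω x v ≤
      2 * (‖x' - x‖ + exitTime Ω x v * ‖v' - v‖) / (‖v‖ * exitCos Ω x v) := by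
  have hτ := hΩ.exitTime_pos hx hv
  have hqf := hΩ.exitPoint_mem_frontier hx hv
  have hn1 := hΩ.norm_normal _ hqf
  have ha : 0 < ‖v‖ * exitCos Ω x v :=
    mul_pos (norm_pos_iff.mpr hv) (hΩ.exitCos_pos hx hv)
  have hvn := inner_normal_eq (Ω := Ω) (x := x) hv
  set τ := exitTime Ω x v with hτdef
  set a := ‖v‖ * exitCos Ω x v with hadef
  set n := outwardNormal Ω (exitPoint Ω x v) with hn
  have hX : 0 ≤ 2 * (‖x' - x‖ + τ * ‖v' - v‖) / a := by positivity
  rw [sub_le_iff_le_add]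
  refine le_of_forall_lt_imp_le_of_dense fun s hs => ?_
  rcases le_or_gt s τ with hsτ | hsτ
  · linarith
  have hmem := sub_smul_mem_of_lt_exitTime (hτ.le.trans hsτ.le) hs
  have h1 := hΩ.inner_normal_nonpos hqf (subset_closure hmem)
  have h2 : x' - s • v' - exitPoint Ω x v = (x' - x) + τ • v - s • v' := by
    rw [exitPoint]; module
  rw [h2, inner_sub_left, inner_add_left, real_inner_smul_left, real_inner_smul_left, ← hn,
    hvn] at h1
  have h3 : -‖x' - x‖ ≤ inner ℝ (x' - x) n := by
    have := abs_real_inner_le_norm (x' - x) n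
    rw [hn1, mul_one] at this
    exact (abs_le.mp this).1
  have h4 : inner ℝ v' n ≤ -a + ‖v' - v‖ := by
    have := abs_real_inner_le_norm (v' - v) n
    rw [hn1, mul_one, inner_sub_left, hvn] at this
    linarith [(abs_le.mp this).2]
  have h5 : (s - τ) * (a / 2) ≤ ‖x' - x‖ + τ * ‖v' - v‖ := by
    have h6 : s * inner ℝ v' n ≤ s * (-a + ‖v' - v‖) :=
      mul_le_mul_of_nonneg_left h4 (hτ.le.trans hsτ.le)
    nlinarith [mul_le_mul_of_nonneg_left hv' (sub_nonneg.mpr hsτ.le)]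
  have h7 : s - τ ≤ 2 * (‖x' - x‖ + τ * ‖v' - v‖) / a := by
    rw [le_div_iff₀ ha]; linarith
  linarith

/-- The phase space `Ω × (ℝ³ \ {0})`. -/
def movingPhase (Ω : Set E3) : Set (E3 × E3) := Ω ×ˢ {0}ᶜ

lemma isOpen_movingPhase (hΩ : IsRollingDomain Ω R r) : IsOpen (movingPhase Ω) :=
  hΩ.isOpen.prod isOpen_compl_singleton

/-- Near an interior point N is bounded below by √(d/R), so the one-sided estimate is uniform there
and may be applied in both orders. -/
lemma locallyLipschitzOn_exitTime (hΩ : IsRollingDomain Ω R r) :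
    LocallyLipschitzOn (movingPhase Ω) (fun z : E3 × E3 => exitTime Ω z.1 z.2) := by
  rintro ⟨x₀, v₀⟩ ⟨hx₀, hv₀⟩
  have hv₀' : 0 < ‖v₀‖ := norm_pos_iff.mpr hv₀
  have hd₀ := hΩ.infDist_pos hx₀
  have hR := hΩ.R_pos
  set d₀ := Metric.infDist x₀ Ωᶜ
  set η := Real.sqrt (d₀ / 2 / R) with hη
  have hη0 : 0 < η := Real.sqrt_pos.mpr (by positivity)
  -- A lower bound for |v|N on the neighbourhood; velocities within a₀/4 of v₀ differ by at most
  -- a₀/2, as the one-sided estimate requires.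
  set a₀ := ‖v₀‖ / 2 * η with ha₀
  have ha₀p : 0 < a₀ := by positivity
  set T := 2 * Metric.diam Ω / ‖v₀‖ with hT
  have hT0 : 0 ≤ T := by have := Metric.diam_nonneg (s := Ω); positivity
  set K := 2 * (1 + T) / a₀ with hK
  set U : Set (E3 × E3) := {z | z.1 ∈ Ω ∧ d₀ / 2 < Metric.infDist z.1 Ωᶜ ∧ ‖v₀‖ / 2 < ‖z.2‖ ∧
    ‖z.2 - v₀‖ < a₀ / 4} with hU
  have hUn : U ∈ 𝓝 (x₀, v₀) := by
    have c1 : ∀ᶠ z : E3 × E3 in 𝓝 (x₀, v₀), z.1 ∈ Ω :=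
      continuous_fst.continuousAt.eventually (hΩ.isOpen.mem_nhds hx₀)
    have c2 : ∀ᶠ z : E3 × E3 in 𝓝 (x₀, v₀), d₀ / 2 < Metric.infDist z.1 Ωᶜ := by
      have hc : Continuous fun z : E3 × E3 => Metric.infDist z.1 Ωᶜ :=
        (Metric.continuous_infDist_pt _).comp continuous_fst
      exact hc.continuousAt.eventually (lt_mem_nhds (half_lt_self hd₀))
    have c3 : ∀ᶠ z : E3 × E3 in 𝓝 (x₀, v₀), ‖v₀‖ / 2 < ‖z.2‖ := by
      have hc : Continuous fun z : E3 × E3 => ‖z.2‖ := by fun_prop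
      exact hc.continuousAt.eventually (lt_mem_nhds (half_lt_self hv₀'))
    have c4 : ∀ᶠ z : E3 × E3 in 𝓝 (x₀, v₀), ‖z.2 - v₀‖ < a₀ / 4 := by
      have hc : Continuous fun z : E3 × E3 => ‖z.2 - v₀‖ := by fun_prop
      exact hc.continuousAt.eventually (gt_mem_nhds (by simp; positivity))
    filter_upwards [c1, c2, c3, c4] with z h1 h2 h3 h4 using ⟨h1, h2, h3, h4⟩
  have key : ∀ z ∈ U, ∀ z' ∈ U,
      exitTime Ω z'.1 z'.2 - exitTime Ω z.1 z.2 ≤ K * ‖z' - z‖ := by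
    rintro ⟨x, v⟩ ⟨hx, hdx, hvv, hv4⟩ ⟨x', v'⟩ ⟨-, -, -, hv4'⟩
    dsimp only at *
    have hvp : 0 < ‖v‖ := by linarith
    have hv : v ≠ 0 := norm_pos_iff.mp hvp
    have hN := hΩ.exitCos_pos hx hv
    have hNη : η ≤ exitCos Ω x v := by
      have := hΩ.infDist_le_exitCos hx hv
      rw [hη, Real.sqrt_le_iff]
      refine ⟨hN.le, ?_⟩
      rw [div_le_iff₀ hR]
      linarith
    have ha : a₀ ≤ ‖v‖ * exitCos Ω x v :=
      mul_le_mul hvv.le hNη hη0.le hvp.le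
    have hvv' : ‖v' - v‖ ≤ a₀ / 2 := by
      have := norm_sub_le_norm_sub_add_norm_sub v' v₀ v
      rw [norm_sub_rev v₀ v] at this
      linarith
    have h1 := hΩ.exitTime_sub_le hx hv x' (v' := v') (by linarith)
    refine h1.trans ?_
    have hτ : exitTime Ω x v ≤ T := by
      have := hΩ.exitTime_mul_norm_le_diam hx hv
      rw [hT, le_div_iff₀ hv₀']
      nlinarith [exitTime_nonneg (Ω := Ω) x v]
    have hn1 : ‖x' - x‖ ≤ ‖(x', v') - (x, v)‖ := norm_fst_le ((x', v') - (x, v))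
    have hn2 : ‖v' - v‖ ≤ ‖(x', v') - (x, v)‖ := norm_snd_le ((x', v') - (x, v))
    calc 2 * (‖x' - x‖ + exitTime Ω x v * ‖v' - v‖) / (‖v‖ * exitCos Ω x v)
        ≤ 2 * (‖(x', v') - (x, v)‖ + T * ‖(x', v') - (x, v)‖) / a₀ := by
          gcongr
      _ = K * ‖(x', v') - (x, v)‖ := by rw [hK]; ring
  refine ⟨Real.toNNReal K, U, mem_nhdsWithin_of_mem_nhds hUn, ?_⟩
  refine LipschitzOnWith.of_dist_le_mul fun z hz z' hz' => ?_
  rw [Real.coe_toNNReal _ (by positivity), dist_eq_norm, dist_eq_norm, Real.norm_eq_abs, abs_le]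
  have h1 := key z hz z' hz'
  have h2 := key z' hz' z hz
  rw [norm_sub_rev] at h1
  constructor <;> linarith

end IsRollingDomain

/-! ### Kernel estimates -/

/-- With a = |v - u| and b = (|v|² - |u|²)/a one has |u|² = |v|² - ab, and αab ≤ α(a² + b²)/2. The
kernel exponent (1-ρ)/4 · (a² + b²) absorbs this and leaves the stated multiple of a². -/
lemma kernelGaussian_mul_exp_le {ρ α : ℝ} (hα : 0 ≤ α) (hα₁ : α < (1 - ρ) / 2) (v u : E3) :
    kernelGaussian ρ v u * Real.exp (-α * ‖u‖ ^ 2) ≤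
      Real.exp (-α * ‖v‖ ^ 2) * Real.exp (-((1 - ρ) / 4 - α / 2) * ‖v - u‖ ^ 2) := by
  rw [kernelGaussian, ← Real.exp_add, ← Real.exp_add, Real.exp_le_exp]
  rcases eq_or_ne v u with rfl | hne
  · simp
  have hpos : 0 < ‖v - u‖ := norm_pos_iff.mpr (sub_ne_zero.mpr hne)
  set a := ‖v - u‖ with ha
  set b := (‖v‖ ^ 2 - ‖u‖ ^ 2) / a with hb
  have hab : ‖v‖ ^ 2 - ‖u‖ ^ 2 = a * b := by rw [hb, mul_div_cancel₀ _ hpos.ne']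
  have h1 : ‖u‖ ^ 2 = ‖v‖ ^ 2 - a * b := by linarith
  rw [h1]
  have h2 : 0 ≤ (1 - ρ) / 4 - α / 2 := by linarith
  nlinarith [mul_nonneg hα (sq_nonneg (a - b)), mul_nonneg h2 (sq_nonneg b)]

lemma integrable_inv_sq_mul_exp {δ : ℝ} (hδ : 0 < δ) :
    Integrable (fun p : E3 => ‖p‖⁻¹ ^ 2 * Real.exp (-δ * ‖p‖ ^ 2)) := by
  have h := integrable_fun_norm_addHaar (E := E3) volume
    (f := fun y : ℝ => y⁻¹ ^ 2 * Real.exp (-δ * y ^ 2))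
  rw [h]
  have h2 : IntegrableOn (fun y : ℝ => Real.exp (-δ * y ^ 2)) (Ioi 0) :=
    (integrable_exp_neg_mul_sq hδ).integrableOn
  refine h2.congr_fun (fun y hy => ?_) measurableSet_Ioi
  have hy' : (y : ℝ) ≠ 0 := ne_of_gt hy
  simp only [finrank_euclideanSpace, Fintype.card_fin, smul_eq_mul]
  norm_num
  field_simp

lemma integrable_exp_neg_mul_norm_sq {δ : ℝ} (hδ : 0 < δ) :
    Integrable (fun p : E3 => Real.exp (-δ * ‖p‖ ^ 2)) := by
  have h := integrable_fun_norm_addHaar (E := E3) volume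
    (f := fun y : ℝ => Real.exp (-δ * y ^ 2))
  rw [h]
  have h2 := integrable_rpow_mul_exp_neg_mul_sq hδ (s := 2) (by norm_num)
  refine h2.integrableOn.congr_fun (fun y hy => ?_) measurableSet_Ioi
  simp [finrank_euclideanSpace]

lemma integrableOn_inv_sq : IntegrableOn (fun p : E3 => ‖p‖⁻¹ ^ 2) (Metric.ball 0 1) := by
  refine IntegrableOn.congr_fun (f := fun p : E3 =>
    Real.exp 1 * (‖p‖⁻¹ ^ 2 * Real.exp (-1 * ‖p‖ ^ 2)) * Real.exp (‖p‖ ^ 2 - 1))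
    ?_ (fun p _ => ?_) measurableSet_ball
  · refine Integrable.mul_bdd (c := 1)
      ((integrable_inv_sq_mul_exp one_pos).const_mul (Real.exp 1)).integrableOn
      (by fun_prop) ?_
    filter_upwards [ae_restrict_mem measurableSet_ball] with p hp
    rw [mem_ball_zero_iff] at hp
    rw [Real.norm_of_nonneg (Real.exp_pos _).le, Real.exp_le_one_iff]
    nlinarith [norm_nonneg p]
  · have : Real.exp 1 * Real.exp (-1 * ‖p‖ ^ 2) * Real.exp (‖p‖ ^ 2 - 1) = 1 := by
      rw [← Real.exp_add, ← Real.exp_add, Real.exp_eq_one_iff]; ring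
    linear_combination ‖p‖⁻¹ ^ 2 * this

/-- The two singularities sit at u = v and u = 0 and may come arbitrarily close. Young's inequality
separates them into inverse squares, each locally integrable in dimension three, and translation
invariance makes the bound uniform in v. -/
lemma exists_integral_singular_le {δ : ℝ} (hδ : 0 < δ) :
    ∃ C : ℝ, 0 ≤ C ∧ ∀ v : E3,
      Integrable (fun u => ‖v - u‖⁻¹ * Real.exp (-δ * ‖v - u‖ ^ 2) * (2 + ‖u‖⁻¹)) ∧
      ∫ u, ‖v - u‖⁻¹ * Real.exp (-δ * ‖v - u‖ ^ 2) * (2 + ‖u‖⁻¹) ≤ C := by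
  set e : E3 → ℝ := fun p => Real.exp (-δ * ‖p‖ ^ 2) with he
  set P : E3 → ℝ := fun p => ‖p‖⁻¹ ^ 2 * Real.exp (-δ * ‖p‖ ^ 2) with hP
  -- Truncated, since |u|⁻² is not integrable at infinity; outside the ball 1/|u| ≤ 1 and the
  -- Gaussian alone suffices.
  set Q : E3 → ℝ := (Metric.ball 0 1).indicator (fun p => ‖p‖⁻¹ ^ 2) with hQ
  have ie : Integrable e := integrable_exp_neg_mul_norm_sq hδ
  have iP : Integrable P := integrable_inv_sq_mul_exp hδ
  have iQ : Integrable Q := integrableOn_inv_sq.integrable_indicator measurableSet_ball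
  have e0 : ∀ p, 0 ≤ e p := fun p => (Real.exp_pos _).le
  have e1 : ∀ p, e p ≤ 1 := fun p => by
    rw [he]; simp only [Real.exp_le_one_iff]; nlinarith [sq_nonneg ‖p‖]
  have Q0 : ∀ p, 0 ≤ Q p := fun p => indicator_nonneg (fun _ _ => by positivity) p
  have P0 : ∀ p, 0 ≤ P p := fun p => by simp only [hP]; positivity
  have ptw : ∀ v u : E3, ‖v - u‖⁻¹ * Real.exp (-δ * ‖v - u‖ ^ 2) * (2 + ‖u‖⁻¹) ≤
      3 * e (v - u) + 3 * P (v - u) + Q u := by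
    intro v u
    have hPe : P (v - u) = ‖v - u‖⁻¹ ^ 2 * e (v - u) := rfl
    have hee : Real.exp (-δ * ‖v - u‖ ^ 2) = e (v - u) := rfl
    rw [hPe, hee]
    have ha : 0 ≤ ‖v - u‖⁻¹ := by positivity
    have hb : 0 ≤ ‖u‖⁻¹ := by positivity
    have hE0 := e0 (v - u)
    have hE1 := e1 (v - u)
    set a := ‖v - u‖⁻¹
    set b := ‖u‖⁻¹ with hbdef
    set E := e (v - u)
    have h1 : E * b ^ 2 ≤ E + Q u := by
      by_cases hu : u ∈ Metric.ball (0 : E3) 1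
      · have : Q u = b ^ 2 := by rw [hQ, indicator_of_mem hu]
        rw [this]; nlinarith [sq_nonneg b]
      · have h2 : b ≤ 1 := by
          rw [mem_ball_zero_iff, not_lt] at hu
          exact inv_le_one_of_one_le₀ hu
        have : b ^ 2 ≤ 1 := by nlinarith
        have := Q0 u
        nlinarith
    nlinarith [mul_nonneg hE0 (sq_nonneg (a - b)), mul_nonneg hE0 (sq_nonneg (a - 1)),
      mul_nonneg hE0 (sq_nonneg a), mul_nonneg hE0 (sq_nonneg b)]
  have iM : ∀ v : E3, Integrable fun u : E3 => 3 * e (v - u) + 3 * P (v - u) + Q u := fun v =>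
    (((ie.comp_sub_left v).const_mul 3).add ((iP.comp_sub_left v).const_mul 3)).add iQ
  have iW : ∀ v : E3, Integrable
      (fun u : E3 => ‖v - u‖⁻¹ * Real.exp (-δ * ‖v - u‖ ^ 2) * (2 + ‖u‖⁻¹)) := fun v => by
    refine (iM v).mono' (by fun_prop) (Eventually.of_forall fun u => ?_)
    rw [Real.norm_of_nonneg (by positivity)]
    exact ptw v u
  refine ⟨3 * (∫ p, e p) + 3 * (∫ p, P p) + ∫ p, Q p, ?_, fun v => ⟨iW v, ?_⟩⟩
  · have := integral_nonneg (μ := volume) (f := e) e0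
    have := integral_nonneg (μ := volume) (f := P) P0
    have := integral_nonneg (μ := volume) (f := Q) Q0
    positivity
  · refine (integral_mono (iW v) (iM v) (ptw v)).trans (le_of_eq ?_)
    rw [integral_add _ iQ, integral_add, integral_const_mul, integral_const_mul,
      integral_sub_left_eq_self e volume v, integral_sub_left_eq_self P volume v]
    · exact (ie.comp_sub_left v).const_mul 3
    · exact (iP.comp_sub_left v).const_mul 3
    · exact ((ie.comp_sub_left v).const_mul 3).add ((iP.comp_sub_left v).const_mul 3)

/-- For u off this null set, the kernel is differentiable along the whole line in its first
argument, so the mean value theorem applies. -/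
lemma volume_line_eq_zero (v e : E3) : volume {u : E3 | ∃ θ : ℝ, v + θ • e = u} = 0 := by
  have h1 : (Submodule.span ℝ {e} : Submodule ℝ E3) ≠ ⊤ := by
    intro h
    have h2 := finrank_span_le_card (R := ℝ) ({e} : Set E3)
    rw [h, finrank_top, finrank_euclideanSpace] at h2
    simp at h2
  have h3 := Measure.addHaar_submodule (volume : Measure E3) _ h1
  have h4 : {u : E3 | ∃ θ : ℝ, v + θ • e = u} =
      (fun u => u - v) ⁻¹' (Submodule.span ℝ {e} : Submodule ℝ E3) := by
    ext u
    simp only [mem_ofPred_eq, mem_preimage, SetLike.mem_coe, Submodule.mem_span_singleton]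
    refine exists_congr fun θ => ?_
    rw [eq_sub_iff_add_eq, add_comm]
  rw [h4, (measurePreserving_sub_right volume v).measure_preimage
    (Submodule.closed_of_finiteDimensional _).measurableSet.nullMeasurableSet]
  exact h3

lemma norm_gradient_eq (f : E3 → ℝ) (x : E3) : ‖∇ f x‖ = ‖fderiv ℝ f x‖ := by
  simp [gradient]

/-- The weight (1+|v|+|u|)^{1-γ} is simply at least 1 in the kernel bound. In the gradient bound it
is at least (1+|v|)^{1-γ}, which turns the growth 1+|v| into (1+|v|)^γ, the growth matched by the
lower bound on ν. -/
lemma PropertyA.exists_bounds {γ ρ : ℝ} {ν : E3 → ℝ} {k : E3 → E3 → ℝ}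
    (hA : PropertyA γ ρ ν k) : ∃ C : ℝ, 0 < C ∧
      (∀ v u, v ≠ u → |k v u| ≤ C * (‖v - u‖⁻¹ * kernelGaussian ρ v u)) ∧
      (∀ v u, v ≠ u → ‖fderiv ℝ (fun v' => k v' u) v‖ ≤
        C * ((1 + ‖v‖) ^ γ * ‖v - u‖⁻¹ ^ 2 * kernelGaussian ρ v u)) := by
  obtain ⟨C₁, h₁⟩ := hA.k_bound
  obtain ⟨C₂, h₂⟩ := hA.k_gradient
  have hg : ∀ v u, 0 < kernelGaussian ρ v u := fun v u => Real.exp_pos _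
  have hγ : 0 ≤ 1 - γ := by linarith [hA.gamma_le_one]
  refine ⟨max (max C₁ C₂) 1, by positivity, fun v u hvu => ?_, fun v u hvu => ?_⟩
  · have hpos : 0 < ‖v - u‖ := norm_pos_iff.mpr (sub_ne_zero.mpr hvu)
    refine (h₁ v u hvu).trans ?_
    have hX : 1 ≤ (1 + ‖v‖ + ‖u‖) ^ (1 - γ) :=
      Real.one_le_rpow (by linarith [norm_nonneg v, norm_nonneg u]) hγ
    refine mul_le_mul ((le_max_left _ _).trans (le_max_left _ _)) ?_ ?_ (by positivity)
    · refine mul_le_mul_of_nonneg_right ?_ (hg v u).le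
      rw [one_div]
      exact inv_anti₀ hpos (le_mul_of_one_le_right hpos.le hX)
    · have := hg v u; positivity
  · have hpos : 0 < ‖v - u‖ := norm_pos_iff.mpr (sub_ne_zero.mpr hvu)
    rw [← norm_gradient_eq]
    refine (h₂ v u hvu).trans ?_
    refine mul_le_mul ((le_max_right _ _).trans (le_max_left _ _)) ?_ ?_ (by positivity)
    · refine mul_le_mul_of_nonneg_right ?_ (hg v u).le
      have hv1 : 0 < 1 + ‖v‖ := by positivity
      have hX : (1 + ‖v‖) ^ (1 - γ) ≤ (1 + ‖v‖ + ‖u‖) ^ (1 - γ) :=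
        Real.rpow_le_rpow hv1.le (by linarith [norm_nonneg u]) hγ
      have hY : (1 + ‖v‖) ^ γ * (1 + ‖v‖) ^ (1 - γ) = 1 + ‖v‖ := by
        rw [← Real.rpow_add hv1]; simp
      rw [div_le_iff₀ (by positivity)]
      have : (1 + ‖v‖) ^ γ * ‖v - u‖⁻¹ ^ 2 * (‖v - u‖ ^ 2 * (1 + ‖v‖ + ‖u‖) ^ (1 - γ)) =
          (1 + ‖v‖) ^ γ * (1 + ‖v‖ + ‖u‖) ^ (1 - γ) := by field_simp
      rw [this]
      calc 1 + ‖v‖ = (1 + ‖v‖) ^ γ * (1 + ‖v‖) ^ (1 - γ) := hY.symm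
        _ ≤ _ := mul_le_mul_of_nonneg_left hX (by positivity)
    · have := hg v u; positivity

/-- Weighted integral bounds for the kernel and its variation in the first variable. -/
structure KernelBounds (γ α C : ℝ) (k : E3 → E3 → ℝ) : Prop where
  measurable : Measurable (Function.uncurry k)
  pos : 0 < C
  integrable : ∀ v, Integrable
    (fun u => |k v u| * Real.exp (-α * ‖u‖ ^ 2) * (1 + (1 + ‖u‖) / ‖u‖))
  integral_le : ∀ v, ∫ u, |k v u| * Real.exp (-α * ‖u‖ ^ 2) * (1 + (1 + ‖u‖) / ‖u‖) ≤
    C * Real.exp (-α * ‖v‖ ^ 2)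
  integral_sub_le : ∀ v v' m, (∀ θ ∈ Icc (0 : ℝ) 1,
      (1 + ‖v + θ • (v' - v)‖) ^ γ * Real.exp (-α * ‖v + θ • (v' - v)‖ ^ 2) ≤ m) →
    ∫ u, |k v' u - k v u| * Real.exp (-α * ‖u‖ ^ 2) ≤ C * m * ‖v' - v‖

/-- The variation bound integrates the gradient estimate over the segment from v to v' and then over
u. After Tonelli, each u-integral is a translate of ∫ |p|⁻² e^{-δ|p|²}, whatever the position on the
segment. -/
lemma PropertyA.exists_kernelBounds {γ ρ α : ℝ} {ν : E3 → ℝ} {k : E3 → E3 → ℝ}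
    (hA : PropertyA γ ρ ν k) (hα₀ : 0 ≤ α) (hα₁ : α < (1 - ρ) / 2) :
    ∃ C : ℝ, KernelBounds γ α C k := by
  obtain ⟨C₀, hC₀, hk, hdk⟩ := hA.exists_bounds
  set δ := (1 - ρ) / 4 - α / 2 with hδdef
  have hδ : 0 < δ := by rw [hδdef]; linarith
  obtain ⟨C₁, hC₁, hW⟩ := exists_integral_singular_le hδ
  have hE := kernelGaussian_mul_exp_le hα₀ hα₁
  rw [← hδdef] at hE
  set P : E3 → ℝ := fun p => ‖p‖⁻¹ ^ 2 * Real.exp (-δ * ‖p‖ ^ 2) with hP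
  have iP : Integrable P := integrable_inv_sq_mul_exp hδ
  have P0 : ∀ p, 0 ≤ P p := fun p => by simp only [hP]; positivity
  set C₂ := ∫ p, P p with hC₂
  have hC₂0 : 0 ≤ C₂ := integral_nonneg P0
  have hkm : ∀ v, Measurable (k v) := fun v => hA.k_measurable.of_uncurry_left
  have hne : ∀ v : E3, ∀ᵐ u : E3, v ≠ u := fun v => by
    have : ∀ᵐ u : E3, u ≠ v := by simp [ae_iff]
    filter_upwards [this] with u hu using hu.symm
  have ptw : ∀ v, ∀ᵐ u : E3,
      |k v u| * Real.exp (-α * ‖u‖ ^ 2) * (1 + (1 + ‖u‖) / ‖u‖) ≤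
      C₀ * Real.exp (-α * ‖v‖ ^ 2) *
        (‖v - u‖⁻¹ * Real.exp (-δ * ‖v - u‖ ^ 2) * (2 + ‖u‖⁻¹)) := by
    intro v
    filter_upwards [hne v] with u hu
    have h1 : 1 + (1 + ‖u‖) / ‖u‖ ≤ 2 + ‖u‖⁻¹ := by
      rw [add_div, one_div]
      have := div_self_le_one ‖u‖
      linarith
    have h2 : |k v u| * Real.exp (-α * ‖u‖ ^ 2) ≤
        C₀ * (‖v - u‖⁻¹ * (Real.exp (-α * ‖v‖ ^ 2) * Real.exp (-δ * ‖v - u‖ ^ 2))) := by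
      calc _ ≤ C₀ * (‖v - u‖⁻¹ * kernelGaussian ρ v u) * Real.exp (-α * ‖u‖ ^ 2) :=
            mul_le_mul_of_nonneg_right (hk v u hu) (Real.exp_pos _).le
        _ = C₀ * (‖v - u‖⁻¹ * (kernelGaussian ρ v u * Real.exp (-α * ‖u‖ ^ 2))) := by ring
        _ ≤ _ := mul_le_mul_of_nonneg_left
            (mul_le_mul_of_nonneg_left (hE v u) (by positivity)) hC₀.le
    calc _ ≤ C₀ * (‖v - u‖⁻¹ * (Real.exp (-α * ‖v‖ ^ 2) * Real.exp (-δ * ‖v - u‖ ^ 2))) *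
          (2 + ‖u‖⁻¹) := mul_le_mul h2 h1 (by positivity) (by positivity)
      _ = _ := by ring
  have iK : ∀ v, Integrable
      (fun u => |k v u| * Real.exp (-α * ‖u‖ ^ 2) * (1 + (1 + ‖u‖) / ‖u‖)) := by
    intro v
    refine ((hW v).1.const_mul (C₀ * Real.exp (-α * ‖v‖ ^ 2))).mono' ?_ ?_
    · have := hkm v
      fun_prop
    · filter_upwards [ptw v] with u hu
      rw [Real.norm_of_nonneg (by positivity)]
      exact hu
  refine ⟨C₀ * C₁ + C₀ * C₂ + 1, hA.k_measurable, by positivity, iK, fun v => ?_,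
    fun v v' m hm => ?_⟩
  · refine (integral_mono_ae (iK v) ((hW v).1.const_mul _) (ptw v)).trans ?_
    rw [integral_const_mul]
    have h1 : C₀ * Real.exp (-α * ‖v‖ ^ 2) *
        ∫ u, ‖v - u‖⁻¹ * Real.exp (-δ * ‖v - u‖ ^ 2) * (2 + ‖u‖⁻¹) ≤
        C₀ * Real.exp (-α * ‖v‖ ^ 2) * C₁ :=
      mul_le_mul_of_nonneg_left (hW v).2 (by positivity)
    have h2 : 0 ≤ (C₀ * C₂ + 1) * Real.exp (-α * ‖v‖ ^ 2) := by positivity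
    linarith
  · have hm0 : 0 ≤ m := le_trans (by positivity) (hm 0 (by simp))
    set e := v' - v with he
    set D := C₀ * m * ‖e‖ with hD
    have hD0 : 0 ≤ D := by positivity
    -- pointwise mean value estimate off the line through `v` and `v'`
    have hpt : ∀ᵐ u : E3, ENNReal.ofReal (|k v' u - k v u| * Real.exp (-α * ‖u‖ ^ 2)) ≤
        ∫⁻ θ in Ioc (0 : ℝ) 1, ENNReal.ofReal (D * P (v + θ • e - u)) := by
      filter_upwards [show ∀ᵐ u : E3, u ∉ {u : E3 | ∃ θ : ℝ, v + θ • e = u} from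
        measure_eq_zero_iff_ae_notMem.mp (volume_line_eq_zero v e)] with u hu
      have hu' : ∀ θ : ℝ, v + θ • e ≠ u := fun θ h => hu ⟨θ, h⟩
      have hline : ∀ θ : ℝ, HasDerivAt (fun θ : ℝ => v + θ • e) e θ := fun θ => by
        simpa using ((hasDerivAt_id θ).smul_const e).const_add v
      have hder : ∀ θ : ℝ, HasDerivAt (fun θ : ℝ => k (v + θ • e) u)
          (fderiv ℝ (fun v' => k v' u) (v + θ • e) e) θ := fun θ =>
        HasFDerivAt.comp_hasDerivAt (f := fun θ : ℝ => v + θ • e) (l := fun v' => k v' u) θ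
          (hA.k_differentiable _ _ (hu' θ)).hasFDerivAt (hline θ)
      have hcont : Continuous fun θ : ℝ => P (v + θ • e - u) := by
        have h0 : ∀ θ : ℝ, ‖v + θ • e - u‖ ≠ 0 := fun θ =>
          norm_ne_zero_iff.mpr (sub_ne_zero.mpr (hu' θ))
        simp only [hP]
        refine Continuous.mul (Continuous.pow (Continuous.inv₀ (by fun_prop) h0) 2) (by fun_prop)
      -- The factor e^{α|u|²} is constant in θ; it is extracted to cancel the weight e^{-α|u|²}
      -- afterwards.
      have hB : ∀ θ ∈ Ioo (0 : ℝ) 1, ‖deriv (fun θ : ℝ => k (v + θ • e) u) θ‖ ≤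
          Real.exp (α * ‖u‖ ^ 2) * (D * P (v + θ • e - u)) := by
        intro θ hθ
        rw [(hder θ).deriv]
        refine (ContinuousLinearMap.le_opNorm _ _).trans ?_
        have h1 := hdk _ _ (hu' θ)
        have h2 := hE (v + θ • e) u
        have h3 := hm θ ⟨hθ.1.le, hθ.2.le⟩
        set y := v + θ • e
        have h4 : kernelGaussian ρ y u ≤ Real.exp (α * ‖u‖ ^ 2) *
            (Real.exp (-α * ‖y‖ ^ 2) * Real.exp (-δ * ‖y - u‖ ^ 2)) := by
          calc kernelGaussian ρ y u = Real.exp (α * ‖u‖ ^ 2) *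
                (kernelGaussian ρ y u * Real.exp (-α * ‖u‖ ^ 2)) := by
                have : Real.exp (α * ‖u‖ ^ 2) * Real.exp (-α * ‖u‖ ^ 2) = 1 := by
                  rw [← Real.exp_add, Real.exp_eq_one_iff]; ring
                linear_combination -kernelGaussian ρ y u * this
            _ ≤ _ := mul_le_mul_of_nonneg_left h2 (Real.exp_pos _).le
        calc ‖fderiv ℝ (fun v' => k v' u) y‖ * ‖e‖
            ≤ C₀ * ((1 + ‖y‖) ^ γ * ‖y - u‖⁻¹ ^ 2 * (Real.exp (α * ‖u‖ ^ 2) *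
            (Real.exp (-α * ‖y‖ ^ 2) * Real.exp (-δ * ‖y - u‖ ^ 2)))) * ‖e‖ := by
              refine mul_le_mul_of_nonneg_right (h1.trans ?_) (norm_nonneg _)
              gcongr
          _ = ((1 + ‖y‖) ^ γ * Real.exp (-α * ‖y‖ ^ 2)) *
              (C₀ * ‖e‖ * (Real.exp (α * ‖u‖ ^ 2) * P (y - u))) := by
              simp only [hP]; ring
          _ ≤ m * (C₀ * ‖e‖ * (Real.exp (α * ‖u‖ ^ 2) * P (y - u))) := by
              refine mul_le_mul_of_nonneg_right h3 ?_
              have := P0 (y - u); positivity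
          _ = _ := by rw [hD]; ring
      have hmv := norm_sub_le_integral_of_norm_deriv_le_of_le (a := 0) (b := 1) zero_le_one
        (f := fun θ : ℝ => k (v + θ • e) u)
        (fun θ _ => (hder θ).continuousAt.continuousWithinAt)
        (fun θ _ => (hder θ).differentiableAt.differentiableWithinAt)
        (Eventually.of_forall hB)
        ((continuous_const.mul (continuous_const.mul hcont)).intervalIntegrable 0 1)
      rw [intervalIntegral.integral_const_mul, intervalIntegral.integral_of_le zero_le_one] at hmv
      have hv'e : v + (1 : ℝ) • e = v' := by rw [he]; simp
      have hve : v + (0 : ℝ) • e = v := by simp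
      rw [hv'e, hve, Real.norm_eq_abs] at hmv
      have hfin : |k v' u - k v u| * Real.exp (-α * ‖u‖ ^ 2) ≤
          ∫ θ in Ioc (0 : ℝ) 1, D * P (v + θ • e - u) := by
        calc _ ≤ Real.exp (α * ‖u‖ ^ 2) * (∫ θ in Ioc (0 : ℝ) 1, D * P (v + θ • e - u)) *
              Real.exp (-α * ‖u‖ ^ 2) := mul_le_mul_of_nonneg_right hmv (Real.exp_pos _).le
          _ = _ := by
              have : Real.exp (α * ‖u‖ ^ 2) * Real.exp (-α * ‖u‖ ^ 2) = 1 := by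
                rw [← Real.exp_add, Real.exp_eq_one_iff]; ring
              linear_combination (∫ θ in Ioc (0 : ℝ) 1, D * P (v + θ • e - u)) * this
      refine (ENNReal.ofReal_le_ofReal hfin).trans (le_of_eq ?_)
      refine ofReal_integral_eq_lintegral_ofReal ?_ ?_
      · exact (continuous_const.mul hcont).integrableOn_Icc.mono_set Ioc_subset_Icc_self
      · exact Eventually.of_forall fun θ => mul_nonneg hD0 (P0 _)
    have hPm : Measurable P := by simp only [hP]; fun_prop
    have hlin : ∫⁻ u, ENNReal.ofReal (|k v' u - k v u| * Real.exp (-α * ‖u‖ ^ 2)) ≤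
        ENNReal.ofReal (D * C₂) := by
      calc _ ≤ ∫⁻ u, ∫⁻ θ in Ioc (0 : ℝ) 1, ENNReal.ofReal (D * P (v + θ • e - u)) :=
            lintegral_mono_ae hpt
        _ = ∫⁻ θ in Ioc (0 : ℝ) 1, ∫⁻ u, ENNReal.ofReal (D * P (v + θ • e - u)) := by
            refine lintegral_lintegral_swap (Measurable.aemeasurable ?_)
            refine ENNReal.measurable_ofReal.comp (measurable_const.mul (hPm.comp ?_))
            fun_prop
        _ = ∫⁻ θ in Ioc (0 : ℝ) 1, ENNReal.ofReal (D * C₂) := by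
            refine lintegral_congr fun θ => ?_
            rw [← ofReal_integral_eq_lintegral_ofReal ((iP.comp_sub_left _).const_mul D)
              (Eventually.of_forall fun u => mul_nonneg hD0 (P0 _)), integral_const_mul,
              integral_sub_left_eq_self P volume]
        _ = ENNReal.ofReal (D * C₂) := by simp
    rw [integral_eq_lintegral_of_nonneg_ae (Eventually.of_forall fun u => by positivity)
      (by have := hkm v; have := hkm v'; fun_prop)]
    refine (ENNReal.toReal_mono ENNReal.ofReal_ne_top hlin).trans ?_
    rw [ENNReal.toReal_ofReal (by positivity), hD]
    have : 0 ≤ (C₀ * C₁ + 1) * m * ‖e‖ := by positivity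
    linarith

/-! ### Slices of weak gradients -/

/-- Measurable representatives of a function and its weak spatial gradient, with pointwise bounds
that hold everywhere. -/
structure IsBoundedWeakPair (Ω : Set E3) (α M B : ℝ) (h : E3 × E3 → ℝ) (G : E3 × E3 → E3) :
    Prop where
  measurable : StronglyMeasurable h
  measurable_grad : StronglyMeasurable G
  bound : ∀ z, ‖h z‖ ≤ M * Real.exp (-α * ‖z.2‖ ^ 2)
  bound_grad : ∀ z, ‖G z‖ ≤ B * Real.exp (-α * ‖z.2‖ ^ 2) * (1 + (1 + ‖z.2‖) / ‖z.2‖) *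
    (Real.sqrt (Metric.infDist z.1 Ωᶜ))⁻¹
  weak : ∀ φ : E3 × E3 → ℝ, ContDiff ℝ (⊤ : ℕ∞) φ → HasCompactSupport φ →
    tsupport φ ⊆ Ω ×ˢ univ → ∀ e : E3, ∫ z in Ω ×ˢ univ, h z * fderiv ℝ φ z (e, 0) =
      - ∫ z in Ω ×ˢ univ, inner ℝ (G z) e * φ z

/-- Setting a measurable representative to zero where the bound fails changes it only on a null set;
later slices then carry the bound without exceptions. -/
lemma exists_stronglyMeasurable_bounded {X F : Type*} [MeasurableSpace X] {μ : Measure X}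
    [NormedAddCommGroup F] {f : X → F} (hf : AEStronglyMeasurable f μ) {b : X → ℝ}
    (hbm : Measurable b) (hb0 : ∀ z, 0 ≤ b z) (hb : ∀ᵐ z ∂μ, ‖f z‖ ≤ b z) :
    ∃ f₀ : X → F, StronglyMeasurable f₀ ∧ f₀ =ᵐ[μ] f ∧ ∀ z, ‖f₀ z‖ ≤ b z := by
  set g := hf.mk f
  have hgm : StronglyMeasurable g := hf.stronglyMeasurable_mk
  set s : Set X := {z | ‖g z‖ ≤ b z}
  have hs : MeasurableSet s := measurableSet_le hgm.norm.measurable hbm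
  refine ⟨s.indicator g, hgm.indicator hs, ?_, fun z => ?_⟩
  · filter_upwards [hf.ae_eq_mk, hb] with z hz hbz
    have : z ∈ s := by
      change ‖hf.mk f z‖ ≤ b z
      rw [← hz]; exact hbz
    rw [indicator_of_mem this, hz]
  · by_cases hz : z ∈ s
    · rw [indicator_of_mem hz]; exact hz
    · rw [indicator_of_notMem hz, norm_zero]; exact hb0 z

lemma locallyIntegrable_one_add_div :
    LocallyIntegrable (fun u : E3 => 1 + (1 + ‖u‖) / ‖u‖) := by
  have hQ : Integrable ((Metric.ball (0 : E3) 1).indicator (fun p => ‖p‖⁻¹ ^ 2)) :=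
    integrableOn_inv_sq.integrable_indicator measurableSet_ball
  have h1 : LocallyIntegrable (fun u : E3 =>
      (3 : ℝ) + (Metric.ball (0 : E3) 1).indicator (fun p => ‖p‖⁻¹ ^ 2) u) :=
    (locallyIntegrable_const 3).add hQ.locallyIntegrable
  refine h1.mono (Measurable.aestronglyMeasurable (by fun_prop)) (Eventually.of_forall fun u => ?_)
  rw [Real.norm_of_nonneg (by positivity), Real.norm_of_nonneg
    (add_nonneg (by norm_num) (indicator_nonneg (fun _ _ => by positivity) u)), add_div, one_div]
  have h2 := div_self_le_one ‖u‖
  have hb : 0 ≤ ‖u‖⁻¹ := by positivity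
  by_cases hu : u ∈ Metric.ball (0 : E3) 1
  · rw [indicator_of_mem hu]
    nlinarith [sq_nonneg (‖u‖⁻¹ - 1)]
  · rw [indicator_of_notMem hu]
    have h3 : ‖u‖⁻¹ ≤ 1 := by
      rw [mem_ball_zero_iff, not_lt] at hu
      exact inv_le_one_of_one_le₀ hu
    linarith

lemma exp_neg_mul_sq_le_one {α : ℝ} (hα : 0 ≤ α) (u : E3) : Real.exp (-α * ‖u‖ ^ 2) ≤ 1 := by
  rw [Real.exp_le_one_iff]
  nlinarith [sq_nonneg ‖u‖]

lemma exists_inv_sqrt_infDist_le {Ω : Set E3} {R r : ℝ} (hΩ : IsRollingDomain Ω R r)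
    {K : Set E3} (hK : IsCompact K) (hKΩ : K ⊆ Ω) :
    ∃ b : ℝ, 0 ≤ b ∧ ∀ x ∈ K, (Real.sqrt (Metric.infDist x Ωᶜ))⁻¹ ≤ b := by
  have hc : ContinuousOn (fun x => (Real.sqrt (Metric.infDist x Ωᶜ))⁻¹) K := by
    refine ContinuousOn.inv₀ ?_ fun x hx => (Real.sqrt_pos.mpr (hΩ.infDist_pos (hKΩ hx))).ne'
    exact (Real.continuous_sqrt.comp (Metric.continuous_infDist_pt _)).continuousOn
  obtain ⟨b, hb⟩ := hK.exists_bound_of_continuousOn hc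
  refine ⟨max b 0, le_max_right _ _, fun x hx => ?_⟩
  exact ((le_abs_self _).trans (hb x hx)).trans (le_max_left _ _)

/-- For almost every velocity, the slices of a weak pair are a function and its weak gradient. -/
lemma IsBoundedWeakPair.ae_slice {Ω : Set E3} {R r α M B : ℝ} {h : E3 × E3 → ℝ}
    {G : E3 × E3 → E3} (hΩ : IsRollingDomain Ω R r) (hα : 0 ≤ α) (hM : 0 ≤ M) (hB : 0 ≤ B)
    (hp : IsBoundedWeakPair Ω α M B h G) {φ : E3 → ℝ} (hφ : ContDiff ℝ (⊤ : ℕ∞) φ)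
    (hφc : HasCompactSupport φ) (hφΩ : tsupport φ ⊆ Ω) (e : E3) :
    ∀ᵐ u : E3, ∫ x, h (x, u) * fderiv ℝ φ x e = - ∫ x, inner ℝ (G (x, u)) e * φ x := by
  set K := tsupport φ with hK
  have hKc : IsCompact K := hφc
  set q : E3 → ℝ := fun u => 1 + (1 + ‖u‖) / ‖u‖ with hq
  have hq1 : ∀ u, 1 ≤ q u := fun u => le_add_of_nonneg_right (by positivity)
  obtain ⟨b, hb0, hb⟩ := exists_inv_sqrt_infDist_le hΩ hKc hφΩ
  have hφ'c : Continuous fun x => fderiv ℝ φ x e :=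
    (hφ.continuous_fderiv (by simp)).clm_apply continuous_const
  obtain ⟨c₁, hc₁⟩ := hφ.continuous.bounded_above_of_compact_support hφc
  have hφ'supp : Function.support (fun x => fderiv ℝ φ x e) ⊆ K := by
    intro x hx
    by_contra hxK
    apply hx
    change fderiv ℝ φ x e = 0
    rw [image_eq_zero_of_notMem_tsupport (fun h => hxK (tsupport_fderiv_subset ℝ h))]
    rfl
  obtain ⟨c₂, hc₂⟩ := hφ'c.bounded_above_of_compact_support
    (HasCompactSupport.intro hKc fun x hx => by
      by_contra h; exact hx (hφ'supp h))
  have hc₁0 : 0 ≤ c₁ := (norm_nonneg _).trans (hc₁ 0)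
  have hc₂0 : 0 ≤ c₂ := (norm_nonneg _).trans (hc₂ 0)
  -- the two integrands
  set F₁ : E3 × E3 → ℝ := fun z => h z * fderiv ℝ φ z.1 e with hF₁
  set F₂ : E3 × E3 → ℝ := fun z => inner ℝ (G z) e * φ z.1 with hF₂
  have mF₁ : StronglyMeasurable F₁ :=
    hp.measurable.mul (hφ'c.comp continuous_fst).stronglyMeasurable
  have mF₂ : StronglyMeasurable F₂ :=
    (hp.measurable_grad.inner stronglyMeasurable_const).mul
      (hφ.continuous.comp continuous_fst).stronglyMeasurable
  set D := M * c₂ + B * b * ‖e‖ * c₁ with hD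
  have hD0 : 0 ≤ D := by positivity
  have bF : ∀ z, ‖F₁ z‖ ≤ K.indicator (fun _ => D) z.1 * q z.2 ∧
      ‖F₂ z‖ ≤ K.indicator (fun _ => D) z.1 * q z.2 := by
    rintro ⟨x, u⟩
    have hE1 := exp_neg_mul_sq_le_one hα u
    have hE0 := (Real.exp_pos (-α * ‖u‖ ^ 2)).le
    have hqu := hq1 u
    by_cases hx : x ∈ K
    · simp only [indicator_of_mem hx, hF₁, hF₂, norm_mul]
      constructor
      · have h1 := hp.bound (x, u)
        have h2 := hc₂ x
        calc ‖h (x, u)‖ * ‖fderiv ℝ φ x e‖ ≤ (M * 1) * c₂ := by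
              refine mul_le_mul (h1.trans ?_) h2 (norm_nonneg _) (by positivity)
              exact mul_le_mul_of_nonneg_left hE1 hM
          _ ≤ D * 1 := by
              rw [hD]
              have : 0 ≤ B * b * ‖e‖ * c₁ := by positivity
              linarith
          _ ≤ D * q u := mul_le_mul_of_nonneg_left hqu hD0
      · have h1 := hp.bound_grad (x, u)
        have h2 := hc₁ x
        have h3 := hb x hx
        have h4 : ‖inner ℝ (G (x, u)) e‖ ≤ ‖G (x, u)‖ * ‖e‖ := norm_inner_le_norm _ _
        have h5 : ‖G (x, u)‖ ≤ B * 1 * q u * b := by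
          refine h1.trans ?_
          dsimp only
          gcongr
        calc ‖inner ℝ (G (x, u)) e‖ * ‖φ x‖ ≤ (B * 1 * q u * b * ‖e‖) * c₁ := by
              gcongr
              exact h4.trans (by gcongr)
          _ = (B * b * ‖e‖ * c₁) * q u := by ring
          _ ≤ D * q u := by
              refine mul_le_mul_of_nonneg_right ?_ (by linarith)
              rw [hD]
              have : 0 ≤ M * c₂ := by positivity
              linarith
    · have h1 : fderiv ℝ φ x e = 0 := by
        by_contra h; exact hx (hφ'supp h)
      have h2 : φ x = 0 := image_eq_zero_of_notMem_tsupport hx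
      simp [hF₁, hF₂, h1, h2, indicator_of_notMem hx]
  have iK : Integrable (K.indicator (fun _ => D) : E3 → ℝ) :=
    (integrable_indicator_iff hKc.measurableSet).mpr
      (integrableOn_const hKc.measure_lt_top.ne)
  have iF : ∀ {χ : E3 → ℝ}, Continuous χ → HasCompactSupport χ →
      Integrable (fun z : E3 × E3 => K.indicator (fun _ => D) z.1 * (q z.2 * ‖χ z.2‖))
        (volume.prod volume) := fun {χ} hχ hχc =>
    iK.mul_prod (g := fun u => q u * ‖χ u‖)
      ((locallyIntegrable_one_add_div.integrable_smul_left_of_hasCompactSupport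
        (g := fun u => ‖χ u‖) hχ.norm hχc.norm).congr
        (Eventually.of_forall fun u => by simp [hq, mul_comm]))
  -- The defect of the slice identity. Product test functions φ(x)χ(u) show that it is orthogonal to
  -- every χ, hence zero almost everywhere; the exceptional set may depend on φ.
  set P : E3 → ℝ := fun u => ∫ x, (F₁ (x, u) + F₂ (x, u)) with hP
  have mP : StronglyMeasurable P :=
    StronglyMeasurable.integral_prod_left (f := fun x u => F₁ (x, u) + F₂ (x, u)) (mF₁.add mF₂)
  have slice : ∀ u, Integrable (fun x => F₁ (x, u)) ∧ Integrable (fun x => F₂ (x, u)) := by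
    intro u
    constructor
    · exact (iK.mul_const (q u)).mono'
        (mF₁.comp_measurable (measurable_id.prodMk measurable_const)).aestronglyMeasurable
        (Eventually.of_forall fun x => (bF (x, u)).1)
    · exact (iK.mul_const (q u)).mono'
        (mF₂.comp_measurable (measurable_id.prodMk measurable_const)).aestronglyMeasurable
        (Eventually.of_forall fun x => (bF (x, u)).2)
  have hPli : LocallyIntegrable P := by
    set c := ∫ x, 2 * K.indicator (fun _ => D) x with hc
    refine (locallyIntegrable_one_add_div.smul c).mono mP.aestronglyMeasurable
      (Eventually.of_forall fun u => ?_)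
    have : ‖P u‖ ≤ ∫ x, 2 * K.indicator (fun _ => D) x * q u := by
      refine norm_integral_le_of_norm_le ((iK.const_mul 2).mul_const _)
        (Eventually.of_forall fun x => ?_)
      have := bF (x, u)
      exact (norm_add_le _ _).trans (by linarith [this.1, this.2])
    rw [integral_mul_const] at this
    refine this.trans ?_
    rw [Pi.smul_apply, norm_smul, Real.norm_eq_abs, Real.norm_eq_abs]
    exact mul_le_mul (le_abs_self _) (le_abs_self _) (by have := hq1 u; positivity) (abs_nonneg _)
  have hzero : ∀ᵐ u, P u = 0 := by
    refine ae_eq_zero_of_integral_contDiff_smul_eq_zero hPli fun χ hχ hχc => ?_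
    set ψ : E3 × E3 → ℝ := fun z => φ z.1 * χ z.2 with hψ
    have hψs : ContDiff ℝ (⊤ : ℕ∞) ψ := (hφ.comp contDiff_fst).mul (hχ.comp contDiff_snd)
    have hψsupp : Function.support ψ ⊆ K ×ˢ tsupport χ := by
      intro z hz
      have hz' : φ z.1 * χ z.2 ≠ 0 := hz
      exact ⟨subset_tsupport _ (left_ne_zero_of_mul hz'),
        subset_tsupport _ (right_ne_zero_of_mul hz')⟩
    have hψt : tsupport ψ ⊆ K ×ˢ tsupport χ :=
      closure_minimal hψsupp ((isClosed_tsupport _).prod (isClosed_tsupport _))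
    have hψc : HasCompactSupport ψ :=
      (hKc.prod hχc).of_isClosed_subset (isClosed_tsupport _) hψt
    have hw := hp.weak ψ hψs hψc (hψt.trans (prod_mono hφΩ (subset_univ _))) e
    have hdψ : ∀ z, fderiv ℝ ψ z (e, 0) = fderiv ℝ φ z.1 e * χ z.2 := by
      intro z
      have d1 : HasFDerivAt (fun z : E3 × E3 => φ z.1)
          ((fderiv ℝ φ z.1).comp (ContinuousLinearMap.fst ℝ E3 E3)) z :=
        ((hφ.differentiable (by simp)) z.1).hasFDerivAt.comp z hasFDerivAt_fst
      have d2 : HasFDerivAt (fun z : E3 × E3 => χ z.2)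
          ((fderiv ℝ χ z.2).comp (ContinuousLinearMap.snd ℝ E3 E3)) z :=
        ((hχ.differentiable (by simp)) z.2).hasFDerivAt.comp z hasFDerivAt_snd
      have d3 : HasFDerivAt ψ _ z := d1.mul d2
      rw [d3.fderiv]
      simp [mul_comm]
    have e1 : ∀ z, h z * fderiv ℝ ψ z (e, 0) = χ z.2 * F₁ z := fun z => by
      rw [hdψ]; simp only [hF₁]; ring
    have e2 : ∀ z, inner ℝ (G z) e * ψ z = χ z.2 * F₂ z := fun z => by
      simp only [hF₂, hψ]; ring
    simp only [e1, e2] at hw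
    have supp : ∀ F : E3 × E3 → ℝ, (∀ z, ‖F z‖ ≤ K.indicator (fun _ => D) z.1 * q z.2) →
        ∫ z in Ω ×ˢ univ, χ z.2 * F z = ∫ z, χ z.2 * F z := by
      intro F hF
      refine setIntegral_eq_integral_of_forall_compl_eq_zero fun z hz => ?_
      have hz1 : z.1 ∉ K := fun h => hz ⟨hφΩ h, mem_univ _⟩
      have := hF z
      rw [indicator_of_notMem hz1, zero_mul, norm_le_zero_iff] at this
      rw [this, mul_zero]
    rw [supp F₁ fun z => (bF z).1, supp F₂ fun z => (bF z).2] at hw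
    have iχ : ∀ F : E3 × E3 → ℝ, StronglyMeasurable F →
        (∀ z, ‖F z‖ ≤ K.indicator (fun _ => D) z.1 * q z.2) →
        Integrable (fun z => χ z.2 * F z) (volume.prod volume) := by
      intro F hFm hF
      refine (iF hχ.continuous hχc).mono'
        ((hχ.continuous.comp continuous_snd).stronglyMeasurable.mul hFm).aestronglyMeasurable
        (Eventually.of_forall fun z => ?_)
      rw [norm_mul, mul_comm ‖χ z.2‖, ← mul_assoc]
      exact mul_le_mul_of_nonneg_right (hF z) (norm_nonneg _)
    have i1 := iχ F₁ mF₁ fun z => (bF z).1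
    have i2 := iχ F₂ mF₂ fun z => (bF z).2
    have hsum : ∫ z : E3 × E3, χ z.2 * (F₁ z + F₂ z) ∂(volume.prod volume) = 0 := by
      simp only [mul_add]
      rw [integral_add i1 i2]
      have hw' : ∫ z : E3 × E3, χ z.2 * F₁ z ∂(volume.prod volume) =
        -∫ z : E3 × E3, χ z.2 * F₂ z ∂(volume.prod volume) := hw
      rw [hw', neg_add_cancel]
    rw [integral_prod_symm _ ((i1.add i2).congr
      (Eventually.of_forall fun z => (mul_add _ _ _).symm))] at hsum
    rw [← hsum]
    refine integral_congr_ae (Eventually.of_forall fun u => ?_)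
    simp only [hP, smul_eq_mul]
    rw [integral_const_mul]
  filter_upwards [hzero] with u hu
  rw [hP] at hu
  simp only at hu
  rw [integral_add (slice u).1 (slice u).2] at hu
  exact eq_neg_of_add_eq_zero_left hu

/-! ### Mollification along segments -/

/-- The average of the translates of `g` along the segment from `y` to `y + e`. -/
def segmentAverage (g : E3 → ℝ) (y e : E3) : E3 → ℝ :=
  fun z => ∫ θ in (0 : ℝ)..1, g (z - (y + θ • e))

/-- Convolution with the image of Lebesgue measure on (0,1] spread along the segment; smoothness is
inherited from g. -/
lemma segmentAverage_eq_convolution (g : E3 → ℝ) (hg : Continuous g) (y e : E3) :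
    segmentAverage g y e = MeasureTheory.convolution (fun _ => (1 : ℝ)) g
      (ContinuousLinearMap.lsmul ℝ ℝ)
      ((volume.restrict (Ioc (0 : ℝ) 1)).map (fun θ : ℝ => y + θ • e)) := by
  funext z
  rw [segmentAverage, convolution_def, integral_map (by fun_prop)
    (by apply Continuous.aestronglyMeasurable; simp; fun_prop),
    intervalIntegral.integral_of_le zero_le_one]
  simp

lemma contDiff_segmentAverage {g : E3 → ℝ} (hg : ContDiff ℝ (⊤ : ℕ∞) g)
    (hgc : HasCompactSupport g) (y e : E3) :
    ContDiff ℝ (⊤ : ℕ∞) (segmentAverage g y e) := by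
  rw [segmentAverage_eq_convolution g hg.continuous]
  have : IsFiniteMeasure ((volume.restrict (Ioc (0 : ℝ) 1)).map (fun θ : ℝ => y + θ • e)) :=
    inferInstance
  exact hgc.contDiff_convolution_right _ (locallyIntegrable_const 1) hg

/-- The reason for averaging along a segment: the derivative in its direction telescopes to a
difference of two translates of g. Thus a difference of mollified values is a weak derivative tested
against an admissible function. -/
lemma fderiv_segmentAverage {g : E3 → ℝ} (hg : ContDiff ℝ (⊤ : ℕ∞) g)
    (hgc : HasCompactSupport g) (y e z : E3) :
    fderiv ℝ (segmentAverage g y e) z e = g (z - y) - g (z - (y + e)) := by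
  have hd : DifferentiableAt ℝ (segmentAverage g y e) z :=
    (contDiff_segmentAverage hg hgc y e).differentiable (by simp) z
  have hline : HasDerivAt (fun t : ℝ => z + t • e) e 0 := by
    simpa using ((hasDerivAt_id (0 : ℝ)).smul_const e).const_add z
  have h1 : HasDerivAt (fun t : ℝ => segmentAverage g y e (z + t • e))
      (fderiv ℝ (segmentAverage g y e) z e) 0 := by
    refine HasFDerivAt.comp_hasDerivAt (f := fun t : ℝ => z + t • e) (l := segmentAverage g y e)
      (0 : ℝ) ?_ hline
    simpa using hd.hasFDerivAt
  set p : ℝ → ℝ := fun s => g (z - (y + s • e)) with hp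
  have hpc : Continuous p := by have := hg.continuous; fun_prop
  -- Moving z along e only shifts the interval of integration, so just the endpoints contribute to
  -- the derivative.
  have h2 : ∀ t : ℝ, segmentAverage g y e (z + t • e) = ∫ s in (0 - t)..(1 - t), p s := by
    intro t
    rw [segmentAverage, ← intervalIntegral.integral_comp_sub_right (f := p)]
    refine intervalIntegral.integral_congr fun θ _ => ?_
    simp only [hp]
    congr 1
    module
  have h3 : HasDerivAt (fun t : ℝ => ∫ s in (0 - t)..(1 - t), p s) (p 0 - p 1) 0 := by
    have hF : ∀ x : ℝ, HasDerivAt (fun x => ∫ s in (0 : ℝ)..x, p s) (p x) x := fun x =>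
      hpc.integral_hasStrictDerivAt 0 x |>.hasDerivAt
    have ha : HasDerivAt (fun t : ℝ => (0 : ℝ) - t) (-1) 0 := by
      simpa using (hasDerivAt_id (0 : ℝ)).const_sub 0
    have hb : HasDerivAt (fun t : ℝ => (1 : ℝ) - t) (-1) 0 := by
      simpa using (hasDerivAt_id (0 : ℝ)).const_sub 1
    have hA := HasDerivAt.comp (h := fun t : ℝ => (0 : ℝ) - t)
      (h₂ := fun x => ∫ s in (0 : ℝ)..x, p s) 0 (hF _) ha
    have hB := HasDerivAt.comp (h := fun t : ℝ => (1 : ℝ) - t)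
      (h₂ := fun x => ∫ s in (0 : ℝ)..x, p s) 0 (hF _) hb
    have hBA := hB.sub hA
    refine (hBA.congr_of_eventuallyEq (Eventually.of_forall fun t => ?_)).congr_deriv ?_
    · simp only [Pi.sub_apply, Function.comp]
      rw [intervalIntegral.integral_interval_sub_left (hpc.intervalIntegrable _ _)
        (hpc.intervalIntegrable _ _)]
    · simp only [sub_zero]
      ring
  have h4 := h1.unique (h3.congr_of_eventuallyEq (Eventually.of_forall h2))
  rw [h4]
  simp [hp]

lemma support_segmentAverage_subset {g : E3 → ℝ} {ε : ℝ}
    (hgs : ∀ p, ε ≤ ‖p‖ → g p = 0) {x y z : E3}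
    (hz : segmentAverage g y (x - y) z ≠ 0) : ∃ p ∈ segment ℝ y x, ‖z - p‖ < ε := by
  by_contra! hcon
  apply hz
  rw [segmentAverage]
  refine (intervalIntegral.integral_congr (g := fun _ => (0 : ℝ)) fun θ hθ => ?_).trans (by simp)
  rw [uIcc_of_le zero_le_one] at hθ
  refine hgs _ (hcon _ ?_)
  rw [segment_eq_image']
  exact ⟨θ, hθ, rfl⟩

lemma integral_segmentAverage {g : E3 → ℝ} (hg : Continuous g) (hgc : HasCompactSupport g)
    (y e : E3) :
    ∫ z, segmentAverage g y e z = ∫ z, g z := by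
  have hgi : Integrable g := hg.integrable_of_hasCompactSupport hgc
  have hswap : ∫ z, ∫ θ in Ioc (0 : ℝ) 1, g (z - (y + θ • e)) =
      ∫ θ in Ioc (0 : ℝ) 1, ∫ z, g (z - (y + θ • e)) := by
    refine integral_integral_swap ?_
    refine (integrable_prod_iff' ?_).mpr ⟨?_, ?_⟩
    · apply Continuous.aestronglyMeasurable
      simp only [Function.uncurry_def]; fun_prop
    · exact Eventually.of_forall fun θ => hgi.comp_sub_right (y + θ • e)
    · have : ∀ θ : ℝ, ∫ z, ‖Function.uncurry (fun z (θ : ℝ) => g (z - (y + θ • e))) (z, θ)‖ =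
          ∫ z, ‖g z‖ := fun θ => integral_sub_right_eq_self (fun z => ‖g z‖) (y + θ • e)
      simp only [this]
      exact integrable_const _
  simp only [segmentAverage, intervalIntegral.integral_of_le zero_le_one]
  rw [hswap]
  have : ∀ θ : ℝ, ∫ z, g (z - (y + θ • e)) = ∫ z, g z := fun θ =>
    integral_sub_right_eq_self g (y + θ • e)
  simp [this]

/-- A mollified weak pair is Lipschitz in space, with the constant given by the gradient bound. -/
lemma IsBoundedWeakPair.ae_abs_integral_sub_le {Ω : Set E3} {R r α M B : ℝ} {h : E3 × E3 → ℝ}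
    {G : E3 × E3 → E3} (hΩ : IsRollingDomain Ω R r) (hα : 0 ≤ α) (hM : 0 ≤ M) (hB : 0 ≤ B)
    (hp : IsBoundedWeakPair Ω α M B h G) {g : E3 → ℝ} (hg : ContDiff ℝ (⊤ : ℕ∞) g)
    (hgc : HasCompactSupport g) (hg0 : ∀ p, 0 ≤ g p) (hg1 : ∫ p, g p = 1) {ε δ : ℝ}
    (hgs : ∀ p, ε ≤ ‖p‖ → g p = 0) {x y : E3} (hx : x ∈ Ω) (hy : y ∈ Ω)
    (hε : ε < δ)
    (hδ : δ ≤ min (Metric.infDist x Ωᶜ) (Metric.infDist y Ωᶜ)) :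
    ∀ᵐ u : E3, |∫ z, (g (z - x) - g (z - y)) * h (z, u)| ≤
      B * Real.exp (-α * ‖u‖ ^ 2) * (1 + (1 + ‖u‖) / ‖u‖) * (Real.sqrt (δ - ε))⁻¹ * ‖x - y‖ := by
  set Φ := segmentAverage g y (x - y) with hΦ
  have hΦs := contDiff_segmentAverage hg hgc y (x - y)
  have hΦ0 : ∀ z, 0 ≤ Φ z := fun z =>
    intervalIntegral.integral_nonneg zero_le_one fun θ _ => hg0 _
  -- the support of `Φ` stays at distance `δ - ε` from the boundary
  have hdist : ∀ z ∈ tsupport Φ, δ - ε ≤ Metric.infDist z Ωᶜ := by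
    have hcl : IsClosed {z : E3 | δ - ε ≤ Metric.infDist z Ωᶜ} :=
      isClosed_le continuous_const (Metric.continuous_infDist_pt _)
    refine fun z hz => closure_minimal (fun z hz => ?_) hcl hz
    obtain ⟨p, hp, hzp⟩ := support_segmentAverage_subset hgs hz
    -- By concavity the distance to the complement along a segment is at least its smaller endpoint
    -- value; the mollification radius costs ε.
    have h1 := hΩ.min_infDist_le_of_mem_segment hy hx hp
    have h2 := Metric.infDist_le_infDist_add_dist (s := Ωᶜ) (x := p) (y := z)
    rw [dist_comm, dist_eq_norm] at h2
    rw [min_comm] at h1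
    change δ - ε ≤ Metric.infDist z Ωᶜ
    linarith
  have hsub : tsupport Φ ⊆ Ω := by
    intro z hz
    by_contra hzΩ
    have h1 := hdist z hz
    rw [Metric.infDist_zero_of_mem (show z ∈ Ωᶜ from hzΩ)] at h1
    linarith
  have hΦc : HasCompactSupport Φ :=
    Metric.isCompact_of_isClosed_isBounded (isClosed_tsupport _) (hΩ.isBounded.subset hsub)
  filter_upwards [hp.ae_slice hΩ hα hM hB hΦs hΦc hsub (x - y)] with u hu
  have h1 : ∫ z, (g (z - x) - g (z - y)) * h (z, u) = ∫ z, inner ℝ (G (z, u)) (x - y) * Φ z := by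
    rw [← neg_eq_iff_eq_neg] at hu
    rw [← hu, ← integral_neg]
    refine integral_congr_ae (Eventually.of_forall fun z => ?_)
    simp only
    rw [fderiv_segmentAverage hg hgc, add_sub_cancel]
    ring
  rw [h1]
  set b := B * Real.exp (-α * ‖u‖ ^ 2) * (1 + (1 + ‖u‖) / ‖u‖) * (Real.sqrt (δ - ε))⁻¹ *
    ‖x - y‖ with hb
  have hint : Integrable fun z => b * Φ z :=
    (hΦs.continuous.integrable_of_hasCompactSupport hΦc).const_mul b
  calc |∫ z, inner ℝ (G (z, u)) (x - y) * Φ z| ≤ ∫ z, b * Φ z := by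
        rw [← Real.norm_eq_abs]
        refine norm_integral_le_of_norm_le hint (Eventually.of_forall fun z => ?_)
        by_cases hz : z ∈ tsupport Φ
        · rw [norm_mul, Real.norm_of_nonneg (hΦ0 z)]
          refine mul_le_mul_of_nonneg_right ?_ (hΦ0 z)
          refine (norm_inner_le_norm _ _).trans (mul_le_mul_of_nonneg_right ?_ (norm_nonneg _))
          refine (hp.bound_grad (z, u)).trans ?_
          refine mul_le_mul_of_nonneg_left ?_ (by positivity)
          exact inv_anti₀ (Real.sqrt_pos.mpr (by linarith)) (Real.sqrt_le_sqrt (hdist z hz))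
        · rw [image_eq_zero_of_notMem_tsupport hz]; simp
    _ = b := by
        rw [integral_const_mul, hΦ, integral_segmentAverage hg.continuous hgc, hg1, mul_one]

/-! ### The regular representative of `K h` -/

/-- Pointwise regularity of a function on phase space: size, spatial Lipschitz bound degenerating
at the boundary, and velocity Lipschitz bound. -/
structure IsRegularSource (Ω : Set E3) (γ α m₀ m₁ : ℝ) (g : E3 → E3 → ℝ) : Prop where
  nonneg₀ : 0 ≤ m₀
  nonneg₁ : 0 ≤ m₁
  bound : ∀ x v, |g x v| ≤ m₀ * Real.exp (-α * ‖v‖ ^ 2)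
  lipschitz_x : ∀ x ∈ Ω, ∀ y ∈ Ω, ∀ v, |g x v - g y v| ≤
    m₁ * Real.exp (-α * ‖v‖ ^ 2) *
      (Real.sqrt (min (Metric.infDist x Ωᶜ) (Metric.infDist y Ωᶜ)))⁻¹ * ‖x - y‖
  lipschitz_v : ∀ x v v' m, (∀ θ ∈ Icc (0 : ℝ) 1,
      (1 + ‖v + θ • (v' - v)‖) ^ γ * Real.exp (-α * ‖v + θ • (v' - v)‖ ^ 2) ≤ m) →
    |g x v' - g x v| ≤ m₀ * m * ‖v' - v‖

section

variable {Ω : Set E3} {R r γ α M B C : ℝ} {h : E3 × E3 → ℝ} {G : E3 × E3 → E3}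
  {k : E3 → E3 → ℝ}

lemma KernelBounds.integrable_abs (hk : KernelBounds γ α C k) (v : E3) :
    Integrable (fun u => |k v u| * Real.exp (-α * ‖u‖ ^ 2)) := by
  have hkm : Measurable (k v) := hk.measurable.of_uncurry_left
  refine (hk.integrable v).mono' (by fun_prop) (Eventually.of_forall fun u => ?_)
  rw [Real.norm_of_nonneg (by positivity)]
  exact le_mul_of_one_le_right (by positivity) (le_add_of_nonneg_right (by positivity))

lemma KernelBounds.integral_abs_le (hk : KernelBounds γ α C k) (v : E3) :
    ∫ u, |k v u| * Real.exp (-α * ‖u‖ ^ 2) ≤ C * Real.exp (-α * ‖v‖ ^ 2) := by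
  refine (integral_mono (hk.integrable_abs v) (hk.integrable v) fun u => ?_).trans
    (hk.integral_le v)
  exact le_mul_of_one_le_right (by positivity) (le_add_of_nonneg_right (by positivity))

lemma KernelBounds.integrable_mul (hk : KernelBounds γ α C k) {f : E3 → ℝ} (v : E3)
    (hf : AEStronglyMeasurable f) (hb : ∀ᵐ u, ‖f u‖ ≤ M * Real.exp (-α * ‖u‖ ^ 2)) :
    Integrable (fun u => k v u * f u) := by
  have hkm : Measurable (k v) := hk.measurable.of_uncurry_left
  refine ((hk.integrable_abs v).const_mul M).mono' (hkm.aestronglyMeasurable.mul hf) ?_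
  filter_upwards [hb] with u hu
  rw [norm_mul, Real.norm_eq_abs]
  calc |k v u| * ‖f u‖ ≤ |k v u| * (M * Real.exp (-α * ‖u‖ ^ 2)) :=
        mul_le_mul_of_nonneg_left hu (abs_nonneg _)
    _ = _ := by ring

lemma IsBoundedWeakPair.measurable_slice (hp : IsBoundedWeakPair Ω α M B h G) (x : E3) :
    AEStronglyMeasurable fun u => h (x, u) :=
  (hp.measurable.comp_measurable (measurable_const.prodMk measurable_id)).aestronglyMeasurable

lemma IsBoundedWeakPair.integrable_mul (hp : IsBoundedWeakPair Ω α M B h G)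
    (hk : KernelBounds γ α C k) (x v : E3) : Integrable (fun u => k v u * h (x, u)) :=
  hk.integrable_mul v (hp.measurable_slice x) (Eventually.of_forall fun u => hp.bound (x, u))

lemma IsBoundedWeakPair.abs_opK_le (hp : IsBoundedWeakPair Ω α M B h G) (hM : 0 ≤ M)
    (hk : KernelBounds γ α C k) (x v : E3) :
    |opK k h (x, v)| ≤ C * M * Real.exp (-α * ‖v‖ ^ 2) := by
  have h1 : ‖opK k h (x, v)‖ ≤ ∫ u, M * (|k v u| * Real.exp (-α * ‖u‖ ^ 2)) := by
    refine norm_integral_le_of_norm_le ((hk.integrable_abs v).const_mul M)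
      (Eventually.of_forall fun u => ?_)
    rw [norm_mul, Real.norm_eq_abs]
    calc |k v u| * ‖h (x, u)‖ ≤ |k v u| * (M * Real.exp (-α * ‖u‖ ^ 2)) :=
          mul_le_mul_of_nonneg_left (hp.bound (x, u)) (abs_nonneg _)
      _ = _ := by ring
  rw [integral_const_mul] at h1
  refine h1.trans ((mul_le_mul_of_nonneg_left (hk.integral_abs_le v) hM).trans (le_of_eq ?_))
  ring

/-- The increment in v falls entirely on the kernel, so only the size of h enters. -/
lemma IsBoundedWeakPair.abs_opK_sub_le (hp : IsBoundedWeakPair Ω α M B h G) (hM : 0 ≤ M)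
    (hk : KernelBounds γ α C k) (x v v' : E3) (m : ℝ) (hm : ∀ θ ∈ Icc (0 : ℝ) 1,
      (1 + ‖v + θ • (v' - v)‖) ^ γ * Real.exp (-α * ‖v + θ • (v' - v)‖ ^ 2) ≤ m) :
    |opK k h (x, v') - opK k h (x, v)| ≤ C * M * m * ‖v' - v‖ := by
  have i1 := hp.integrable_mul hk x v'
  have i2 := hp.integrable_mul hk x v
  have hkm : ∀ v, Measurable (k v) := fun v => hk.measurable.of_uncurry_left
  have hi : Integrable fun u => |k v' u - k v u| * Real.exp (-α * ‖u‖ ^ 2) := by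
    refine ((hk.integrable_abs v').add (hk.integrable_abs v)).mono' ?_
      (Eventually.of_forall fun u => ?_)
    · have := hkm v; have := hkm v'; fun_prop
    · rw [Real.norm_of_nonneg (by positivity), Pi.add_apply, ← add_mul]
      exact mul_le_mul_of_nonneg_right (abs_sub _ _) (Real.exp_pos _).le
  rw [opK, opK, ← integral_sub i1 i2, ← Real.norm_eq_abs]
  have h1 : ‖∫ u, (k v' u * h (x, u) - k v u * h (x, u))‖ ≤
      ∫ u, M * (|k v' u - k v u| * Real.exp (-α * ‖u‖ ^ 2)) := by
    refine norm_integral_le_of_norm_le (hi.const_mul M) (Eventually.of_forall fun u => ?_)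
    rw [← sub_mul, norm_mul, Real.norm_eq_abs]
    calc |k v' u - k v u| * ‖h (x, u)‖ ≤
          |k v' u - k v u| * (M * Real.exp (-α * ‖u‖ ^ 2)) :=
          mul_le_mul_of_nonneg_left (hp.bound (x, u)) (abs_nonneg _)
      _ = _ := by ring
  rw [integral_const_mul] at h1
  refine h1.trans ((mul_le_mul_of_nonneg_left (hk.integral_sub_le v v' m hm) hM).trans
    (le_of_eq ?_))
  ring

lemma IsBoundedWeakPair.stronglyMeasurable_opK (hp : IsBoundedWeakPair Ω α M B h G)
    (hk : KernelBounds γ α C k) : StronglyMeasurable (opK k h) := by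
  refine StronglyMeasurable.integral_prod_right
    (f := fun (z : E3 × E3) u => k z.2 u * h (z.1, u)) ?_
  refine StronglyMeasurable.mul ?_ ?_
  · exact (hk.measurable.comp
      ((measurable_snd.comp measurable_fst).prodMk measurable_snd)).stronglyMeasurable
  · exact hp.measurable.comp_measurable
      ((measurable_fst.comp measurable_fst).prodMk measurable_snd)

/-- Fubini moves the mollification onto h(·,u), where the estimate holds for almost every u; its
singular factor in u is then integrated against k. -/
lemma IsBoundedWeakPair.abs_integral_opK_sub_le (hΩ : IsRollingDomain Ω R r) (hα : 0 ≤ α)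
    (hM : 0 ≤ M) (hB : 0 ≤ B) (hp : IsBoundedWeakPair Ω α M B h G) (hk : KernelBounds γ α C k)
    {g : E3 → ℝ} (hg : ContDiff ℝ (⊤ : ℕ∞) g)
    (hgc : HasCompactSupport g) (hg0 : ∀ p, 0 ≤ g p) (hg1 : ∫ p, g p = 1) {ε δ : ℝ}
    (hgs : ∀ p, ε ≤ ‖p‖ → g p = 0) {x y : E3} (hx : x ∈ Ω) (hy : y ∈ Ω)
    (hε : ε < δ)
    (hδ : δ ≤ min (Metric.infDist x Ωᶜ) (Metric.infDist y Ωᶜ)) (v : E3) :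
    |∫ z, (g (z - x) - g (z - y)) * opK k h (z, v)| ≤
      C * B * Real.exp (-α * ‖v‖ ^ 2) * (Real.sqrt (δ - ε))⁻¹ * ‖x - y‖ := by
  have hkm : Measurable (k v) := hk.measurable.of_uncurry_left
  have hgi : Integrable g := hg.continuous.integrable_of_hasCompactSupport hgc
  set η : E3 → ℝ := fun z => g (z - x) - g (z - y) with hη
  have hηi : Integrable η := (hgi.comp_sub_right x).sub (hgi.comp_sub_right y)
  have hηc : Continuous η := by have := hg.continuous; fun_prop
  have hswap : ∫ z, η z * opK k h (z, v) = ∫ u, k v u * ∫ z, η z * h (z, u) := by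
    simp only [opK, ← integral_const_mul]
    rw [integral_integral_swap]
    · refine integral_congr_ae (Eventually.of_forall fun u => ?_)
      refine integral_congr_ae (Eventually.of_forall fun z => ?_)
      simp only; ring
    · refine (hηi.norm.mul_prod ((hk.integrable_abs v).const_mul M)).mono' ?_
        (Eventually.of_forall fun z => ?_)
      · refine AEStronglyMeasurable.mul
          (hηc.comp continuous_fst).aestronglyMeasurable (AEStronglyMeasurable.mul ?_ ?_)
        · exact (hkm.comp measurable_snd).aestronglyMeasurable
        · exact hp.measurable.aestronglyMeasurable
      · simp only [Function.uncurry, norm_mul]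
        refine mul_le_mul_of_nonneg_left ?_ (norm_nonneg _)
        rw [Real.norm_eq_abs (k v z.2)]
        calc |k v z.2| * ‖h (z.1, z.2)‖ ≤ |k v z.2| * (M * Real.exp (-α * ‖z.2‖ ^ 2)) :=
              mul_le_mul_of_nonneg_left (hp.bound (z.1, z.2)) (abs_nonneg _)
          _ = _ := by ring
  rw [hswap, ← Real.norm_eq_abs]
  set c := B * (Real.sqrt (δ - ε))⁻¹ * ‖x - y‖ with hc
  have hc0 : 0 ≤ c := by positivity
  have h1 : ‖∫ u, k v u * ∫ z, η z * h (z, u)‖ ≤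
      ∫ u, c * (|k v u| * Real.exp (-α * ‖u‖ ^ 2) * (1 + (1 + ‖u‖) / ‖u‖)) := by
    refine norm_integral_le_of_norm_le ((hk.integrable v).const_mul c) ?_
    filter_upwards [hp.ae_abs_integral_sub_le hΩ hα hM hB hg hgc hg0 hg1 hgs hx hy hε hδ] with u hu
    rw [norm_mul, Real.norm_eq_abs, Real.norm_eq_abs]
    refine (mul_le_mul_of_nonneg_left hu (abs_nonneg _)).trans (le_of_eq ?_)
    rw [hc]; ring
  rw [integral_const_mul] at h1
  refine h1.trans ((mul_le_mul_of_nonneg_left (hk.integral_le v) hc0).trans (le_of_eq ?_))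
  rw [hc]; ring

/-- All bounds hold for the mollifications uniformly and survive any pointwise limit. An ultrafilter
limit exists at every point by compactness, so no null set interferes with the Lipschitz bounds, and
at Lebesgue points it agrees with K h. -/
lemma IsBoundedWeakPair.exists_regularSource (hΩ : IsRollingDomain Ω R r) (hα : 0 ≤ α)
    (hM : 0 ≤ M) (hB : 0 ≤ B) (hp : IsBoundedWeakPair Ω α M B h G)
    (hk : KernelBounds γ α C k) :
    ∃ g : E3 → E3 → ℝ, IsRegularSource Ω γ α (C * M) (C * B) g ∧
      ∀ v, ∀ᵐ x, g x v = opK k h (x, v) := by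
  have hC := hk.pos
  let b : ℕ → ContDiffBump (0 : E3) := fun n =>
    { rIn := 1 / (n + 1 : ℝ) / 2
      rOut := 1 / (n + 1 : ℝ)
      rIn_pos := by positivity
      rIn_lt_rOut := half_lt_self (by positivity) }
  have hrOut : ∀ n, (b n).rOut = 1 / (n + 1 : ℝ) := fun n => rfl
  have htend : Tendsto (fun n => (b n).rOut) atTop (𝓝 0) := tendsto_one_div_add_atTop_nhds_zero_nat
  set ρ : ℕ → E3 → ℝ := fun n => (b n).normed volume with hρ
  have ρs : ∀ n, ContDiff ℝ (⊤ : ℕ∞) (ρ n) := fun n => (b n).contDiff_normed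
  have ρc : ∀ n, HasCompactSupport (ρ n) := fun n => (b n).hasCompactSupport_normed
  have ρ0 : ∀ n p, 0 ≤ ρ n p := fun n p => (b n).nonneg_normed p
  have ρ1 : ∀ n, ∫ p, ρ n p = 1 := fun n => (b n).integral_normed
  have ρsupp : ∀ n p, (b n).rOut ≤ ‖p‖ → ρ n p = 0 := by
    intro n p hp
    rw [← Function.notMem_support, hρ, (b n).support_normed_eq, mem_ball_zero_iff, not_lt]
    exact hp
  have ρi : ∀ n (x : E3), Integrable fun z => ρ n (z - x) := fun n x =>
    ((ρs n).continuous.integrable_of_hasCompactSupport (ρc n)).comp_sub_right x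
  have ρ1' : ∀ n (x : E3), ∫ z, ρ n (z - x) = 1 := fun n x => by
    rw [integral_sub_right_eq_self (ρ n) x, ρ1]
  have Km : ∀ v, StronglyMeasurable fun z => opK k h (z, v) := fun v =>
    (hp.stronglyMeasurable_opK hk).comp_measurable (measurable_id.prodMk measurable_const)
  set a : ℕ → E3 → E3 → ℝ := fun n x v => ∫ z, ρ n (z - x) * opK k h (z, v) with ha
  have ai : ∀ n x v, Integrable fun z => ρ n (z - x) * opK k h (z, v) := fun n x v =>
    (ρi n x).mul_bdd (Km v).aestronglyMeasurable
      (Eventually.of_forall fun z => (hp.abs_opK_le hM hk z v))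
  have key : ∀ (n : ℕ) (x : E3) (f : E3 → ℝ) (c : ℝ), (∀ z, |f z| ≤ c) →
      |∫ z, ρ n (z - x) * f z| ≤ c := by
    intro n x f c hf
    rw [← Real.norm_eq_abs]
    refine (norm_integral_le_of_norm_le ((ρi n x).mul_const c)
      (Eventually.of_forall fun z => ?_)).trans (le_of_eq ?_)
    · rw [norm_mul, Real.norm_of_nonneg (ρ0 n _)]
      exact mul_le_mul_of_nonneg_left (hf z) (ρ0 n _)
    · rw [integral_mul_const, ρ1', one_mul]
  have abound : ∀ n x v, |a n x v| ≤ C * M * Real.exp (-α * ‖v‖ ^ 2) := fun n x v =>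
    key n x _ _ fun z => hp.abs_opK_le hM hk z v
  -- limit along an ultrafilter
  have hU : ∀ x v, ∃ l, Tendsto (fun n => a n x v) (hyperfilter ℕ : Filter ℕ) (𝓝 l) := by
    intro x v
    have hcpt : IsCompact (Icc (-(C * M * Real.exp (-α * ‖v‖ ^ 2)))
      (C * M * Real.exp (-α * ‖v‖ ^ 2))) := isCompact_Icc
    obtain ⟨l, -, hl⟩ := hcpt.ultrafilter_le_nhds ((hyperfilter ℕ).map fun n => a n x v) (by
      rw [le_principal_iff]
      exact (Eventually.of_forall fun n => abs_le.mp (abound n x v) :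
        ∀ᶠ n in (hyperfilter ℕ : Filter ℕ), a n x v ∈ Icc _ _))
    exact ⟨l, hl⟩
  choose g hg using hU
  refine ⟨g, ⟨by positivity, by positivity, fun x v => ?_, fun x hx y hy v => ?_,
    fun x v v' m hm => ?_⟩, fun v => ?_⟩
  · exact le_of_tendsto (hg x v).abs (Eventually.of_forall fun n => abound n x v)
  · set δ := min (Metric.infDist x Ωᶜ) (Metric.infDist y Ωᶜ) with hδ
    have hδ0 : 0 < δ := lt_min (hΩ.infDist_pos hx) (hΩ.infDist_pos hy)
    have h1 : Tendsto (fun n => C * B * Real.exp (-α * ‖v‖ ^ 2) *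
        (Real.sqrt (δ - (b n).rOut))⁻¹ * ‖x - y‖) (hyperfilter ℕ : Filter ℕ)
        (𝓝 (C * B * Real.exp (-α * ‖v‖ ^ 2) * (Real.sqrt δ)⁻¹ * ‖x - y‖)) := by
      have h2 : Tendsto (fun n => δ - (b n).rOut) (hyperfilter ℕ : Filter ℕ) (𝓝 δ) := by
        simpa using (htend.const_sub δ).mono_left Nat.hyperfilter_le_atTop
      exact (((Real.continuous_sqrt.continuousAt.tendsto.comp h2).inv₀
        (Real.sqrt_pos.mpr hδ0).ne').const_mul _).mul_const _
    refine le_of_tendsto_of_tendsto ((hg x v).sub (hg y v)).abs h1 ?_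
    have h3 : ∀ᶠ n in (hyperfilter ℕ : Filter ℕ), (b n).rOut < δ :=
      Nat.hyperfilter_le_atTop (htend.eventually (gt_mem_nhds hδ0))
    filter_upwards [h3] with n hn
    have h4 := hp.abs_integral_opK_sub_le hΩ hα hM hB hk (ρs n) (ρc n) (ρ0 n) (ρ1 n) (ρsupp n)
      hx hy hn hδ.le v
    have h5 : a n x v - a n y v =
        ∫ z, (ρ n (z - x) - ρ n (z - y)) * opK k h (z, v) := by
      simp only [ha]
      rw [← integral_sub (ai n x v) (ai n y v)]
      simp only [sub_mul]
    rw [h5]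
    exact h4
  · refine le_of_tendsto ((hg x v').sub (hg x v)).abs (Eventually.of_forall fun n => ?_)
    have h5 : a n x v' - a n x v =
        ∫ z, ρ n (z - x) * (opK k h (z, v') - opK k h (z, v)) := by
      simp only [ha]
      rw [← integral_sub (ai n x v') (ai n x v)]
      simp only [mul_sub]
    rw [h5]
    exact key n x _ _ fun z => hp.abs_opK_sub_le hM hk z v v' m hm
  · have hli : LocallyIntegrable fun z => opK k h (z, v) := by
      refine (locallyIntegrable_const (C * M * Real.exp (-α * ‖v‖ ^ 2))).mono
        (Km v).aestronglyMeasurable (Eventually.of_forall fun z => ?_)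
      exact (hp.abs_opK_le hM hk z v).trans (le_abs_self _)
    -- Differentiation of integrals needs inner and outer radii of comparable size; here their ratio
    -- is 2.
    have hae := ContDiffBump.ae_convolution_tendsto_right_of_locallyIntegrable (φ := b)
      (l := atTop) (K := 2) htend (Eventually.of_forall fun n => by
        change 1 / (n + 1 : ℝ) ≤ 2 * (1 / (n + 1 : ℝ) / 2); linarith) hli
    filter_upwards [hae] with x hx
    refine tendsto_nhds_unique (hg x v) ((hx.mono_left Nat.hyperfilter_le_atTop).congr fun n => ?_)
    rw [convolution_eq_swap]
    simp only [ha]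
    refine integral_congr_ae (Eventually.of_forall fun z => ?_)
    simp only [ContinuousLinearMap.lsmul_apply, smul_eq_mul]
    rw [← neg_sub z x, (b n).normed_neg]

end

/-! ### Elementary estimates -/

lemma mul_exp_neg_le_one (y : ℝ) : y * Real.exp (-y) ≤ 1 := by
  have h := Real.add_one_le_exp y
  rw [Real.exp_neg, ← div_eq_mul_inv, div_le_one (Real.exp_pos _)]
  linarith

lemma abs_exp_neg_sub_le {p q b : ℝ} (hp : b ≤ p) (hq : b ≤ q) :
    |Real.exp (-p) - Real.exp (-q)| ≤ |p - q| * Real.exp (-b) := by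
  have h := Convex.norm_image_sub_le_of_norm_deriv_le (f := fun y : ℝ => Real.exp (-y))
    (s := Ici b) (C := Real.exp (-b)) (fun y _ => by fun_prop) (fun y hy => ?_) (convex_Ici b) hq hp
  · rw [Real.norm_eq_abs, Real.norm_eq_abs] at h
    rw [mul_comm]
    exact h
  · have hd : HasDerivAt (fun y : ℝ => Real.exp (-y)) (Real.exp (-y) * -1) y :=
      (hasDerivAt_neg y).exp
    rw [hd.deriv, mul_neg_one, norm_neg, Real.norm_of_nonneg (Real.exp_pos _).le,
      Real.exp_le_exp]
    exact neg_le_neg hy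

lemma abs_one_sub_le_exp_half {y : ℝ} (hy : 0 ≤ y) : |1 - y| ≤ Real.exp (y / 2) := by
  have h := Real.quadratic_le_exp_of_nonneg (show 0 ≤ y / 2 by linarith)
  rw [abs_le]
  constructor <;> nlinarith [sq_nonneg (y - 4)]

/-- Half of the exponential is spent on the derivative factor |1 - ay|; the other half is kept,
because its integral later provides decay in τ. -/
lemma abs_mul_exp_neg_sub_le {a t t' b : ℝ} (ha : 0 ≤ a) (hb : 0 ≤ b) (ht : b ≤ t)
    (ht' : b ≤ t') :
    |t' * Real.exp (-(a * t')) - t * Real.exp (-(a * t))| ≤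
      |t' - t| * Real.exp (-(a * b / 2)) := by
  have hd : ∀ y : ℝ, HasDerivAt (fun y : ℝ => y * Real.exp (-(a * y)))
      ((1 - a * y) * Real.exp (-(a * y))) y := by
    intro y
    have h1 : HasDerivAt (fun y : ℝ => -(a * y)) (-a) y := by
      simpa using ((hasDerivAt_id y).const_mul a).fun_neg
    refine ((hasDerivAt_id y).mul h1.exp).congr_deriv ?_
    simp only [id]
    ring
  have h := Convex.norm_image_sub_le_of_norm_deriv_le
    (f := fun y : ℝ => y * Real.exp (-(a * y)))
    (s := Ici b) (C := Real.exp (-(a * b / 2))) (fun y _ => (hd y).differentiableAt)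
    (fun y hy => ?_) (convex_Ici b) ht ht'
  · rw [Real.norm_eq_abs, Real.norm_eq_abs] at h
    rw [mul_comm |t' - t|]
    exact h
  · have hy' : b ≤ y := hy
    rw [(hd y).deriv, norm_mul, Real.norm_eq_abs, Real.norm_of_nonneg (Real.exp_pos _).le]
    calc |1 - a * y| * Real.exp (-(a * y)) ≤ Real.exp (a * y / 2) * Real.exp (-(a * y)) :=
          mul_le_mul_of_nonneg_right (abs_one_sub_le_exp_half (mul_nonneg ha (hb.trans hy')))
            (Real.exp_pos _).le
      _ = Real.exp (-(a * y / 2)) := by rw [← Real.exp_add]; congr 1; ring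
      _ ≤ _ := by
          rw [Real.exp_le_exp]
          have := mul_le_mul_of_nonneg_left hy' ha
          linarith

lemma integral_mul_exp_neg_le {β : ℝ} :
    ∫ σ in (0 : ℝ)..1, β * Real.exp (-(β * σ)) ≤ 1 := by
  have h : ∀ σ ∈ uIcc (0 : ℝ) 1, HasDerivAt (fun σ : ℝ => -Real.exp (-(β * σ)))
      (β * Real.exp (-(β * σ))) σ := by
    intro σ _
    have h1 : HasDerivAt (fun y : ℝ => -(β * y)) (-β) σ := by
      simpa using ((hasDerivAt_id σ).const_mul β).fun_neg
    refine h1.exp.neg.congr_deriv ?_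
    ring
  rw [intervalIntegral.integral_eq_sub_of_hasDerivAt h
    ((by fun_prop : Continuous _).intervalIntegrable _ _)]
  have := Real.exp_pos (-(β * 1))
  simp
  simpa using this.le

lemma integral_exp_neg_le_one {β : ℝ} (hβ : 0 ≤ β) :
    ∫ σ in (0 : ℝ)..1, Real.exp (-(β * σ)) ≤ 1 := by
  have h : ∫ σ in (0 : ℝ)..1, Real.exp (-(β * σ)) ≤ ∫ σ in (0 : ℝ)..1, (1 : ℝ) := by
    refine intervalIntegral.integral_mono_on zero_le_one
      ((by fun_prop : Continuous _).intervalIntegrable _ _)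
      (continuous_const.intervalIntegrable _ _) fun σ hσ => ?_
    rw [Real.exp_le_one_iff]
    have := mul_nonneg hβ hσ.1
    linarith
  simpa using h

/-- The endpoint weight of the chord estimate. -/
def endpointWeight (σ : ℝ) : ℝ := (Real.sqrt σ)⁻¹ + (Real.sqrt (1 - σ))⁻¹

lemma endpointWeight_nonneg (σ : ℝ) : 0 ≤ endpointWeight σ := by
  unfold endpointWeight; positivity

lemma intervalIntegrable_inv_sqrt :
    IntervalIntegrable (fun σ : ℝ => (Real.sqrt σ)⁻¹) volume 0 1 ∧
      ∫ σ in (0 : ℝ)..1, (Real.sqrt σ)⁻¹ = 2 := by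
  have heq : EqOn (fun σ : ℝ => σ ^ (-(1 / 2) : ℝ)) (fun σ => (Real.sqrt σ)⁻¹) (uIcc 0 1) := by
    intro σ hσ
    rw [uIcc_of_le zero_le_one] at hσ
    simp only
    rw [Real.rpow_neg hσ.1, Real.sqrt_eq_rpow]
  constructor
  · refine (intervalIntegral.intervalIntegrable_rpow' (r := -(1 / 2)) (by norm_num)).congr ?_
    intro σ hσ
    exact heq (uIoc_subset_uIcc hσ)
  · rw [← intervalIntegral.integral_congr heq, integral_rpow (Or.inl (by norm_num))]
    norm_num

lemma intervalIntegrable_endpointWeight :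
    IntervalIntegrable endpointWeight volume 0 1 := by
  obtain ⟨h1, -⟩ := intervalIntegrable_inv_sqrt
  have h2 := h1.comp_sub_left 1
  simp only [sub_zero, sub_self] at h2
  exact h1.add h2.symm

lemma integral_endpointWeight : ∫ σ in (0 : ℝ)..1, endpointWeight σ = 4 := by
  obtain ⟨h1, h3⟩ := intervalIntegrable_inv_sqrt
  have h2 := h1.comp_sub_left 1
  simp only [sub_zero, sub_self] at h2
  unfold endpointWeight
  rw [intervalIntegral.integral_add h1 h2.symm,
    intervalIntegral.integral_comp_sub_left (fun σ : ℝ => (Real.sqrt σ)⁻¹) 1]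
  simp only [sub_zero, sub_self, h3]
  norm_num

/-! ### The transport operator on regular sources -/

/-- Bounds on the collision frequency. -/
structure FrequencyBounds (γ c L : ℝ) (ν : E3 → ℝ) : Prop where
  gamma_nonneg : 0 ≤ γ
  c_pos : 0 < c
  L_nonneg : 0 ≤ L
  lower : ∀ v, c * (1 + ‖v‖) ^ γ ≤ ν v
  lipschitz : ∀ v v', |ν v' - ν v| ≤ L * ‖v' - v‖

lemma FrequencyBounds.one_le {γ c L : ℝ} {ν : E3 → ℝ} (hν : FrequencyBounds γ c L ν) (v : E3) :
    1 ≤ (1 + ‖v‖) ^ γ :=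
  Real.one_le_rpow (by linarith [norm_nonneg v]) hν.gamma_nonneg

lemma FrequencyBounds.c_le {γ c L : ℝ} {ν : E3 → ℝ} (hν : FrequencyBounds γ c L ν) (v : E3) :
    c ≤ ν v :=
  (le_mul_of_one_le_right hν.c_pos.le (hν.one_le v)).trans (hν.lower v)

lemma PropertyA.exists_frequencyBounds {γ ρ : ℝ} {ν : E3 → ℝ} {k : E3 → E3 → ℝ}
    (hA : PropertyA γ ρ ν k) : ∃ c L : ℝ, FrequencyBounds γ c L ν := by
  obtain ⟨c, hc, hlow⟩ := hA.nu_lower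
  obtain ⟨C, hC⟩ := hA.nu_gradient
  refine ⟨c, max C 0, hA.gamma_nonneg, hc, le_max_right _ _, hlow, fun v v' => ?_⟩
  have h := Convex.norm_image_sub_le_of_norm_fderiv_le (𝕜 := ℝ) (f := ν) (s := univ)
    (C := max C 0) (fun y _ => hA.nu_differentiable y) (fun y _ => ?_) convex_univ
    (mem_univ v) (mem_univ v')
  · exact h
  · rw [← norm_gradient_eq]
    refine (hC y).trans ?_
    have h1 : (1 + ‖y‖) ^ (γ - 1) ≤ 1 :=
      Real.rpow_le_one_of_one_le_of_nonpos (by linarith [norm_nonneg y])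
        (by linarith [hA.gamma_le_one])
    have h0 : 0 ≤ (1 + ‖y‖) ^ (γ - 1) := by positivity
    calc C * (1 + ‖y‖) ^ (γ - 1) ≤ max C 0 * (1 + ‖y‖) ^ (γ - 1) :=
          mul_le_mul_of_nonneg_right (le_max_left _ _) h0
      _ ≤ max C 0 * 1 := mul_le_mul_of_nonneg_left h1 (le_max_right _ _)
      _ = _ := mul_one _

/-- Two phase points at which exit time, speed and velocity weights are comparable. -/
structure IsComparable (Ω : Set E3) (γ α : ℝ) (z z' : E3 × E3) : Prop where
  time : exitTime Ω z.1 z.2 ≤ 2 * exitTime Ω z'.1 z'.2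
  time' : exitTime Ω z'.1 z'.2 ≤ 2 * exitTime Ω z.1 z.2
  speed : ‖z.2‖ ≤ 2 * ‖z'.2‖
  speed' : ‖z'.2‖ ≤ 2 * ‖z.2‖
  gauss : Real.exp (-α * ‖z'.2‖ ^ 2) ≤ 2 * Real.exp (-α * ‖z.2‖ ^ 2)
  weight : ∀ θ ∈ Icc (0 : ℝ) 1, (1 + ‖z.2 + θ • (z'.2 - z.2)‖) ^ γ *
      Real.exp (-α * ‖z.2 + θ • (z'.2 - z.2)‖ ^ 2) ≤
    2 * ((1 + ‖z.2‖) ^ γ * Real.exp (-α * ‖z.2‖ ^ 2))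

section

variable {Ω : Set E3} {R r γ α m₀ m₁ c L : ℝ} {g : E3 → E3 → ℝ} {ν : E3 → ℝ}

lemma IsRegularSource.continuousOn (hΩ : IsRollingDomain Ω R r)
    (hg : IsRegularSource Ω γ α m₀ m₁ g) (v : E3) : ContinuousOn (fun x => g x v) Ω := by
  intro x hx
  refine ContinuousAt.continuousWithinAt ?_
  have hd := hΩ.infDist_pos hx
  set d := Metric.infDist x Ωᶜ with hd'
  have hev : ∀ᶠ y in 𝓝 x, y ∈ Ω ∧ d / 2 < Metric.infDist y Ωᶜ := by
    refine Filter.Eventually.and (hΩ.isOpen.mem_nhds hx) ?_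
    exact (Metric.continuous_infDist_pt Ωᶜ).continuousAt.eventually
      (lt_mem_nhds (half_lt_self hd))
  rw [ContinuousAt, tendsto_iff_dist_tendsto_zero]
  have h1 : Tendsto (fun y => m₁ * Real.exp (-α * ‖v‖ ^ 2) * (Real.sqrt (d / 2))⁻¹ * ‖y - x‖)
      (𝓝 x) (𝓝 0) := by
    have : Continuous fun y => m₁ * Real.exp (-α * ‖v‖ ^ 2) * (Real.sqrt (d / 2))⁻¹ * ‖y - x‖ := by
      fun_prop
    simpa using this.tendsto x
  refine squeeze_zero' (Eventually.of_forall fun y => dist_nonneg) ?_ h1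
  filter_upwards [hev] with y hy
  rw [Real.dist_eq]
  refine (hg.lipschitz_x y hy.1 x hx v).trans ?_
  have := hg.nonneg₁
  gcongr
  exact le_min hy.2.le (half_le_self hd.le)

/-- The substitution s = στ fixes the domain of integration, so that two phase points can be
compared under one integral. -/
lemma opS_eq (z : E3 × E3) (F : E3 × E3 → ℝ) :
    opS Ω ν F z = ∫ σ in (0 : ℝ)..1, exitTime Ω z.1 z.2 *
      Real.exp (-(ν z.2 * σ * exitTime Ω z.1 z.2)) *
        F (z.1 - (σ * exitTime Ω z.1 z.2) • z.2, z.2) := by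
  set τ := exitTime Ω z.1 z.2 with hτ
  have h := intervalIntegral.smul_integral_comp_mul_left (a := 0) (b := 1)
    (fun s : ℝ => Real.exp (-ν z.2 * s) * F (z.1 - s • z.2, z.2)) τ
  rw [mul_zero, mul_one] at h
  rw [opS, ← hτ, ← h, smul_eq_mul, ← intervalIntegral.integral_const_mul]
  refine intervalIntegral.integral_congr fun σ _ => ?_
  rw [mul_comm τ σ, show -ν z.2 * (σ * τ) = -(ν z.2 * σ * τ) by ring]
  ring

lemma IsRegularSource.intervalIntegrable (hΩ : IsRollingDomain Ω R r)
    (hg : IsRegularSource Ω γ α m₀ m₁ g) {z : E3 × E3}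
    (hz : z ∈ IsRollingDomain.movingPhase Ω) :
    IntervalIntegrable (fun σ : ℝ => exitTime Ω z.1 z.2 *
      Real.exp (-(ν z.2 * σ * exitTime Ω z.1 z.2)) *
        g (z.1 - (σ * exitTime Ω z.1 z.2) • z.2) z.2) volume 0 1 := by
  rw [intervalIntegrable_iff_integrableOn_Ioo_of_le zero_le_one]
  have hc : ContinuousOn (fun σ : ℝ => g (z.1 - (σ * exitTime Ω z.1 z.2) • z.2) z.2)
      (Ioo 0 1) := by
    refine (hg.continuousOn hΩ z.2).comp (f := fun σ : ℝ => z.1 - (σ * exitTime Ω z.1 z.2) • z.2)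
      (by fun_prop) fun σ hσ => hΩ.chord_mem hz.1 hz.2 hσ.1.le hσ.2
  have hi : IntegrableOn (fun σ : ℝ => exitTime Ω z.1 z.2 *
      Real.exp (-(ν z.2 * σ * exitTime Ω z.1 z.2))) (Ioo 0 1) :=
    ((by fun_prop : Continuous _).integrableOn_Icc).mono_set Ioo_subset_Icc_self
  refine hi.mul_bdd (c := m₀ * Real.exp (-α * ‖z.2‖ ^ 2))
    (hc.aestronglyMeasurable measurableSet_Ioo) (Eventually.of_forall fun σ => hg.bound _ _)

set_option maxHeartbeats 1000000 in
-- Exit time, collision frequency, velocity of the source and position of the source are changed one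
-- at a time. The first three changes need only the size m₀ of the source; the last one costs m₁ and
-- the inverse root of the distance to the boundary.
lemma IsRegularSource.abs_integrand_sub_le (hΩ : IsRollingDomain Ω R r)
    (hg : IsRegularSource Ω γ α m₀ m₁ g) (hν : FrequencyBounds γ c L ν) {x v x' v' : E3}
    (hx : x ∈ Ω) (hv : v ≠ 0) (hx' : x' ∈ Ω) (hv' : v' ≠ 0)
    (hcl : IsComparable Ω γ α (x, v) (x', v')) {τ τ' : ℝ} (hτ : τ = exitTime Ω x v)
    (hτ' : τ' = exitTime Ω x' v') {σ : ℝ} (h0 : 0 < σ) (h1 : σ < 1) :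
    |τ' * Real.exp (-(ν v' * σ * τ')) * g (x' - (σ * τ') • v') v' -
      τ * Real.exp (-(ν v * σ * τ)) * g (x - (σ * τ) • v) v| ≤
      2 * m₀ * Real.exp (-α * ‖v‖ ^ 2) * (|τ' - τ| * Real.exp (-(c * τ / 4 * σ)) +
        L / c * τ * ‖v' - v‖ +
        ((1 + ‖v‖) ^ γ * τ) * Real.exp (-(c * ((1 + ‖v‖) ^ γ * τ) * σ)) * ‖v' - v‖) +
      10 * m₁ * Real.exp (-α * ‖v‖ ^ 2) * (IsRollingDomain.chordConst R r / ‖v‖) *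
        (‖x' - x‖ + 2 * (1 + 1 / c) * ‖v‖ * |τ' - τ| / (1 + τ) + ‖v' - v‖ / c) *
        endpointWeight σ := by
  have hc := hν.c_pos
  have hL := hν.L_nonneg
  have hm₀ := hg.nonneg₀
  have hm₁ := hg.nonneg₁
  have hJ := hΩ.chordConst_pos
  have hτ0 : 0 < τ := hτ ▸ hΩ.exitTime_pos hx hv
  have hτ'0 : 0 < τ' := hτ' ▸ hΩ.exitTime_pos hx' hv'
  have hvp : 0 < ‖v‖ := norm_pos_iff.mpr hv
  have hvp' : 0 < ‖v'‖ := norm_pos_iff.mpr hv'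
  obtain ⟨ct, ct', cs, cs', cg, cw⟩ := hcl
  dsimp only at ct ct' cs cs' cg cw
  rw [← hτ, ← hτ'] at ct ct'
  have hyΩ : x - (σ * τ) • v ∈ Ω := by rw [hτ]; exact hΩ.chord_mem hx hv h0.le h1
  have hyΩ' : x' - (σ * τ') • v' ∈ Ω := by rw [hτ']; exact hΩ.chord_mem hx' hv' h0.le h1
  have hd := hΩ.infDist_pos hyΩ
  have hd' := hΩ.infDist_pos hyΩ'
  have hch := hΩ.div_sqrt_infDist_chord_le hx hv h0 h1
  have hch' := hΩ.div_sqrt_infDist_chord_le hx' hv' h0 h1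
  rw [← hτ] at hch
  rw [← hτ'] at hch'
  change _ ≤ _ * endpointWeight σ at hch hch'
  set y := x - (σ * τ) • v with hy
  set y' := x' - (σ * τ') • v' with hy'
  set E := Real.exp (-α * ‖v‖ ^ 2) with hE
  have hE0 : 0 < E := Real.exp_pos _
  set Γ := (1 + ‖v‖) ^ γ with hΓ
  have hΓ1 : 1 ≤ Γ := hν.one_le v
  set J := IsRollingDomain.chordConst R r with hJdef
  set s := endpointWeight σ with hs
  have hs0 : 0 ≤ s := endpointWeight_nonneg σ
  have hνc : c ≤ ν v := hν.c_le v
  have hνc' : c ≤ ν v' := hν.c_le v'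
  have hνΓ : c * Γ ≤ ν v := hν.lower v
  -- splitting
  have hsplit : τ' * Real.exp (-(ν v' * σ * τ')) * g y' v' - τ * Real.exp (-(ν v * σ * τ)) * g y v =
      (τ' * Real.exp (-(ν v' * σ * τ')) - τ * Real.exp (-(ν v' * σ * τ))) * g y' v' +
      τ * (Real.exp (-(ν v' * σ * τ)) - Real.exp (-(ν v * σ * τ))) * g y' v' +
      τ * Real.exp (-(ν v * σ * τ)) * (g y v' - g y v) +
      τ * Real.exp (-(ν v * σ * τ)) * (g y' v' - g y v') := by ring
  have hgb : |g y' v'| ≤ m₀ * (2 * E) :=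
    (hg.bound y' v').trans (mul_le_mul_of_nonneg_left cg hm₀)
  have t1 : |(τ' * Real.exp (-(ν v' * σ * τ')) - τ * Real.exp (-(ν v' * σ * τ))) * g y' v'| ≤
      (|τ' - τ| * Real.exp (-(c * τ / 4 * σ))) * (m₀ * (2 * E)) := by
    rw [abs_mul]
    refine mul_le_mul ?_ hgb (abs_nonneg _) (by positivity)
    have hν0 : 0 ≤ ν v' * σ := mul_nonneg (hc.le.trans hνc') h0.le
    -- Comparability makes both exit times at least τ/2, and half of the exponent is lost, hence the
    -- rate c/4.
    refine (abs_mul_exp_neg_sub_le (b := τ / 2) hν0 (by positivity) (by linarith)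
      (by linarith)).trans ?_
    refine mul_le_mul_of_nonneg_left ?_ (abs_nonneg _)
    rw [Real.exp_le_exp]
    have := mul_le_mul_of_nonneg_right hνc' (show 0 ≤ σ * τ by positivity)
    nlinarith
  have hexp_le : ∀ β, c ≤ β → Real.exp (-(β * σ * τ)) ≤ Real.exp (-(c * σ * τ)) := by
    intro β hβ
    rw [Real.exp_le_exp]
    have := mul_le_mul_of_nonneg_right hβ (show 0 ≤ σ * τ by positivity)
    nlinarith
  have hye : σ * τ * Real.exp (-(c * σ * τ)) ≤ 1 / c := by
    rw [le_div_iff₀ hc]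
    have := mul_exp_neg_le_one (c * σ * τ)
    linarith
  have t2 : |τ * (Real.exp (-(ν v' * σ * τ)) - Real.exp (-(ν v * σ * τ))) * g y' v'| ≤
      (L / c * τ * ‖v' - v‖) * (m₀ * (2 * E)) := by
    rw [abs_mul, abs_mul, abs_of_pos hτ0]
    refine mul_le_mul ?_ hgb (abs_nonneg _) (by positivity)
    have h2 : |Real.exp (-(ν v' * σ * τ)) - Real.exp (-(ν v * σ * τ))| ≤
        |ν v' * σ * τ - ν v * σ * τ| * Real.exp (-(c * σ * τ)) :=
      abs_exp_neg_sub_le (by gcongr) (by gcongr)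
    have h3 : |ν v' * σ * τ - ν v * σ * τ| = |ν v' - ν v| * (σ * τ) := by
      rw [← sub_mul, ← sub_mul, abs_mul, abs_mul, abs_of_pos h0, abs_of_pos hτ0, mul_assoc]
    rw [h3] at h2
    calc τ * |Real.exp (-(ν v' * σ * τ)) - Real.exp (-(ν v * σ * τ))|
        ≤ τ * (|ν v' - ν v| * (σ * τ) * Real.exp (-(c * σ * τ))) :=
          mul_le_mul_of_nonneg_left h2 hτ0.le
      _ = τ * |ν v' - ν v| * (σ * τ * Real.exp (-(c * σ * τ))) := by ring
      _ ≤ τ * (L * ‖v' - v‖) * (1 / c) := by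
          refine mul_le_mul ?_ hye (by positivity) (by positivity)
          exact mul_le_mul_of_nonneg_left (hν.lipschitz v v') hτ0.le
      _ = _ := by ring
  have t3 : |τ * Real.exp (-(ν v * σ * τ)) * (g y v' - g y v)| ≤
      τ * Real.exp (-(c * (Γ * τ) * σ)) * (m₀ * (2 * (Γ * E)) * ‖v' - v‖) := by
    rw [abs_mul, abs_of_pos (show 0 < τ * Real.exp (-(ν v * σ * τ)) by positivity)]
    refine mul_le_mul ?_ (hg.lipschitz_v y v v' _ cw) (abs_nonneg _) (by positivity)
    refine mul_le_mul_of_nonneg_left ?_ hτ0.le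
    rw [Real.exp_le_exp]
    have := mul_le_mul_of_nonneg_right hνΓ (show 0 ≤ σ * τ by positivity)
    nlinarith
  have t4 : |τ * Real.exp (-(ν v * σ * τ)) * (g y' v' - g y v')| ≤
      10 * m₁ * E * (J / ‖v‖) *
        (‖x' - x‖ + 2 * (1 + 1 / c) * ‖v‖ * |τ' - τ| / (1 + τ) + ‖v' - v‖ / c) * s := by
    rw [abs_mul, abs_of_pos (show 0 < τ * Real.exp (-(ν v * σ * τ)) by positivity)]
    have hmin : (Real.sqrt (min (Metric.infDist y' Ωᶜ) (Metric.infDist y Ωᶜ)))⁻¹ ≤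
        (Real.sqrt (Metric.infDist y' Ωᶜ))⁻¹ + (Real.sqrt (Metric.infDist y Ωᶜ))⁻¹ := by
      rcases min_choice (Metric.infDist y' Ωᶜ) (Metric.infDist y Ωᶜ) with hh | hh <;> rw [hh]
      · exact le_add_of_nonneg_right (by positivity)
      · exact le_add_of_nonneg_left (by positivity)
    -- The chord through y contributes 1 and the chord through y' contributes 4, from τ ≤ 2τ' and
    -- 1/|v'| ≤ 2/|v|.
    have hτd : τ * (Real.sqrt (min (Metric.infDist y' Ωᶜ) (Metric.infDist y Ωᶜ)))⁻¹ ≤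
        5 * (J / ‖v‖) * s := by
      have h2 : τ * (Real.sqrt (Metric.infDist y' Ωᶜ))⁻¹ ≤ 4 * (J / ‖v‖) * s := by
        calc τ * (Real.sqrt (Metric.infDist y' Ωᶜ))⁻¹
            ≤ 2 * τ' * (Real.sqrt (Metric.infDist y' Ωᶜ))⁻¹ :=
              mul_le_mul_of_nonneg_right ct (by positivity)
          _ = 2 * (τ' * (Real.sqrt (Metric.infDist y' Ωᶜ))⁻¹) := by ring
          _ ≤ 2 * (J / ‖v'‖ * s) := by linarith
          _ ≤ 2 * (2 * (J / ‖v‖) * s) := by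
              have : J / ‖v'‖ ≤ 2 * (J / ‖v‖) := by
                rw [← mul_div_assoc, div_le_div_iff₀ hvp' hvp]
                nlinarith
              gcongr
          _ = _ := by ring
      calc _ ≤ τ * ((Real.sqrt (Metric.infDist y' Ωᶜ))⁻¹ + (Real.sqrt (Metric.infDist y Ωᶜ))⁻¹) :=
            mul_le_mul_of_nonneg_left hmin hτ0.le
        _ ≤ _ := by rw [mul_add]; linarith
    have hyy : ‖y' - y‖ ≤ ‖x' - x‖ + σ * (2 * ‖v‖ * |τ' - τ| + τ * ‖v' - v‖) := by
      have h2 : y' - y = (x' - x) - σ • ((τ' - τ) • v' + τ • (v' - v)) := by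
        rw [hy, hy']; module
      rw [h2]
      refine (norm_sub_le _ _).trans (add_le_add le_rfl ?_)
      rw [norm_smul, Real.norm_of_nonneg h0.le]
      refine mul_le_mul_of_nonneg_left ?_ h0.le
      refine (norm_add_le _ _).trans ?_
      rw [norm_smul, norm_smul, Real.norm_of_nonneg hτ0.le, Real.norm_eq_abs]
      have := mul_le_mul_of_nonneg_left cs' (abs_nonneg (τ' - τ))
      linarith
    have he1 : Real.exp (-(c * σ * τ)) ≤ 1 := by
      rw [Real.exp_le_one_iff]
      have : 0 < c * σ * τ := by positivity
      linarith
    -- The factor 1/(1+τ) compensates the growth in τ of the velocity derivative of the exit time.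
    have hσe : σ * Real.exp (-(c * σ * τ)) ≤ (1 + 1 / c) / (1 + τ) := by
      rw [le_div_iff₀ (by positivity)]
      have h3 : σ * Real.exp (-(c * σ * τ)) ≤ 1 := by
        have := (Real.exp_pos (-(c * σ * τ))).le
        nlinarith
      nlinarith
    have hey : Real.exp (-(c * σ * τ)) * ‖y' - y‖ ≤
        ‖x' - x‖ + 2 * (1 + 1 / c) * ‖v‖ * |τ' - τ| / (1 + τ) + ‖v' - v‖ / c := by
      calc _ ≤ Real.exp (-(c * σ * τ)) *
            (‖x' - x‖ + σ * (2 * ‖v‖ * |τ' - τ| + τ * ‖v' - v‖)) :=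
            mul_le_mul_of_nonneg_left hyy (Real.exp_pos _).le
        _ = Real.exp (-(c * σ * τ)) * ‖x' - x‖ +
            (σ * Real.exp (-(c * σ * τ))) * (2 * ‖v‖ * |τ' - τ|) +
            (σ * τ * Real.exp (-(c * σ * τ))) * ‖v' - v‖ := by ring
        _ ≤ 1 * ‖x' - x‖ + ((1 + 1 / c) / (1 + τ)) * (2 * ‖v‖ * |τ' - τ|) +
            (1 / c) * ‖v' - v‖ := by gcongr
        _ = _ := by ring
    have hlip := hg.lipschitz_x y' hyΩ' y hyΩ v'
    calc τ * Real.exp (-(ν v * σ * τ)) * |g y' v' - g y v'|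
        ≤ τ * Real.exp (-(c * σ * τ)) * (m₁ * (2 * E) *
          (Real.sqrt (min (Metric.infDist y' Ωᶜ) (Metric.infDist y Ωᶜ)))⁻¹ * ‖y' - y‖) := by
          refine mul_le_mul (mul_le_mul_of_nonneg_left (hexp_le _ hνc) hτ0.le)
            (hlip.trans ?_) (abs_nonneg _) (by positivity)
          gcongr
      _ = 2 * m₁ * E *
          (τ * (Real.sqrt (min (Metric.infDist y' Ωᶜ) (Metric.infDist y Ωᶜ)))⁻¹) *
          (Real.exp (-(c * σ * τ)) * ‖y' - y‖) := by ring
      _ ≤ 2 * m₁ * E * (5 * (J / ‖v‖) * s) *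
          (‖x' - x‖ + 2 * (1 + 1 / c) * ‖v‖ * |τ' - τ| / (1 + τ) + ‖v' - v‖ / c) := by
          gcongr
      _ = _ := by ring
  rw [hsplit]
  refine (abs_add_le _ _).trans ?_
  refine add_le_add ?_ t4
  refine ((abs_add_le _ _).trans (add_le_add ((abs_add_le _ _).trans (add_le_add t1 t2)) t3)).trans
    (le_of_eq ?_)
  ring

/-- The constant in the difference estimate for the transport operator. -/
def transportConst (c L : ℝ) : ℝ := 200 * (1 + L) * (1 + 1 / c)

set_option maxHeartbeats 1000000 in
-- Integration in σ. The increment of the exit time enters only through |τ' - τ|/(1+τ), the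
-- combination that the weight can control without powers of τ.
lemma IsRegularSource.abs_opS_sub_le (hΩ : IsRollingDomain Ω R r)
    (hg : IsRegularSource Ω γ α m₀ m₁ g) (hν : FrequencyBounds γ c L ν) {x v x' v' : E3}
    (hx : x ∈ Ω) (hv : v ≠ 0) (hx' : x' ∈ Ω) (hv' : v' ≠ 0)
    (hcl : IsComparable Ω γ α (x, v) (x', v')) {τ τ' : ℝ} (hτ : τ = exitTime Ω x v)
    (hτ' : τ' = exitTime Ω x' v') :
    |opS Ω ν (fun z => g z.1 z.2) (x', v') - opS Ω ν (fun z => g z.1 z.2) (x, v)| ≤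
      transportConst c L * Real.exp (-α * ‖v‖ ^ 2) *
        (m₀ * (|τ' - τ| / (1 + τ) + (1 + τ) * ‖v' - v‖) +
          m₁ * (IsRollingDomain.chordConst R r / ‖v‖) *
            (‖x' - x‖ + ‖v‖ * (|τ' - τ| / (1 + τ)) + ‖v' - v‖)) := by
  have hc := hν.c_pos
  have hL := hν.L_nonneg
  have hm₀ := hg.nonneg₀
  have hm₁ := hg.nonneg₁
  have hJ := hΩ.chordConst_pos
  have hτ0 : 0 < τ := hτ ▸ hΩ.exitTime_pos hx hv
  have hvp : 0 < ‖v‖ := norm_pos_iff.mpr hv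
  have i1 := hg.intervalIntegrable (ν := ν) hΩ (z := (x', v')) ⟨hx', hv'⟩
  have i2 := hg.intervalIntegrable (ν := ν) hΩ (z := (x, v)) ⟨hx, hv⟩
  rw [opS_eq, opS_eq, ← intervalIntegral.integral_sub i1 i2]
  dsimp only
  rw [← hτ, ← hτ', ← Real.norm_eq_abs]
  set E := Real.exp (-α * ‖v‖ ^ 2) with hE
  have hE0 : 0 < E := Real.exp_pos _
  set Γ := (1 + ‖v‖) ^ γ with hΓ
  have hΓ1 : 1 ≤ Γ := hν.one_le v
  set J := IsRollingDomain.chordConst R r with hJdef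
  set A := 10 * m₁ * E * (J / ‖v‖) *
        (‖x' - x‖ + 2 * (1 + 1 / c) * ‖v‖ * |τ' - τ| / (1 + τ) + ‖v' - v‖ / c) with hA
  have j1 : IntervalIntegrable (fun σ : ℝ => |τ' - τ| * Real.exp (-(c * τ / 4 * σ))) volume 0 1 :=
    (by fun_prop : Continuous _).intervalIntegrable _ _
  have j2 : IntervalIntegrable (fun _ : ℝ => L / c * τ * ‖v' - v‖) volume 0 1 :=
    continuous_const.intervalIntegrable _ _
  have j3 : IntervalIntegrable (fun σ : ℝ => (Γ * τ) * Real.exp (-(c * (Γ * τ) * σ)) * ‖v' - v‖)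
      volume 0 1 := (by fun_prop : Continuous _).intervalIntegrable _ _
  have j4 := intervalIntegrable_endpointWeight.const_mul A
  have hb := intervalIntegral.norm_integral_le_of_norm_le (a := 0) (b := 1) (μ := volume)
    zero_le_one (f := fun σ => τ' * Real.exp (-(ν v' * σ * τ')) * g (x' - (σ * τ') • v') v' -
      τ * Real.exp (-(ν v * σ * τ)) * g (x - (σ * τ) • v) v)
    (g := fun σ => 2 * m₀ * E * (|τ' - τ| * Real.exp (-(c * τ / 4 * σ)) +
        L / c * τ * ‖v' - v‖ +
        (Γ * τ) * Real.exp (-(c * (Γ * τ) * σ)) * ‖v' - v‖) + A * endpointWeight σ) (by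
      -- At σ = 1 the chord reaches the exit point, which is outside Ω.
      have h1 : ∀ᵐ σ : ℝ, σ ≠ 1 := by simp [ae_iff]
      filter_upwards [h1] with σ hσ1 hσ
      exact hg.abs_integrand_sub_le hΩ hν hx hv hx' hv' hcl hτ hτ' hσ.1
        (lt_of_le_of_ne hσ.2 hσ1)) (((j1.add j2).add j3).const_mul _ |>.add j4)
  refine hb.trans ?_
  rw [intervalIntegral.integral_add (((j1.add j2).add j3).const_mul _) j4,
    intervalIntegral.integral_const_mul, intervalIntegral.integral_const_mul,
    integral_endpointWeight, intervalIntegral.integral_add (j1.add j2) j3,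
    intervalIntegral.integral_add j1 j2, intervalIntegral.integral_const_mul,
    intervalIntegral.integral_const, intervalIntegral.integral_mul_const]
  have k1 : ∫ σ in (0 : ℝ)..1, Real.exp (-(c * τ / 4 * σ)) ≤ (1 + 4 / c) / (1 + τ) := by
    rw [le_div_iff₀ (by positivity)]
    have h1 := integral_exp_neg_le_one (β := c * τ / 4) (by positivity)
    have h2 := integral_mul_exp_neg_le (β := c * τ / 4)
    rw [intervalIntegral.integral_const_mul] at h2
    set I := ∫ σ in (0 : ℝ)..1, Real.exp (-(c * τ / 4 * σ))
    have h3 : I * τ ≤ 4 / c := by rw [le_div_iff₀ hc]; linarith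
    linarith
  -- Uniform in Γ = (1+|v|)^γ: the growth in the velocity Lipschitz bound is absorbed by the damping
  -- ν ≥ cΓ.
  have k3 : ∫ σ in (0 : ℝ)..1, (Γ * τ) * Real.exp (-(c * (Γ * τ) * σ)) ≤ 1 / c := by
    have h2 := integral_mul_exp_neg_le (β := c * (Γ * τ))
    simp only [mul_assoc c] at h2
    rw [intervalIntegral.integral_const_mul] at h2
    rw [le_div_iff₀ hc]
    simp only [mul_assoc c]
    linarith
  set I₁ := ∫ σ in (0 : ℝ)..1, Real.exp (-(c * τ / 4 * σ))
  set I₃ := ∫ σ in (0 : ℝ)..1, (Γ * τ) * Real.exp (-(c * (Γ * τ) * σ))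
  set T := |τ' - τ| / (1 + τ) with hT
  have hT0 : 0 ≤ T := by positivity
  set V := ‖v' - v‖
  have hV0 : 0 ≤ V := norm_nonneg _
  set X := ‖x' - x‖
  have hX0 : 0 ≤ X := norm_nonneg _
  have hic : 0 < 1 / c := by positivity
  have k1' : |τ' - τ| * I₁ ≤ (1 + 4 / c) * T := by
    calc |τ' - τ| * I₁ ≤ |τ' - τ| * ((1 + 4 / c) / (1 + τ)) :=
          mul_le_mul_of_nonneg_left k1 (abs_nonneg _)
      _ = _ := by rw [hT]; ring
  have hfirst : |τ' - τ| * I₁ + (1 - 0 : ℝ) • (L / c * τ * V) + I₃ * V ≤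
      100 * (1 + L) * (1 + 1 / c) * (T + (1 + τ) * V) := by
    have e1 : (1 + 4 / c) * T ≤ 100 * (1 + L) * (1 + 1 / c) * T := by
      refine mul_le_mul_of_nonneg_right ?_ hT0
      rw [show 4 / c = 4 * (1 / c) by ring]
      nlinarith [mul_nonneg hL hic.le]
    have e2 : L / c * τ * V + 1 / c * V ≤ 100 * (1 + L) * (1 + 1 / c) * ((1 + τ) * V) := by
      rw [show L / c = L * (1 / c) by ring]
      have : (L * (1 / c) * τ + 1 / c) * V ≤ 100 * (1 + L) * (1 + 1 / c) * (1 + τ) * V := by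
        refine mul_le_mul_of_nonneg_right ?_ hV0
        have h1 : L * (1 / c) * τ + 1 / c ≤ (1 + L) * (1 + 1 / c) * (1 + τ) := by
          have := mul_nonneg hL hic.le
          nlinarith [mul_nonneg this hτ0.le, mul_nonneg hL hτ0.le, mul_nonneg hic.le hτ0.le]
        have h2 : 0 ≤ (1 + L) * (1 + 1 / c) * (1 + τ) := by positivity
        linarith
      linarith
    have e3 : I₃ * V ≤ 1 / c * V := mul_le_mul_of_nonneg_right k3 hV0
    simp only [sub_zero, one_smul]
    linarith
  have hsecond : A * 4 ≤ transportConst c L * E * (m₁ * (J / ‖v‖) * (X + ‖v‖ * T + V)) := by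
    have e0 : 2 * (1 + 1 / c) * ‖v‖ * |τ' - τ| / (1 + τ) = 2 * (1 + 1 / c) * (‖v‖ * T) := by
      rw [hT]; ring
    have e1 : X + 2 * (1 + 1 / c) * (‖v‖ * T) + V / c ≤
        5 * (1 + L) * (1 + 1 / c) * (X + ‖v‖ * T + V) := by
      have a0 : 0 ≤ ‖v‖ * T := by positivity
      have a1 := mul_nonneg hL hic.le
      have a2 : 1 ≤ (1 + L) * (1 + 1 / c) := by nlinarith
      have a3 : 1 + 1 / c ≤ (1 + L) * (1 + 1 / c) := by nlinarith
      have a4 : 1 / c ≤ (1 + L) * (1 + 1 / c) := by nlinarith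
      have b1 := mul_le_mul_of_nonneg_right a2 hX0
      have b2 := mul_le_mul_of_nonneg_right a3 a0
      have b3 := mul_le_mul_of_nonneg_right a4 hV0
      have b4 : 0 ≤ (1 + L) * (1 + 1 / c) * (X + ‖v‖ * T + V) := by positivity
      rw [show V / c = 1 / c * V by ring]
      nlinarith
    rw [hA, e0, transportConst]
    calc _ = 40 * m₁ * E * (J / ‖v‖) * (X + 2 * (1 + 1 / c) * (‖v‖ * T) + V / c) := by ring
      _ ≤ 40 * m₁ * E * (J / ‖v‖) * (5 * (1 + L) * (1 + 1 / c) * (X + ‖v‖ * T + V)) :=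
          mul_le_mul_of_nonneg_left e1 (by positivity)
      _ = _ := by ring
  calc _ ≤ 2 * m₀ * E * (100 * (1 + L) * (1 + 1 / c) * (T + (1 + τ) * V)) +
        transportConst c L * E * (m₁ * (J / ‖v‖) * (X + ‖v‖ * T + V)) :=
        add_le_add (mul_le_mul_of_nonneg_left hfirst (by positivity)) hsecond
    _ = _ := by rw [transportConst]; ring

end

/-! ### Local Lipschitz continuity and weighted derivative bounds for the transport operator. -/

section

variable {Ω : Set E3} {R r γ α m₀ m₁ c L : ℝ} {g : E3 → E3 → ℝ} {ν : E3 → ℝ}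

/-- The bounds 2/3 and 4/3 make any two nearby values comparable with factor 2. -/
lemma eventually_comparable_of_continuousAt {X : Type*} [TopologicalSpace X] {p : X → ℝ} {x₀ : X}
    (hp : ContinuousAt p x₀) (h0 : 0 < p x₀) :
    ∀ᶠ x in 𝓝 x₀, 2 / 3 * p x₀ < p x ∧ p x < 4 / 3 * p x₀ :=
  (hp.eventually (lt_mem_nhds (by linarith))).and (hp.eventually (gt_mem_nhds (by linarith)))

lemma IsRollingDomain.exists_nhds_comparable (hΩ : IsRollingDomain Ω R r) (γ α : ℝ)
    {z₀ : E3 × E3} (hz₀ : z₀ ∈ movingPhase Ω) :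
    ∃ U ∈ 𝓝 z₀, U ⊆ movingPhase Ω ∧ ∀ z ∈ U, ∀ z' ∈ U, IsComparable Ω γ α z z' := by
  have hτc : ContinuousAt (fun z : E3 × E3 => exitTime Ω z.1 z.2) z₀ :=
    hΩ.locallyLipschitzOn_exitTime.continuousOn.continuousAt
      (hΩ.isOpen_movingPhase.mem_nhds hz₀)
  have e1 := eventually_comparable_of_continuousAt hτc (hΩ.exitTime_pos hz₀.1 hz₀.2)
  have e2 := eventually_comparable_of_continuousAt (p := fun z : E3 × E3 => ‖z.2‖) (x₀ := z₀)
    (by fun_prop) (norm_pos_iff.mpr hz₀.2)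
  have e3 := eventually_comparable_of_continuousAt
    (p := fun z : E3 × E3 => Real.exp (-α * ‖z.2‖ ^ 2)) (x₀ := z₀) (by fun_prop) (Real.exp_pos _)
  have hpc : Continuous fun v : E3 => (1 + ‖v‖) ^ γ * Real.exp (-α * ‖v‖ ^ 2) := by
    refine Continuous.mul (Continuous.rpow_const (by fun_prop) fun v => Or.inl ?_) (by fun_prop)
    positivity
  have e4 := eventually_comparable_of_continuousAt (x₀ := z₀.2) hpc.continuousAt (by positivity)
  -- A ball, being convex, contains the whole segment between two velocities.
  obtain ⟨ε, hε, hball⟩ := Metric.eventually_nhds_iff_ball.mp e4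
  have e5 : ∀ᶠ z : E3 × E3 in 𝓝 z₀, z.2 ∈ Metric.ball z₀.2 ε :=
    continuous_snd.continuousAt.eventually (Metric.ball_mem_nhds _ hε)
  have e0 := hΩ.isOpen_movingPhase.mem_nhds hz₀
  refine ⟨_, (((e1.and e2).and (e3.and e5)).and e0), fun z hz => hz.2, fun z hz z' hz' => ?_⟩
  obtain ⟨⟨⟨a1, a2⟩, a3, a5⟩, -⟩ := hz
  obtain ⟨⟨⟨b1, b2⟩, b3, b5⟩, -⟩ := hz'
  refine ⟨by linarith [a1.2, b1.1], by linarith [a1.1, b1.2], by linarith [a2.2, b2.1],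
    by linarith [a2.1, b2.2], by linarith [a3.1, b3.2], fun θ hθ => ?_⟩
  have hmem : z.2 + θ • (z'.2 - z.2) ∈ Metric.ball z₀.2 ε :=
    (convex_ball z₀.2 ε).add_smul_sub_mem a5 b5 hθ
  linarith [(hball _ hmem).2, (hball _ a5).1]

lemma IsRegularSource.locallyLipschitzOn_opS (hΩ : IsRollingDomain Ω R r) (hα : 0 ≤ α)
    (hg : IsRegularSource Ω γ α m₀ m₁ g) (hν : FrequencyBounds γ c L ν) :
    LocallyLipschitzOn (IsRollingDomain.movingPhase Ω) (opS Ω ν fun z => g z.1 z.2) := by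
  intro z₀ hz₀
  obtain ⟨U, hU, hUsub, hUcmp⟩ := hΩ.exists_nhds_comparable γ α hz₀
  obtain ⟨K, W, hW, hWlip⟩ := hΩ.locallyLipschitzOn_exitTime hz₀
  have hc := hν.c_pos
  have hL := hν.L_nonneg
  have hm₀ := hg.nonneg₀
  have hm₁ := hg.nonneg₁
  have hJ := hΩ.chordConst_pos
  have hz₀U : z₀ ∈ U := mem_of_mem_nhds hU
  have hv₀ : 0 < ‖z₀.2‖ := norm_pos_iff.mpr hz₀.2
  have hτ₀ := hΩ.exitTime_pos hz₀.1 hz₀.2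
  set τ₀ := exitTime Ω z₀.1 z₀.2
  set J := IsRollingDomain.chordConst R r
  have hκ : 0 ≤ transportConst c L := by unfold transportConst; positivity
  set D := transportConst c L * 1 * (m₀ * (K + (1 + 2 * τ₀)) +
    m₁ * (2 * J / ‖z₀.2‖) * (1 + 2 * ‖z₀.2‖ * K + 1)) with hD
  have hD0 : 0 ≤ D := by positivity
  refine ⟨Real.toNNReal D, U ∩ W, inter_mem (mem_nhdsWithin_of_mem_nhds hU) hW, ?_⟩
  refine LipschitzOnWith.of_dist_le_mul ?_
  rintro ⟨x', v'⟩ hz' ⟨x, v⟩ hz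
  have hzm := hUsub hz.1
  have hzm' := hUsub hz'.1
  have hcmp := hUcmp _ hz.1 _ hz'.1
  have hcmp0 := hUcmp _ hz.1 _ hz₀U
  rw [Real.coe_toNNReal _ hD0, Real.dist_eq, dist_eq_norm]
  refine (hg.abs_opS_sub_le hΩ hν hzm.1 hzm.2 hzm'.1 hzm'.2 hcmp rfl rfl).trans ?_
  have hτ := hΩ.exitTime_pos hzm.1 hzm.2
  have hvp : 0 < ‖v‖ := norm_pos_iff.mpr hzm.2
  dsimp only at hτ
  set δ := ‖(x', v') - (x, v)‖ with hδ
  have hn1 : ‖x' - x‖ ≤ δ := norm_fst_le ((x', v') - (x, v))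
  have hn2 : ‖v' - v‖ ≤ δ := norm_snd_le ((x', v') - (x, v))
  have hT : |exitTime Ω x' v' - exitTime Ω x v| ≤ K * δ := by
    have := hWlip.dist_le_mul _ hz'.2 _ hz.2
    rwa [Real.dist_eq, dist_eq_norm] at this
  have hTd : |exitTime Ω x' v' - exitTime Ω x v| / (1 + exitTime Ω x v) ≤ K * δ := by
    rw [div_le_iff₀ (by positivity)]
    have : 0 ≤ K * δ := by positivity
    nlinarith
  have h2 : exitTime Ω x v ≤ 2 * τ₀ := hcmp0.time
  have h3 : ‖v‖ ≤ 2 * ‖z₀.2‖ := hcmp0.speed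
  have h4 : J / ‖v‖ ≤ 2 * J / ‖z₀.2‖ := by
    have : ‖z₀.2‖ ≤ 2 * ‖v‖ := hcmp0.speed'
    rw [div_le_div_iff₀ hvp hv₀]
    nlinarith
  calc _ ≤ transportConst c L * 1 * (m₀ * (K * δ + (1 + 2 * τ₀) * δ) +
      m₁ * (2 * J / ‖z₀.2‖) * (δ + 2 * ‖z₀.2‖ * (K * δ) + δ)) := by
        gcongr
        exact exp_neg_mul_sq_le_one hα v
    _ = D * δ := by rw [hD]; ring

/-- The one-sided increment bound passes to right difference quotients; using the directions e and
-e bounds the absolute value. -/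
lemma IsRollingDomain.abs_fderiv_exitTime_le (hΩ : IsRollingDomain Ω R r) {x v : E3}
    (hx : x ∈ Ω) (hv : v ≠ 0)
    (hd : DifferentiableAt ℝ (fun z : E3 × E3 => exitTime Ω z.1 z.2) (x, v)) (e : E3 × E3) :
    |fderiv ℝ (fun z : E3 × E3 => exitTime Ω z.1 z.2) (x, v) e| ≤
      2 * (‖e.1‖ + exitTime Ω x v * ‖e.2‖) / (‖v‖ * exitCos Ω x v) := by
  have ha : 0 < ‖v‖ * exitCos Ω x v :=
    mul_pos (norm_pos_iff.mpr hv) (hΩ.exitCos_pos hx hv)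
  have key : ∀ e : E3 × E3, fderiv ℝ (fun z : E3 × E3 => exitTime Ω z.1 z.2) (x, v) e ≤
      2 * (‖e.1‖ + exitTime Ω x v * ‖e.2‖) / (‖v‖ * exitCos Ω x v) := by
    intro e
    have ht := (hd.hasFDerivAt.hasLineDerivAt e).tendsto_slope_zero_right
    refine le_of_tendsto ht ?_
    have hsmall : ∀ᶠ t : ℝ in 𝓝[>] 0, ‖t • e.2‖ ≤ ‖v‖ * exitCos Ω x v / 2 := by
      have hcont : Continuous fun t : ℝ => ‖t • e.2‖ := by fun_prop
      have := (hcont.tendsto 0).mono_left (nhdsWithin_le_nhds (s := Ioi 0))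
      rw [zero_smul, norm_zero] at this
      exact (this.eventually (gt_mem_nhds (by positivity))).mono fun t h => h.le
    filter_upwards [hsmall, self_mem_nhdsWithin] with t ht ht0
    have ht0' : (0 : ℝ) < t := ht0
    have h1 := hΩ.exitTime_sub_le hx hv (x + t • e.1) (v' := v + t • e.2)
      (by rw [add_sub_cancel_left]; exact ht)
    rw [add_sub_cancel_left, add_sub_cancel_left, norm_smul, norm_smul,
      Real.norm_of_nonneg ht0'.le] at h1
    change t⁻¹ * (exitTime Ω (x + t • e.1) (v + t • e.2) - exitTime Ω x v) ≤ _
    rw [inv_mul_le_iff₀ ht0']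
    refine h1.trans (le_of_eq ?_)
    ring
  rw [abs_le]
  refine ⟨?_, key e⟩
  have := key (-e)
  rw [map_neg, Prod.fst_neg, Prod.snd_neg, norm_neg, norm_neg] at this
  linarith

/-- After the limit in difference quotients, the weight w = |v|N/(1+|v|) cancels the factor 1/(|v|N)
from the exit time. Moreover w ≤ |v| removes the 1/|v| of the chord integral and gives wτ ≤ τ|v| ≤
diam Ω. -/
lemma IsRegularSource.abs_fderiv_opS_le (hΩ : IsRollingDomain Ω R r)
    (hg : IsRegularSource Ω γ α m₀ m₁ g) (hν : FrequencyBounds γ c L ν) {x v : E3}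
    (hx : x ∈ Ω) (hv : v ≠ 0)
    (hτd : DifferentiableAt ℝ (fun z : E3 × E3 => exitTime Ω z.1 z.2) (x, v))
    (hfd : DifferentiableAt ℝ (opS Ω ν fun z => g z.1 z.2) (x, v)) (e : E3 × E3) :
    weight Ω (x, v) * |fderiv ℝ (opS Ω ν fun z => g z.1 z.2) (x, v) e| ≤
      3 * transportConst c L * Real.exp (-α * ‖v‖ ^ 2) *
        (m₀ * (1 + Metric.diam Ω) + m₁ * IsRollingDomain.chordConst R r) *
          (‖e.1‖ + ‖e.2‖) := by
  have hc := hν.c_pos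
  have hL := hν.L_nonneg
  have hm₀ := hg.nonneg₀
  have hm₁ := hg.nonneg₁
  have hJ := hΩ.chordConst_pos
  have hτ0 := hΩ.exitTime_pos hx hv
  have hvp : 0 < ‖v‖ := norm_pos_iff.mpr hv
  have hN := hΩ.exitCos_pos hx hv
  have hN1 := hΩ.exitCos_le_one hx hv
  have hdiam := hΩ.exitTime_mul_norm_le_diam hx hv
  have hκ : 0 ≤ transportConst c L := by unfold transportConst; positivity
  obtain ⟨U, hU, hUsub, hUcmp⟩ := hΩ.exists_nhds_comparable γ α (z₀ := (x, v)) ⟨hx, hv⟩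
  have hDτ := hΩ.abs_fderiv_exitTime_le hx hv hτd e
  set f := opS Ω ν fun z => g z.1 z.2 with hf
  set τ := exitTime Ω x v with hτ
  set N := exitCos Ω x v with hNdef
  set J := IsRollingDomain.chordConst R r with hJdef
  set E := Real.exp (-α * ‖v‖ ^ 2) with hE
  have hE0 : 0 < E := Real.exp_pos _
  set p := |fderiv ℝ (fun z : E3 × E3 => exitTime Ω z.1 z.2) (x, v) e| with hp
  have t1 := (hfd.hasFDerivAt.hasLineDerivAt e).tendsto_slope_zero_right.abs
  have t2 := (hτd.hasFDerivAt.hasLineDerivAt e).tendsto_slope_zero_right.abs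
  rw [← hp] at t2
  have t3 : Tendsto (fun t : ℝ => transportConst c L * E *
        (m₀ * (|t⁻¹ • ((fun z : E3 × E3 => exitTime Ω z.1 z.2) ((x, v) + t • e) -
          (fun z : E3 × E3 => exitTime Ω z.1 z.2) (x, v))| / (1 + τ) + (1 + τ) * ‖e.2‖) +
          m₁ * (J / ‖v‖) * (‖e.1‖ + ‖v‖ *
          (|t⁻¹ • ((fun z : E3 × E3 => exitTime Ω z.1 z.2) ((x, v) + t • e) -
          (fun z : E3 × E3 => exitTime Ω z.1 z.2) (x, v))| / (1 + τ)) + ‖e.2‖))) (𝓝[>] 0)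
      (𝓝 (transportConst c L * E * (m₀ * (p / (1 + τ) + (1 + τ) * ‖e.2‖) +
          m₁ * (J / ‖v‖) * (‖e.1‖ + ‖v‖ * (p / (1 + τ)) + ‖e.2‖)))) := by
    have t4 := t2.div_const (1 + τ)
    exact ((((t4.add_const _).const_mul _).add
      ((((t4.const_mul ‖v‖).const_add _).add_const _).const_mul _)).const_mul _)
  have hDf : |fderiv ℝ f (x, v) e| ≤
      transportConst c L * E * (m₀ * (p / (1 + τ) + (1 + τ) * ‖e.2‖) +
          m₁ * (J / ‖v‖) * (‖e.1‖ + ‖v‖ * (p / (1 + τ)) + ‖e.2‖)) := by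
    refine le_of_tendsto_of_tendsto t1 t3 ?_
    have hev : ∀ᶠ t : ℝ in 𝓝[>] 0, (x, v) + t • e ∈ U := by
      have hcont : Continuous fun t : ℝ => (x, v) + t • e := by fun_prop
      have := (hcont.tendsto 0).mono_left (nhdsWithin_le_nhds (s := Ioi 0))
      rw [zero_smul, add_zero] at this
      exact this.eventually hU
    filter_upwards [hev, self_mem_nhdsWithin] with t htU ht0
    have ht0' : (0 : ℝ) < t := ht0
    have hmem := hUsub htU
    have h1 := hg.abs_opS_sub_le hΩ hν hx hv hmem.1 hmem.2
      (hUcmp _ (mem_of_mem_nhds hU) _ htU) hτ rfl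
    rw [← hf, ← hE, ← hJdef] at h1
    simp only [smul_eq_mul, abs_mul, abs_of_pos (inv_pos.mpr ht0')]
    rw [inv_mul_le_iff₀ ht0']
    refine h1.trans (le_of_eq ?_)
    simp only [Prod.fst_add, Prod.snd_add, Prod.smul_fst, Prod.smul_snd, add_sub_cancel_left,
      norm_smul, Real.norm_of_nonneg ht0'.le]
    rw [← hτ]
    field_simp
  -- weighted estimate
  set S := ‖e.1‖ + ‖e.2‖ with hS
  have he1 : ‖e.1‖ ≤ S := le_add_of_nonneg_right (norm_nonneg _)
  have he2 : ‖e.2‖ ≤ S := le_add_of_nonneg_left (norm_nonneg _)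
  have hS0 : 0 ≤ S := by positivity
  have hw : weight Ω (x, v) = ‖v‖ / (‖v‖ + 1) * N := rfl
  -- Here |e.1| + τ|e.2| ≤ (1+τ)S, so the division by 1+τ removes all dependence on τ.
  have hpq : p / (1 + τ) ≤ 2 * S / (‖v‖ * N) := by
    rw [div_le_iff₀ (by positivity)]
    refine hDτ.trans ?_
    rw [div_mul_eq_mul_div]
    refine div_le_div_of_nonneg_right ?_ (by positivity)
    have := mul_nonneg hτ0.le (norm_nonneg e.1)
    have := norm_nonneg e.2
    rw [hS]
    nlinarith
  have hw0 : 0 ≤ weight Ω (x, v) := by rw [hw]; positivity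
  have hw1 : weight Ω (x, v) * (2 * S / (‖v‖ * N)) ≤ 2 * S := by
    have : weight Ω (x, v) * (2 * S / (‖v‖ * N)) = 2 * S / (‖v‖ + 1) := by
      rw [hw]; field_simp
    rw [this]
    exact div_le_self (by positivity) (by linarith)
  have hwle : weight Ω (x, v) ≤ ‖v‖ := by
    rw [hw]
    calc ‖v‖ / (‖v‖ + 1) * N ≤ ‖v‖ * 1 :=
          mul_le_mul (div_le_self hvp.le (by linarith)) hN1 hN.le hvp.le
      _ = ‖v‖ := mul_one _
  have hwle1 : weight Ω (x, v) ≤ 1 := by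
    rw [hw]
    calc ‖v‖ / (‖v‖ + 1) * N ≤ 1 * 1 :=
          mul_le_mul ((div_le_one (by positivity)).mpr (by linarith)) hN1 hN.le zero_le_one
      _ = 1 := mul_one _
  have hwτ : weight Ω (x, v) * (1 + τ) ≤ 1 + Metric.diam Ω := by
    have := mul_le_mul_of_nonneg_right hwle hτ0.le
    nlinarith
  have hd0 := Metric.diam_nonneg (s := Ω)
  set w := weight Ω (x, v) with hwdef
  have b1 : w * (p / (1 + τ)) ≤ 2 * S := (mul_le_mul_of_nonneg_left hpq hw0).trans hw1
  have b2 : w * ((1 + τ) * ‖e.2‖) ≤ (1 + Metric.diam Ω) * S := by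
    rw [← mul_assoc]
    exact mul_le_mul hwτ he2 (norm_nonneg _) (by positivity)
  have b3 : w / ‖v‖ ≤ 1 := (div_le_one hvp).mpr hwle
  calc w * |fderiv ℝ f (x, v) e| ≤ w * (transportConst c L * E *
        (m₀ * (p / (1 + τ) + (1 + τ) * ‖e.2‖) +
          m₁ * (J / ‖v‖) * (‖e.1‖ + ‖v‖ * (p / (1 + τ)) + ‖e.2‖))) :=
        mul_le_mul_of_nonneg_left hDf hw0
    _ = transportConst c L * E * (m₀ * (w * (p / (1 + τ)) + w * ((1 + τ) * ‖e.2‖)) +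
          m₁ * J * (w / ‖v‖ * S + w * (p / (1 + τ)))) := by
        rw [hS]; field_simp; ring
    _ ≤ transportConst c L * E * (m₀ * (2 * S + (1 + Metric.diam Ω) * S) +
          m₁ * J * (1 * S + 2 * S)) := by gcongr
    _ ≤ transportConst c L * E * (3 * (m₀ * (1 + Metric.diam Ω) + m₁ * J) * S) := by
        refine mul_le_mul_of_nonneg_left ?_ (by positivity)
        have h1 : 0 ≤ m₀ * Metric.diam Ω * S := by positivity
        linarith
    _ = _ := by ring

lemma IsRegularSource.abs_opS_le (hΩ : IsRollingDomain Ω R r)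
    (hg : IsRegularSource Ω γ α m₀ m₁ g) (hν : FrequencyBounds γ c L ν) {x v : E3}
    (hx : x ∈ Ω) (hv : v ≠ 0) :
    |opS Ω ν (fun z => g z.1 z.2) (x, v)| ≤ m₀ / c * Real.exp (-α * ‖v‖ ^ 2) := by
  have hc := hν.c_pos
  have hm₀ := hg.nonneg₀
  have hτ0 := hΩ.exitTime_pos hx hv
  rw [opS_eq, ← Real.norm_eq_abs]
  dsimp only
  set τ := exitTime Ω x v
  set E := Real.exp (-α * ‖v‖ ^ 2) with hE
  have hb := intervalIntegral.norm_integral_le_of_norm_le (a := 0) (b := 1) (μ := volume)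
    zero_le_one (f := fun σ => τ * Real.exp (-(ν v * σ * τ)) * g (x - (σ * τ) • v) v)
    (g := fun σ => m₀ * E / c * (c * τ * Real.exp (-(c * τ * σ)))) (by
      filter_upwards with σ hσ
      rw [norm_mul, Real.norm_of_nonneg (by positivity)]
      have h1 : Real.exp (-(ν v * σ * τ)) ≤ Real.exp (-(c * τ * σ)) := by
        rw [Real.exp_le_exp]
        have := mul_le_mul_of_nonneg_right (hν.c_le v) (show 0 ≤ σ * τ from
          mul_nonneg hσ.1.le hτ0.le)
        nlinarith
      calc τ * Real.exp (-(ν v * σ * τ)) * ‖g (x - (σ * τ) • v) v‖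
          ≤ τ * Real.exp (-(c * τ * σ)) * (m₀ * E) :=
            mul_le_mul (mul_le_mul_of_nonneg_left h1 hτ0.le) (hg.bound _ _) (norm_nonneg _)
              (by positivity)
        _ = _ := by field_simp) ((by fun_prop : Continuous _).intervalIntegrable _ _)
  refine hb.trans ?_
  rw [intervalIntegral.integral_const_mul]
  calc _ ≤ m₀ * E / c * 1 :=
        mul_le_mul_of_nonneg_left (integral_mul_exp_neg_le (β := c * τ)) (by positivity)
    _ = _ := by ring

end

/-! ### Weak gradients of locally Lipschitz functions -/

/-- Integration by parts for a function that is locally Lipschitz on an open set containing the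
support of the test function. -/
lemma integral_mul_fderiv_eq_of_locallyLipschitzOn {E : Type*} [NormedAddCommGroup E]
    [NormedSpace ℝ E] [FiniteDimensional ℝ E] [MeasurableSpace E] [BorelSpace E] {μ : Measure E}
    [μ.IsAddHaarMeasure] {D : Set E} (hD : IsOpen D) {f φ : E → ℝ}
    (hf : LocallyLipschitzOn D f) (hφ : ContDiff ℝ (⊤ : ℕ∞) φ) (hφc : HasCompactSupport φ)
    (hφD : tsupport φ ⊆ D) (a : E) :
    ∫ z, f z * fderiv ℝ φ z a ∂μ = - ∫ z, fderiv ℝ f z a * φ z ∂μ := by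
  have : ProperSpace E := FiniteDimensional.proper_rclike ℝ E
  obtain ⟨δ, hδ, hsub⟩ := hφc.isCompact.exists_cthickening_subset_open hD hφD
  set K := Metric.cthickening δ (tsupport φ) with hK
  have hKc : IsCompact K := hφc.isCompact.cthickening
  -- Lipschitz on a compact neighbourhood of the support, f is replaced by a globally Lipschitz
  -- extension, for which integration by parts is available.
  obtain ⟨C, hC⟩ := (hf.mono hsub).exists_lipschitzOnWith_of_compact hKc
  obtain ⟨g, hg, hfg⟩ := hC.extend_real
  obtain ⟨C', hφl⟩ := hφ.lipschitzWith_of_hasCompactSupport hφc (by simp)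
  have hnear : ∀ z ∈ tsupport φ, f =ᶠ[𝓝 z] g := by
    intro z hz
    have hmem : Metric.thickening δ (tsupport φ) ∈ 𝓝 z :=
      Metric.isOpen_thickening.mem_nhds (Metric.self_subset_thickening hδ _ hz)
    filter_upwards [hmem] with y hy
    exact hfg (Metric.thickening_subset_cthickening _ _ hy)
  have h := hg.integral_lineDeriv_mul_eq hφl hφc (μ := μ) a
  have h1 : ∫ z, lineDeriv ℝ g z a * φ z ∂μ = ∫ z, fderiv ℝ f z a * φ z ∂μ := by
    refine integral_congr_ae ?_
    filter_upwards [hg.ae_differentiableAt (μ := μ)] with z hz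
    by_cases hzs : z ∈ tsupport φ
    · rw [hz.lineDeriv_eq_fderiv, (hnear z hzs).fderiv_eq]
    · simp [image_eq_zero_of_notMem_tsupport hzs]
  have h2 : ∫ z, lineDeriv ℝ φ z (-a) * g z ∂μ = - ∫ z, f z * fderiv ℝ φ z a ∂μ := by
    rw [← integral_neg]
    refine integral_congr_ae (Eventually.of_forall fun z => ?_)
    simp only
    rw [(hφ.differentiable (by simp) z).lineDeriv_eq_fderiv, map_neg]
    by_cases hzs : z ∈ tsupport φ
    · rw [(hnear z hzs).eq_of_nhds]; ring
    · rw [image_eq_zero_of_notMem_tsupport fun hh => hzs (tsupport_fderiv_subset ℝ hh)]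
      simp
  rw [h1, h2] at h
  rw [h, neg_neg]

instance isAddHaarMeasure_volume_phase : (volume : Measure (E3 × E3)).IsAddHaarMeasure := by
  rw [Measure.volume_eq_prod]
  infer_instance

/-- Rademacher's theorem near each point; a locally null set is null. -/
lemma LocallyLipschitzOn.ae_differentiableAt {E : Type*} [NormedAddCommGroup E]
    [NormedSpace ℝ E] [FiniteDimensional ℝ E] [MeasurableSpace E] [BorelSpace E] {μ : Measure E}
    [μ.IsAddHaarMeasure] {D : Set E} (hD : IsOpen D) {f : E → ℝ}
    (hf : LocallyLipschitzOn D f) : ∀ᵐ z ∂μ, z ∈ D → DifferentiableAt ℝ f z := by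
  have : ProperSpace E := FiniteDimensional.proper_rclike ℝ E
  have hloc : ∀ z ∈ D, ∃ t ∈ 𝓝[D] z, μ (t ∩ {y | ¬ DifferentiableAt ℝ f y}) = 0 := by
    intro z hz
    obtain ⟨K, t, ht, hlip⟩ := hf hz
    rw [hD.nhdsWithin_eq hz] at ht
    refine ⟨interior t, mem_nhdsWithin_of_mem_nhds (interior_mem_nhds.mpr ht), ?_⟩
    have h := (hlip.mono interior_subset).ae_differentiableWithinAt_of_mem (μ := μ)
    rw [ae_iff] at h
    refine measure_mono_null ?_ h
    rintro y ⟨hy1, hy2⟩ hcon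
    exact hy2 ((hcon hy1).differentiableAt (isOpen_interior.mem_nhds hy1))
  have hnull : μ (D ∩ {y | ¬ DifferentiableAt ℝ f y}) = 0 := by
    refine measure_null_of_locally_null _ fun z hz => ?_
    obtain ⟨t, ht, htn⟩ := hloc z hz.1
    refine ⟨t ∩ {y | ¬ DifferentiableAt ℝ f y}, ?_, htn⟩
    exact inter_mem (nhdsWithin_mono _ inter_subset_left ht)
      (mem_of_superset self_mem_nhdsWithin inter_subset_right)
  rw [ae_iff]
  refine measure_mono_null ?_ hnull
  intro z hz
  simp only [mem_ofPred_eq, Classical.not_imp] at hz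
  exact hz

lemma volume_compl_movingPhase (Ω : Set E3) :
    (Ω ×ˢ univ : Set (E3 × E3)) =ᵐ[volume] IsRollingDomain.movingPhase Ω := by
  have h : ∀ᵐ z : E3 × E3, z.2 ≠ 0 := by
    have h0 : ∀ᵐ v : E3, v ≠ 0 := by simp [ae_iff]
    exact Measure.quasiMeasurePreserving_snd.ae h0
  filter_upwards [h] with z hz
  refine propext ⟨fun hh => ⟨hh.1, hz⟩, fun hh => ⟨hh.1, mem_univ _⟩⟩

lemma ae_phaseMeasure_mem {Ω : Set E3} (hΩ : IsOpen Ω) :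
    ∀ᵐ z ∂phaseMeasure Ω, z ∈ IsRollingDomain.movingPhase Ω := by
  rw [phaseMeasure, Measure.restrict_congr_set (volume_compl_movingPhase Ω)]
  exact ae_restrict_mem (hΩ.prod isOpen_compl_singleton).measurableSet

section

variable {Ω : Set E3} {R r B : ℝ}

/-- The singularity 1/|v| is locally integrable in dimension three, and the distance to the boundary
is bounded below on compact subsets of Ω. -/
lemma IsRollingDomain.locallyIntegrableOn_of_bound {F : Type*} [NormedAddCommGroup F]
    (hΩ : IsRollingDomain Ω R r) {f : E3 × E3 → F}
    (hm : AEStronglyMeasurable f (phaseMeasure Ω)) (hB : 0 ≤ B)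
    (hb : ∀ᵐ z ∂phaseMeasure Ω, ‖f z‖ ≤
      B * (1 + (1 + ‖z.2‖) / ‖z.2‖) * (Real.sqrt (Metric.infDist z.1 Ωᶜ))⁻¹) :
    LocallyIntegrableOn f (Ω ×ˢ univ) volume := by
  rintro ⟨x₀, v₀⟩ ⟨hx₀, -⟩
  obtain ⟨ε, hε, hball⟩ := Metric.isOpen_iff.mp hΩ.isOpen x₀ hx₀
  set K := Metric.closedBall x₀ (ε / 2) with hK
  have hKc : IsCompact K := isCompact_closedBall _ _
  have hKΩ : K ⊆ Ω := (Metric.closedBall_subset_ball (by linarith)).trans hball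
  set V := Metric.closedBall v₀ 1 with hV
  have hVc : IsCompact V := isCompact_closedBall _ _
  obtain ⟨b, hb0, hbK⟩ := exists_inv_sqrt_infDist_le hΩ hKc hKΩ
  refine ⟨K ×ˢ V, mem_nhdsWithin_of_mem_nhds (prod_mem_nhds (Metric.closedBall_mem_nhds _ (by linarith))
    (Metric.closedBall_mem_nhds _ one_pos)), ?_⟩
  have hKV : K ×ˢ V ⊆ (Ω ×ˢ univ : Set (E3 × E3)) := prod_mono hKΩ (subset_univ _)
  have hi : IntegrableOn (fun z : E3 × E3 => B * b * (1 + (1 + ‖z.2‖) / ‖z.2‖)) (K ×ˢ V) := by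
    rw [IntegrableOn, Measure.volume_eq_prod, ← Measure.prod_restrict]
    exact Integrable.mul_prod (f := fun _ => B * b) (integrableOn_const hKc.measure_lt_top.ne)
      (locallyIntegrable_one_add_div.integrableOn_isCompact hVc)
  refine Integrable.mono' hi (hm.mono_measure (Measure.restrict_mono hKV le_rfl)) ?_
  have hb' : ∀ᵐ z ∂(volume.restrict (K ×ˢ V)), ‖f z‖ ≤
      B * (1 + (1 + ‖z.2‖) / ‖z.2‖) * (Real.sqrt (Metric.infDist z.1 Ωᶜ))⁻¹ :=
    ae_mono (Measure.restrict_mono hKV le_rfl) hb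
  filter_upwards [hb', ae_restrict_mem (hKc.measurableSet.prod hVc.measurableSet)] with z hz hzK
  refine hz.trans ?_
  calc B * (1 + (1 + ‖z.2‖) / ‖z.2‖) * (Real.sqrt (Metric.infDist z.1 Ωᶜ))⁻¹
      ≤ B * (1 + (1 + ‖z.2‖) / ‖z.2‖) * b :=
        mul_le_mul_of_nonneg_left (hbK _ hzK.1) (by positivity)
    _ = _ := by ring

lemma IsRollingDomain.infDist_le_R (hΩ : IsRollingDomain Ω R r) {x : E3} (hx : x ∈ Ω) :
    Metric.infDist x Ωᶜ ≤ R := by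
  have hv : (EuclideanSpace.single 0 1 : E3) ≠ 0 := by simp
  have h1 := hΩ.infDist_le_exitCos hx hv
  have h2 := hΩ.exitCos_le_one hx hv
  have h3 := hΩ.exitCos_pos hx hv
  have := hΩ.R_pos
  have h4 : exitCos Ω x (EuclideanSpace.single 0 1 : E3) ^ 2 ≤ 1 := by nlinarith
  nlinarith

lemma LocallyLipschitzOn.aestronglyMeasurable_phase (hΩ : IsRollingDomain Ω R r)
    {f : E3 × E3 → ℝ} (hf : LocallyLipschitzOn (IsRollingDomain.movingPhase Ω) f) :
    AEStronglyMeasurable f (phaseMeasure Ω) := by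
  rw [phaseMeasure, Measure.restrict_congr_set (volume_compl_movingPhase Ω)]
  exact hf.continuousOn.aestronglyMeasurable hΩ.isOpen_movingPhase.measurableSet

/-- The spatial part of the classical gradient. -/
def gradX (f : E3 × E3 → ℝ) (z : E3 × E3) : E3 :=
  (InnerProductSpace.toDual ℝ E3).symm
    ((fderiv ℝ f z).comp (ContinuousLinearMap.inl ℝ E3 E3))

/-- The velocity part of the classical gradient. -/
def gradV (f : E3 × E3 → ℝ) (z : E3 × E3) : E3 :=
  (InnerProductSpace.toDual ℝ E3).symm
    ((fderiv ℝ f z).comp (ContinuousLinearMap.inr ℝ E3 E3))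

lemma inner_gradX (f : E3 × E3 → ℝ) (z : E3 × E3) (e : E3) :
    inner ℝ (gradX f z) e = fderiv ℝ f z (e, 0) := by
  simp [gradX]

lemma inner_gradV (f : E3 × E3 → ℝ) (z : E3 × E3) (e : E3) :
    inner ℝ (gradV f z) e = fderiv ℝ f z (0, e) := by
  simp [gradV]

lemma stronglyMeasurable_gradX (f : E3 × E3 → ℝ) : StronglyMeasurable (gradX f) := by
  have h1 : Measurable (fderiv ℝ f) := measurable_fderiv ℝ f
  have h2 : Continuous fun A : (E3 × E3) →L[ℝ] ℝ => (InnerProductSpace.toDual ℝ E3).symm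
      (A.comp (ContinuousLinearMap.inl ℝ E3 E3)) := by fun_prop
  exact (h2.measurable.comp h1).stronglyMeasurable

lemma stronglyMeasurable_gradV (f : E3 × E3 → ℝ) : StronglyMeasurable (gradV f) := by
  have h1 : Measurable (fderiv ℝ f) := measurable_fderiv ℝ f
  have h2 : Continuous fun A : (E3 × E3) →L[ℝ] ℝ => (InnerProductSpace.toDual ℝ E3).symm
      (A.comp (ContinuousLinearMap.inr ℝ E3 E3)) := by fun_prop
  exact (h2.measurable.comp h1).stronglyMeasurable

lemma norm_gradX_le {f : E3 × E3 → ℝ} {z : E3 × E3} {b : ℝ}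
    (h : ∀ e : E3 × E3, |fderiv ℝ f z e| ≤ b * (‖e.1‖ + ‖e.2‖)) (hb : 0 ≤ b) :
    ‖gradX f z‖ ≤ b := by
  rw [gradX, LinearIsometryEquiv.norm_map]
  refine ContinuousLinearMap.opNorm_le_bound _ hb fun e => ?_
  simpa using h (e, 0)

lemma norm_gradV_le {f : E3 × E3 → ℝ} {z : E3 × E3} {b : ℝ}
    (h : ∀ e : E3 × E3, |fderiv ℝ f z e| ≤ b * (‖e.1‖ + ‖e.2‖)) (hb : 0 ≤ b) :
    ‖gradV f z‖ ≤ b := by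
  rw [gradV, LinearIsometryEquiv.norm_map]
  refine ContinuousLinearMap.opNorm_le_bound _ hb fun e => ?_
  simpa using h (0, e)

/-- Removing the velocity `0`: integration by parts against test functions on `Ω × ℝ³`. -/
lemma IsRollingDomain.integral_mul_fderiv_eq (hΩ : IsRollingDomain Ω R r) {f : E3 × E3 → ℝ}
    (hf : LocallyLipschitzOn (movingPhase Ω) f) {m : ℝ} (hm : 0 ≤ m)
    (hfb : ∀ z ∈ movingPhase Ω, |f z| ≤ m) {a : E3 × E3}
    (hfa : LocallyIntegrableOn (fun z => fderiv ℝ f z a) (Ω ×ˢ univ) volume)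
    {φ : E3 × E3 → ℝ} (hφ : ContDiff ℝ (⊤ : ℕ∞) φ) (hφc : HasCompactSupport φ)
    (hφΩ : tsupport φ ⊆ Ω ×ˢ univ) :
    ∫ z in Ω ×ˢ univ, f z * fderiv ℝ φ z a = - ∫ z in Ω ×ˢ univ, fderiv ℝ f z a * φ z := by
  let b : ContDiffBump (0 : E3) := ⟨1, 2, one_pos, one_lt_two⟩
  set K := tsupport φ with hK
  have hKc : IsCompact K := hφc
  have hbs : ContDiff ℝ (⊤ : ℕ∞) b := b.contDiff
  have hfm := LocallyLipschitzOn.aestronglyMeasurable_phase hΩ hf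
  -- the cutoff functions
  set ψ : ℕ → E3 × E3 → ℝ := fun n z => φ z * (1 - b ((n + 1 : ℝ) • z.2)) with hψ
  have hcut : ∀ n : ℕ, ContDiff ℝ (⊤ : ℕ∞) fun z : E3 × E3 => 1 - b ((n + 1 : ℝ) • z.2) :=
    fun n => contDiff_const.sub (hbs.comp (contDiff_snd.const_smul _))
  have hψs : ∀ n, ContDiff ℝ (⊤ : ℕ∞) (ψ n) := fun n => hφ.mul (hcut n)
  have hψsub : ∀ n, tsupport (ψ n) ⊆ K := fun n => closure_mono fun z hz => left_ne_zero_of_mul hz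
  have hψc : ∀ n, HasCompactSupport (ψ n) := fun n =>
    hKc.of_isClosed_subset (isClosed_tsupport _) (hψsub n)
  have hψD : ∀ n, tsupport (ψ n) ⊆ movingPhase Ω := by
    intro n z hz
    refine ⟨(hφΩ (hψsub n hz)).1, fun hz2 => ?_⟩
    have hz0 : z.2 = 0 := hz2
    have hev : ∀ᶠ y in 𝓝 z, ψ n y = 0 := by
      have hcont : Continuous fun y : E3 × E3 => ‖(n + 1 : ℝ) • y.2‖ := by fun_prop
      have : ∀ᶠ y in 𝓝 z, ‖(n + 1 : ℝ) • y.2‖ < 1 :=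
        hcont.continuousAt.eventually (gt_mem_nhds (by simp [hz0]))
      filter_upwards [this] with y hy
      have h1 : b ((n + 1 : ℝ) • y.2) = 1 := b.one_of_mem_closedBall (by
        rw [mem_closedBall_zero_iff]; exact hy.le)
      simp [hψ, h1]
    exact (notMem_tsupport_iff_eventuallyEq.mpr hev) hz
  -- the identity for the truncated test functions
  have hA : ∀ n, ∫ z in Ω ×ˢ univ, f z * fderiv ℝ (ψ n) z a =
      - ∫ z in Ω ×ˢ univ, fderiv ℝ f z a * ψ n z := by
    intro n
    have h := integral_mul_fderiv_eq_of_locallyLipschitzOn (μ := (volume : Measure (E3 × E3)))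
      hΩ.isOpen_movingPhase hf (hψs n) (hψc n) (hψD n) a
    rw [setIntegral_eq_integral_of_forall_compl_eq_zero, h,
      setIntegral_eq_integral_of_forall_compl_eq_zero]
    · intro z hz
      rw [image_eq_zero_of_notMem_tsupport fun hh => hz (hφΩ (hψsub n hh)), mul_zero]
    · intro z hz
      rw [image_eq_zero_of_notMem_tsupport fun hh =>
        hz (hφΩ (hψsub n (tsupport_fderiv_subset ℝ hh)))]
      simp
  -- derivative of the truncated test functions
  obtain ⟨cb, hcb⟩ := (hbs.continuous_fderiv (by simp)).bounded_above_of_compact_support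
    (b.hasCompactSupport.fderiv ℝ)
  have hcb0 : 0 ≤ cb := (norm_nonneg _).trans (hcb 0)
  have hdψ : ∀ n z, fderiv ℝ (ψ n) z a = fderiv ℝ φ z a * (1 - b ((n + 1 : ℝ) • z.2)) -
      φ z * fderiv ℝ b ((n + 1 : ℝ) • z.2) ((n + 1 : ℝ) • a.2) := by
    intro n z
    have d1 : HasFDerivAt φ (fderiv ℝ φ z) z := (hφ.differentiable (by simp) z).hasFDerivAt
    have d2 : HasFDerivAt (fun z : E3 × E3 => (n + 1 : ℝ) • z.2)
        ((n + 1 : ℝ) • ContinuousLinearMap.snd ℝ E3 E3) z :=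
      ((n + 1 : ℝ) • ContinuousLinearMap.snd ℝ E3 E3).hasFDerivAt
    have d3 : HasFDerivAt (fun z : E3 × E3 => b ((n + 1 : ℝ) • z.2))
        ((fderiv ℝ b ((n + 1 : ℝ) • z.2)).comp ((n + 1 : ℝ) • ContinuousLinearMap.snd ℝ E3 E3)) z :=
      HasFDerivAt.comp (g := b) z (hbs.differentiable (by simp) _).hasFDerivAt d2
    have d4 : HasFDerivAt (ψ n) _ z := d1.mul (d3.const_sub 1)
    rw [d4.fderiv]
    simp
    ring
  have hb01 : ∀ y, 0 ≤ 1 - b y ∧ 1 - b y ≤ 1 := fun y =>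
    ⟨by linarith [b.le_one (x := y)], by linarith [b.nonneg (x := y)]⟩
  have hlim : ∀ z : E3 × E3, z.2 ≠ 0 → ∀ᶠ n : ℕ in atTop, ψ n z = φ z ∧
      fderiv ℝ (ψ n) z a = fderiv ℝ φ z a := by
    intro z hz
    have hzp : 0 < ‖z.2‖ := norm_pos_iff.mpr hz
    obtain ⟨n₀, hn₀⟩ := exists_nat_gt (2 / ‖z.2‖)
    filter_upwards [eventually_ge_atTop n₀] with n hn
    have h1 : 2 < ‖(n + 1 : ℝ) • z.2‖ := by
      rw [norm_smul, Real.norm_of_nonneg (by positivity)]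
      rw [div_lt_iff₀ hzp] at hn₀
      have : (n₀ : ℝ) ≤ n := by exact_mod_cast hn
      nlinarith
    have hnot : (n + 1 : ℝ) • z.2 ∉ tsupport b := by
      rw [b.tsupport_eq, mem_closedBall_zero_iff, not_le]
      exact h1
    have h2 : b ((n + 1 : ℝ) • z.2) = 0 := image_eq_zero_of_notMem_tsupport hnot
    have h3 : fderiv ℝ b ((n + 1 : ℝ) • z.2) = 0 :=
      image_eq_zero_of_notMem_tsupport fun hh => hnot (tsupport_fderiv_subset ℝ hh)
    exact ⟨by simp [hψ, h2], by rw [hdψ, h2, h3]; simp⟩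
  have hne : ∀ᵐ z ∂(volume.restrict (Ω ×ˢ univ : Set (E3 × E3))), z ∈ movingPhase Ω :=
    ae_phaseMeasure_mem hΩ.isOpen
  obtain ⟨c₁, hc₁⟩ := hφ.continuous.bounded_above_of_compact_support hφc
  have hc₁0 : 0 ≤ c₁ := (norm_nonneg _).trans (hc₁ 0)
  have hφ'c : Continuous fun z => fderiv ℝ φ z a :=
    (hφ.continuous_fderiv (by simp)).clm_apply continuous_const
  obtain ⟨c₂, hc₂⟩ := hφ'c.bounded_above_of_compact_support
    (HasCompactSupport.intro hKc fun z hz => by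
      rw [image_eq_zero_of_notMem_tsupport fun hh => hz (tsupport_fderiv_subset ℝ hh)]; rfl)
  have hc₂0 : 0 ≤ c₂ := (norm_nonneg _).trans (hc₂ 0)
  -- passage to the limit on the left
  have hL : Tendsto (fun n => ∫ z in Ω ×ˢ univ, f z * fderiv ℝ (ψ n) z a) atTop
      (𝓝 (∫ z in Ω ×ˢ univ, f z * fderiv ℝ φ z a)) := by
    set q : E3 × E3 → ℝ := K.indicator fun z =>
      m * (c₂ + 2 * c₁ * cb * ‖a.2‖) * (1 + (1 + ‖z.2‖) / ‖z.2‖) with hq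
    have hqi : Integrable q (volume.restrict (Ω ×ˢ univ)) := by
      have hli : LocallyIntegrableOn (fun z : E3 × E3 =>
          m * (c₂ + 2 * c₁ * cb * ‖a.2‖) * (1 + (1 + ‖z.2‖) / ‖z.2‖)) (Ω ×ˢ univ) volume := by
        refine hΩ.locallyIntegrableOn_of_bound (Measurable.aestronglyMeasurable (by fun_prop))
          (B := m * (c₂ + 2 * c₁ * cb * ‖a.2‖) * Real.sqrt R) (by positivity) ?_
        filter_upwards [hne] with z hz
        rw [Real.norm_of_nonneg (by positivity)]
        have hd := hΩ.infDist_pos hz.1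
        have h1 : 1 ≤ Real.sqrt R * (Real.sqrt (Metric.infDist z.1 Ωᶜ))⁻¹ := by
          rw [← div_eq_mul_inv, one_le_div (Real.sqrt_pos.mpr hd)]
          exact Real.sqrt_le_sqrt (hΩ.infDist_le_R hz.1)
        calc m * (c₂ + 2 * c₁ * cb * ‖a.2‖) * (1 + (1 + ‖z.2‖) / ‖z.2‖)
            ≤ m * (c₂ + 2 * c₁ * cb * ‖a.2‖) * (1 + (1 + ‖z.2‖) / ‖z.2‖) *
              (Real.sqrt R * (Real.sqrt (Metric.infDist z.1 Ωᶜ))⁻¹) :=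
              le_mul_of_one_le_right (by positivity) h1
          _ = _ := by ring
      have := hli.integrableOn_compact_subset hφΩ hKc
      exact ((integrable_indicator_iff hKc.measurableSet).mpr this).restrict
    refine tendsto_integral_of_dominated_convergence q (fun n => ?_) hqi (fun n => ?_) ?_
    · refine hfm.mul (Continuous.aestronglyMeasurable ?_)
      exact ((hψs n).continuous_fderiv (by simp)).clm_apply continuous_const
    · filter_upwards [hne] with z hz
      have hzp : 0 < ‖z.2‖ := norm_pos_iff.mpr hz.2
      by_cases hzK : z ∈ K
      · rw [hq, indicator_of_mem hzK, norm_mul]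
        have h1 : ‖fderiv ℝ (ψ n) z a‖ ≤
            (c₂ + 2 * c₁ * cb * ‖a.2‖) * (1 + (1 + ‖z.2‖) / ‖z.2‖) := by
          rw [hdψ]
          -- The cutoff gradient has size of order n + 1, but only where (n+1)|v| ≤ 2; hence the
          -- majorant of order 1/|v|, independent of n and locally integrable.
          have hs : ‖fderiv ℝ b ((n + 1 : ℝ) • z.2) ((n + 1 : ℝ) • a.2)‖ ≤
              2 * cb * ‖a.2‖ / ‖z.2‖ := by
            by_cases hsup : (n + 1 : ℝ) • z.2 ∈ tsupport b
            · rw [b.tsupport_eq, mem_closedBall_zero_iff, norm_smul,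
                Real.norm_of_nonneg (by positivity)] at hsup
              have hsup' : (n + 1 : ℝ) ≤ 2 / ‖z.2‖ := by
                rw [le_div_iff₀ hzp]; exact hsup
              refine (ContinuousLinearMap.le_opNorm _ _).trans ?_
              rw [norm_smul, Real.norm_of_nonneg (by positivity)]
              calc _ ≤ cb * (2 / ‖z.2‖ * ‖a.2‖) := by
                    gcongr
                    exact hcb _
                _ = _ := by ring
            · rw [image_eq_zero_of_notMem_tsupport fun hh =>
                hsup (tsupport_fderiv_subset ℝ hh)]
              simp only [zero_apply, norm_zero]
              positivity
          have h3 : ‖fderiv ℝ φ z a * (1 - b ((n + 1 : ℝ) • z.2))‖ ≤ c₂ * 1 := by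
            rw [norm_mul]
            refine mul_le_mul (hc₂ z) ?_ (norm_nonneg _) hc₂0
            rw [Real.norm_of_nonneg (hb01 _).1]
            exact (hb01 _).2
          have h4 : ‖φ z * fderiv ℝ b ((n + 1 : ℝ) • z.2) ((n + 1 : ℝ) • a.2)‖ ≤
              c₁ * (2 * cb * ‖a.2‖ / ‖z.2‖) := by
            rw [norm_mul]
            exact mul_le_mul (hc₁ z) hs (norm_nonneg _) hc₁0
          refine (norm_sub_le _ _).trans ((add_le_add h3 h4).trans ?_)
          have h5 : 1 ≤ 1 + (1 + ‖z.2‖) / ‖z.2‖ := le_add_of_nonneg_right (by positivity)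
          have h6 : 1 / ‖z.2‖ ≤ 1 + (1 + ‖z.2‖) / ‖z.2‖ := by
            rw [add_div]
            have : 0 ≤ ‖z.2‖ / ‖z.2‖ := by positivity
            linarith
          calc c₂ * 1 + c₁ * (2 * cb * ‖a.2‖ / ‖z.2‖)
              = c₂ * 1 + (2 * c₁ * cb * ‖a.2‖) * (1 / ‖z.2‖) := by ring
            _ ≤ c₂ * (1 + (1 + ‖z.2‖) / ‖z.2‖) +
                (2 * c₁ * cb * ‖a.2‖) * (1 + (1 + ‖z.2‖) / ‖z.2‖) := by gcongr
            _ = _ := by ring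
        calc ‖f z‖ * ‖fderiv ℝ (ψ n) z a‖
            ≤ m * ((c₂ + 2 * c₁ * cb * ‖a.2‖) * (1 + (1 + ‖z.2‖) / ‖z.2‖)) :=
              mul_le_mul (hfb z hz) h1 (norm_nonneg _) hm
          _ = _ := by ring
      · rw [hq, indicator_of_notMem hzK, image_eq_zero_of_notMem_tsupport fun hh =>
          hzK (hψsub n (tsupport_fderiv_subset ℝ hh))]
        simp
    · filter_upwards [hne] with z hz
      refine tendsto_const_nhds.congr' ?_
      filter_upwards [hlim z hz.2] with n hn
      rw [hn.2]
  have hR : Tendsto (fun n => ∫ z in Ω ×ˢ univ, fderiv ℝ f z a * ψ n z) atTop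
      (𝓝 (∫ z in Ω ×ˢ univ, fderiv ℝ f z a * φ z)) := by
    have hfam : Measurable fun z => fderiv ℝ f z a := measurable_fderiv_apply_const ℝ f a
    have hqi : Integrable (K.indicator fun z => ‖fderiv ℝ f z a‖ * c₁)
        (volume.restrict (Ω ×ˢ univ)) :=
      ((integrable_indicator_iff hKc.measurableSet).mpr
        ((hfa.integrableOn_compact_subset hφΩ hKc).norm.mul_const c₁)).restrict
    refine tendsto_integral_of_dominated_convergence _ (fun n => ?_) hqi (fun n => ?_) ?_
    · exact hfam.aestronglyMeasurable.mul (hψs n).continuous.aestronglyMeasurable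
    · refine Eventually.of_forall fun z => ?_
      by_cases hzK : z ∈ K
      · rw [indicator_of_mem hzK, norm_mul]
        refine mul_le_mul_of_nonneg_left ?_ (norm_nonneg _)
        simp only [hψ, norm_mul]
        rw [Real.norm_of_nonneg (hb01 _).1]
        calc _ ≤ c₁ * 1 := mul_le_mul (hc₁ z) (hb01 _).2 (hb01 _).1 hc₁0
          _ = c₁ := mul_one _
      · rw [indicator_of_notMem hzK, image_eq_zero_of_notMem_tsupport fun hh => hzK (hψsub n hh)]
        simp
    · filter_upwards [hne] with z hz
      refine tendsto_const_nhds.congr' ?_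
      filter_upwards [hlim z hz.2] with n hn
      rw [hn.1]
  refine tendsto_nhds_unique hL ?_
  simp only [hA]
  exact hR.neg

lemma IsRollingDomain.hasWeakGradients (hΩ : IsRollingDomain Ω R r) {f : E3 × E3 → ℝ}
    (hf : LocallyLipschitzOn (movingPhase Ω) f) {m : ℝ} (hm : 0 ≤ m)
    (hfb : ∀ z ∈ movingPhase Ω, |f z| ≤ m) (hB : 0 ≤ B)
    (hfd : ∀ᵐ z ∂phaseMeasure Ω, ∀ e : E3 × E3, |fderiv ℝ f z e| ≤
      B * (1 + (1 + ‖z.2‖) / ‖z.2‖) * (Real.sqrt (Metric.infDist z.1 Ωᶜ))⁻¹ *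
        (‖e.1‖ + ‖e.2‖)) :
    HasWeakGradients Ω f (gradX f) (gradV f) := by
  have hdir : ∀ a : E3 × E3,
      LocallyIntegrableOn (fun z => fderiv ℝ f z a) (Ω ×ˢ univ) volume := fun a => by
    refine hΩ.locallyIntegrableOn_of_bound
      (measurable_fderiv_apply_const ℝ f a).aestronglyMeasurable
      (B := B * (‖a.1‖ + ‖a.2‖)) (by positivity) ?_
    filter_upwards [hfd] with z hz
    refine (hz a).trans (le_of_eq ?_)
    ring
  refine ⟨?_, ?_, ?_, fun φ hφ hφc hφΩ e => ?_, fun φ hφ hφc hφΩ e => ?_⟩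
  · refine hΩ.locallyIntegrableOn_of_bound
      (LocallyLipschitzOn.aestronglyMeasurable_phase hΩ hf)
      (B := m * Real.sqrt R) (by positivity) ?_
    filter_upwards [ae_phaseMeasure_mem hΩ.isOpen] with z hz
    have hd := hΩ.infDist_pos hz.1
    have h1 : 1 ≤ Real.sqrt R * (Real.sqrt (Metric.infDist z.1 Ωᶜ))⁻¹ := by
      rw [← div_eq_mul_inv, one_le_div (Real.sqrt_pos.mpr hd)]
      exact Real.sqrt_le_sqrt (hΩ.infDist_le_R hz.1)
    have h2 : 1 ≤ 1 + (1 + ‖z.2‖) / ‖z.2‖ := le_add_of_nonneg_right (by positivity)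
    calc ‖f z‖ ≤ m := hfb z hz
      _ ≤ m * ((1 + (1 + ‖z.2‖) / ‖z.2‖) *
          (Real.sqrt R * (Real.sqrt (Metric.infDist z.1 Ωᶜ))⁻¹)) :=
          le_mul_of_one_le_right hm (one_le_mul_of_one_le_of_one_le h2 h1)
      _ = _ := by ring
  · refine hΩ.locallyIntegrableOn_of_bound (stronglyMeasurable_gradX f).aestronglyMeasurable hB ?_
    filter_upwards [hfd] with z hz
    exact norm_gradX_le hz (by positivity)
  · refine hΩ.locallyIntegrableOn_of_bound (stronglyMeasurable_gradV f).aestronglyMeasurable hB ?_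
    filter_upwards [hfd] with z hz
    exact norm_gradV_le hz (by positivity)
  · simp only [inner_gradX]
    exact hΩ.integral_mul_fderiv_eq hf hm hfb (hdir _) hφ hφc hφΩ
  · simp only [inner_gradV]
    exact hΩ.integral_mul_fderiv_eq hf hm hfb (hdir _) hφ hφc hφΩ

end

/-! ### Almost everywhere statements along characteristics -/

/-- Each shear (x,v) ↦ (x - sv, v) is an invertible linear map and preserves null sets; Fubini
exchanges the quantifiers over s and (x,v). -/
lemma ae_ae_sub_smul {P : E3 × E3 → Prop} (h : ∀ᵐ z, P z) :
    ∀ᵐ z : E3 × E3, ∀ᵐ s : ℝ, P (z.1 - s • z.2, z.2) := by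
  have hshear : ∀ s : ℝ, Measure.QuasiMeasurePreserving
      (fun z : E3 × E3 => (z.1 - s • z.2, z.2)) volume volume := by
    intro s
    let A : (E3 × E3) ≃ₗ[ℝ] (E3 × E3) :=
      { toFun := fun z => (z.1 - s • z.2, z.2)
        invFun := fun z => (z.1 + s • z.2, z.2)
        map_add' := fun z z' => by
          ext1
          · simp only [Prod.fst_add, Prod.snd_add, smul_add]; abel
          · rfl
        map_smul' := fun a z => by
          ext1
          · simp [smul_sub, smul_comm a s]
          · rfl
        left_inv := fun z => by simp
        right_inv := fun z => by simp }
    exact Measure.LinearMap.quasiMeasurePreserving volume (A : (E3 × E3) →ₗ[ℝ] (E3 × E3))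
      A.isUnit_det'.ne_zero
  have hq : Measure.QuasiMeasurePreserving
      (fun p : (E3 × E3) × ℝ => (p.1.1 - p.2 • p.1.2, p.1.2))
      ((volume : Measure (E3 × E3)).prod volume) volume :=
    QuasiMeasurePreserving.prod_of_left (by fun_prop) (Eventually.of_forall hshear)
  exact Measure.ae_ae_of_ae_prod (hq.ae h)

section

variable {Ω : Set E3} {R r γ α m₀ m₁ M A c L C : ℝ} {g : E3 → E3 → ℝ} {ν : E3 → ℝ}
  {k : E3 → E3 → ℝ} {h h₀ : E3 × E3 → ℝ} {G : E3 × E3 → E3}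

lemma IsRegularSource.continuousOn_uncurry (hΩ : IsRollingDomain Ω R r) (hα : 0 ≤ α)
    (hγ : 0 ≤ γ) (hg : IsRegularSource Ω γ α m₀ m₁ g) :
    ContinuousOn (Function.uncurry g) (Ω ×ˢ univ) := by
  rintro ⟨x, v⟩ ⟨hx, -⟩
  have hm0 := hg.nonneg₀
  have hx1 : ContinuousAt (fun y => g y v) x :=
    (hg.continuousOn hΩ v).continuousAt (hΩ.isOpen.mem_nhds hx)
  have hx2 : Tendsto (fun z : E3 × E3 => |g z.1 v - g x v|) (𝓝 (x, v)) (𝓝 0) := by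
    have h1 : ContinuousAt (fun z : E3 × E3 => |g z.1 v - g x v|) (x, v) :=
      ((hx1.comp (f := Prod.fst) (x := (x, v)) continuousAt_fst).sub continuousAt_const).abs
    simpa [ContinuousAt] using h1
  have hv2 : Tendsto (fun z : E3 × E3 => m₀ * (2 + ‖v‖) ^ γ * ‖z.2 - v‖) (𝓝 (x, v)) (𝓝 0) := by
    have h1 : Continuous fun z : E3 × E3 => m₀ * (2 + ‖v‖) ^ γ * ‖z.2 - v‖ := by fun_prop
    simpa using h1.tendsto (x, v)
  refine ContinuousAt.continuousWithinAt ?_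
  rw [ContinuousAt, tendsto_iff_dist_tendsto_zero]
  have hlim := hx2.add hv2
  rw [add_zero] at hlim
  refine squeeze_zero' (Eventually.of_forall fun _ => dist_nonneg) ?_ hlim
  have hnear : ∀ᶠ z : E3 × E3 in 𝓝 (x, v), ‖z.2 - v‖ < 1 := by
    have h1 : Continuous fun z : E3 × E3 => ‖z.2 - v‖ := by fun_prop
    exact h1.continuousAt.eventually (gt_mem_nhds (by simp))
  filter_upwards [hnear] with z hz
  have h1 : |g z.1 z.2 - g z.1 v| ≤ m₀ * (2 + ‖v‖) ^ γ * ‖z.2 - v‖ := by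
    refine hg.lipschitz_v _ _ _ _ fun θ hθ => ?_
    have h2 : ‖v + θ • (z.2 - v)‖ ≤ ‖v‖ + 1 := by
      refine (norm_add_le _ _).trans (add_le_add_right ?_ _)
      rw [norm_smul, Real.norm_of_nonneg hθ.1]
      nlinarith [hθ.1, hθ.2, norm_nonneg (z.2 - v)]
    calc (1 + ‖v + θ • (z.2 - v)‖) ^ γ * Real.exp (-α * ‖v + θ • (z.2 - v)‖ ^ 2)
        ≤ (2 + ‖v‖) ^ γ * 1 := by
          refine mul_le_mul (Real.rpow_le_rpow (by positivity) (by linarith) hγ)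
            (exp_neg_mul_sq_le_one hα _) (by positivity) (by positivity)
      _ = _ := mul_one _
  rw [Real.dist_eq]
  calc |Function.uncurry g z - Function.uncurry g (x, v)|
      = |(g z.1 v - g x v) + (g z.1 z.2 - g z.1 v)| := by
        congr 1; simp only [Function.uncurry]; ring
    _ ≤ _ := (abs_add_le _ _).trans (by gcongr)

/-- Joint continuity of g on Ω × ℝ³ makes the set of agreement measurable, which Fubini requires to
pass from slices to the product. -/
lemma IsRegularSource.ae_eq_of_forall_ae (hΩ : IsRollingDomain Ω R r) (hα : 0 ≤ α)
    (hγ : 0 ≤ γ) (hg : IsRegularSource Ω γ α m₀ m₁ g) {F : E3 × E3 → ℝ} (hF : Measurable F)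
    (h : ∀ v, ∀ᵐ x, g x v = F (x, v)) :
    ∀ᵐ z : E3 × E3, z.1 ∈ Ω → g z.1 z.2 = F z := by
  classical
  have hΩm : MeasurableSet (Ω ×ˢ univ : Set (E3 × E3)) := hΩ.isOpen.measurableSet.prod .univ
  have hgm : Measurable ((Ω ×ˢ univ : Set (E3 × E3)).piecewise (Function.uncurry g) 0) :=
    (hg.continuousOn_uncurry hΩ hα hγ).measurable_piecewise continuousOn_const hΩm
  have hset : MeasurableSet {z : E3 × E3 | z.1 ∈ Ω → g z.1 z.2 = F z} := by
    convert measurableSet_eq_fun hgm (hF.indicator hΩm) using 1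
    ext z
    by_cases hz : z.1 ∈ Ω
    · have hz' : z ∈ (Ω ×ˢ univ : Set (E3 × E3)) := ⟨hz, mem_univ _⟩
      simp [hz, hz', Function.uncurry]
    · have hz' : z ∉ (Ω ×ˢ univ : Set (E3 × E3)) := fun hh => hz hh.1
      simp [hz, hz']
  rw [Measure.volume_eq_prod, Measure.ae_prod_iff_ae_ae hset,
    Measure.ae_ae_comm (p := fun x v => x ∈ Ω → g x v = F (x, v)) hset]
  refine Eventually.of_forall fun v => ?_
  filter_upwards [h v] with x hx _ using hx

lemma IsRegularSource.intervalIntegrable_exp_mul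
    (hΩ : IsRollingDomain Ω R r) (hg : IsRegularSource Ω γ α m₀ m₁ g) (ν : E3 → ℝ)
    {z : E3 × E3} (hz : z ∈ IsRollingDomain.movingPhase Ω) :
    IntervalIntegrable (fun s : ℝ => Real.exp (-ν z.2 * s) * g (z.1 - s • z.2) z.2) volume 0
      (exitTime Ω z.1 z.2) := by
  have hτ := hΩ.exitTime_pos hz.1 hz.2
  rw [intervalIntegrable_iff_integrableOn_Ioo_of_le hτ.le]
  have hc : ContinuousOn (fun s : ℝ => g (z.1 - s • z.2) z.2) (Ioo 0 (exitTime Ω z.1 z.2)) :=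
    (hg.continuousOn hΩ z.2).comp (f := fun s : ℝ => z.1 - s • z.2) (by fun_prop) fun s hs =>
      IsRollingDomain.sub_smul_mem_of_lt_exitTime hs.1.le hs.2
  have hi : IntegrableOn (fun s : ℝ => Real.exp (-ν z.2 * s)) (Ioo 0 (exitTime Ω z.1 z.2)) :=
    ((by fun_prop : Continuous _).integrableOn_Icc).mono_set Ioo_subset_Icc_self
  exact hi.mul_bdd (c := m₀ * Real.exp (-α * ‖z.2‖ ^ 2))
    (hc.aestronglyMeasurable measurableSet_Ioo) (Eventually.of_forall fun s => hg.bound _ _)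

/-- Replacing the source by an almost everywhere equal one does not change the transport
integrals, for almost every starting point. -/
lemma IsRegularSource.ae_opS_eq (hΩ : IsRollingDomain Ω R r)
    (hg : IsRegularSource Ω γ α m₀ m₁ g) (ν : E3 → ℝ) {F : E3 × E3 → ℝ}
    (hF : ∀ᵐ z : E3 × E3, z.1 ∈ Ω → g z.1 z.2 = F z) :
    ∀ᵐ z ∂phaseMeasure Ω, IntervalIntegrable
        (fun s : ℝ => Real.exp (-ν z.2 * s) * F (z.1 - s • z.2, z.2)) volume 0
          (exitTime Ω z.1 z.2) ∧
      opS Ω ν (fun z => g z.1 z.2) z = opS Ω ν F z := by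
  have h1 := ae_mono (Measure.restrict_le_self (s := (Ω ×ˢ univ : Set (E3 × E3))))
    (ae_ae_sub_smul hF)
  filter_upwards [h1, ae_phaseMeasure_mem hΩ.isOpen] with z hz hzm
  have hτ := hΩ.exitTime_pos hzm.1 hzm.2
  have hae : ∀ᵐ s : ℝ, s ∈ uIoc 0 (exitTime Ω z.1 z.2) →
      Real.exp (-ν z.2 * s) * g (z.1 - s • z.2) z.2 =
        Real.exp (-ν z.2 * s) * F (z.1 - s • z.2, z.2) := by
    have hne : ∀ᵐ s : ℝ, s ≠ exitTime Ω z.1 z.2 := by simp [ae_iff]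
    filter_upwards [hz, hne] with s hs hsτ hsI
    rw [uIoc_of_le hτ.le] at hsI
    have hmem : z.1 - s • z.2 ∈ Ω := IsRollingDomain.sub_smul_mem_of_lt_exitTime hsI.1.le
      (lt_of_le_of_ne hsI.2 hsτ)
    rw [← hs hmem]
  refine ⟨(hg.intervalIntegrable_exp_mul hΩ ν hzm).congr_ae ?_, ?_⟩
  · exact (ae_restrict_iff' measurableSet_uIoc).mpr hae
  · exact intervalIntegral.integral_congr_ae hae

/-! ### Essential suprema -/

lemma ae_norm_le_of_supNorm_le {F : Type*} [NormedAddCommGroup F] {f : E3 × E3 → F}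
    (hM : 0 ≤ M) (hf : supNorm Ω α f ≤ ENNReal.ofReal M) :
    ∀ᵐ z ∂phaseMeasure Ω, ‖f z‖ ≤ M * Real.exp (-α * ‖z.2‖ ^ 2) := by
  filter_upwards [ENNReal.ae_le_essSup (μ := phaseMeasure Ω)
    fun z : E3 × E3 => ENNReal.ofReal (Real.exp (α * ‖z.2‖ ^ 2)) * ‖f z‖ₑ] with z hz
  have h1 := hz.trans hf
  rw [← ofReal_norm, ← ENNReal.ofReal_mul (by positivity), ENNReal.ofReal_le_ofReal_iff hM] at h1
  rw [neg_mul, Real.exp_neg, ← div_eq_mul_inv, le_div_iff₀ (by positivity)]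
  linarith

lemma supNorm_le_of_ae_norm_le {F : Type*} [NormedAddCommGroup F] {f : E3 × E3 → F}
    (hf : ∀ᵐ z ∂phaseMeasure Ω, ‖f z‖ ≤ M * Real.exp (-α * ‖z.2‖ ^ 2)) :
    supNorm Ω α f ≤ ENNReal.ofReal M := by
  refine essSup_le_of_ae_le _ ?_
  filter_upwards [hf] with z hz
  rw [← ofReal_norm, ← ENNReal.ofReal_mul (by positivity)]
  refine ENNReal.ofReal_le_ofReal ?_
  rw [neg_mul, Real.exp_neg, ← div_eq_mul_inv, le_div_iff₀ (by positivity)] at hz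
  linarith

lemma IsRollingDomain.weight_pos (hΩ : IsRollingDomain Ω R r) {z : E3 × E3}
    (hz : z ∈ movingPhase Ω) : 0 < weight Ω z := by
  have h1 := hΩ.exitCos_pos hz.1 hz.2
  have h2 : 0 < ‖z.2‖ := norm_pos_iff.mpr hz.2
  rw [weight]
  positivity

/-- Trades the exit cosine, which depends on direction, for the distance to the boundary, which does
not; this allows the gradient bound to be integrated over velocities at fixed x. -/
lemma IsRollingDomain.inv_weight_le (hΩ : IsRollingDomain Ω R r) {z : E3 × E3}
    (hz : z ∈ movingPhase Ω) :
    (weight Ω z)⁻¹ ≤ Real.sqrt R * ((1 + (1 + ‖z.2‖) / ‖z.2‖) *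
      (Real.sqrt (Metric.infDist z.1 Ωᶜ))⁻¹) := by
  have h1 := hΩ.exitCos_pos hz.1 hz.2
  have h2 : 0 < ‖z.2‖ := norm_pos_iff.mpr hz.2
  have hd := Real.sqrt_pos.mpr (hΩ.infDist_pos hz.1)
  have hR := hΩ.R_pos
  have h3 : Real.sqrt (Metric.infDist z.1 Ωᶜ) ≤ Real.sqrt R * exitCos Ω z.1 z.2 := by
    have := Real.sqrt_le_sqrt (hΩ.infDist_le_exitCos hz.1 hz.2)
    rwa [Real.sqrt_mul hR.le, Real.sqrt_sq h1.le] at this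
  have h4 : (exitCos Ω z.1 z.2)⁻¹ ≤ Real.sqrt R * (Real.sqrt (Metric.infDist z.1 Ωᶜ))⁻¹ := by
    rw [← div_eq_mul_inv, le_div_iff₀ hd, inv_mul_le_iff₀ h1]
    linarith
  calc (weight Ω z)⁻¹ = (1 + ‖z.2‖) / ‖z.2‖ * (exitCos Ω z.1 z.2)⁻¹ := by
        rw [weight, mul_inv, inv_div, add_comm 1]
    _ ≤ (1 + (1 + ‖z.2‖) / ‖z.2‖) *
        (Real.sqrt R * (Real.sqrt (Metric.infDist z.1 Ωᶜ))⁻¹) := by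
        gcongr
        linarith
    _ = _ := by ring

lemma HasWeakGradients.congr {f f' : E3 × E3 → ℝ} {H : E3 × E3 → E3} (hΩ : IsOpen Ω)
    (hf : HasWeakGradients Ω f G H) (hff : f =ᵐ[phaseMeasure Ω] f') :
    HasWeakGradients Ω f' G H := by
  refine ⟨?_, hf.locallyIntegrable_x, hf.locallyIntegrable_v, fun φ h1 h2 h3 e => ?_,
    fun φ h1 h2 h3 e => ?_⟩
  · rw [locallyIntegrableOn_iff (hΩ.prod isOpen_univ).isLocallyClosed]
    intro K hK hKc
    exact (hf.locallyIntegrable.integrableOn_compact_subset hK hKc).congr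
      (ae_mono (Measure.restrict_mono hK le_rfl) hff)
  · rw [← hf.weak_x φ h1 h2 h3 e]
    exact integral_congr_ae (hff.symm.mono fun z hz => by simp only [hz])
  · rw [← hf.weak_v φ h1 h2 h3 e]
    exact integral_congr_ae (hff.symm.mono fun z hz => by simp only [hz])

lemma HasWeakGradients.exists_isBoundedWeakPair {H : E3 × E3 → E3} (hΩ : IsRollingDomain Ω R r)
    (hM : 0 ≤ M) (hA : 0 ≤ A) (hh : HasWeakGradients Ω h G H)
    (hs : supNorm Ω α h ≤ ENNReal.ofReal M) (hw : weightedSupNorm Ω α G ≤ ENNReal.ofReal A) :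
    ∃ h₀ G₀, h₀ =ᵐ[phaseMeasure Ω] h ∧ IsBoundedWeakPair Ω α M (A * Real.sqrt R) h₀ G₀ := by
  have hd : Measurable fun z : E3 × E3 => Metric.infDist z.1 Ωᶜ :=
    (Metric.continuous_infDist_pt Ωᶜ).measurable.comp measurable_fst
  obtain ⟨h₀, hm, he, hb⟩ := exists_stronglyMeasurable_bounded
    hh.locallyIntegrable.aestronglyMeasurable
    (b := fun z => M * Real.exp (-α * ‖z.2‖ ^ 2)) (by fun_prop) (fun z => by positivity)
    (ae_norm_le_of_supNorm_le hM hs)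
  obtain ⟨G₀, hGm, hGe, hGb⟩ := exists_stronglyMeasurable_bounded
    hh.locallyIntegrable_x.aestronglyMeasurable
    (b := fun z => A * Real.sqrt R * Real.exp (-α * ‖z.2‖ ^ 2) * (1 + (1 + ‖z.2‖) / ‖z.2‖) *
      (Real.sqrt (Metric.infDist z.1 Ωᶜ))⁻¹) (by fun_prop) (fun z => by positivity) (by
        filter_upwards [ae_norm_le_of_supNorm_le hA hw, ae_phaseMeasure_mem hΩ.isOpen]
          with z hz hzm
        have hwp := hΩ.weight_pos hzm
        rw [norm_smul, Real.norm_of_nonneg hwp.le, ← le_inv_mul_iff₀ hwp] at hz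
        refine hz.trans ((mul_le_mul_of_nonneg_right (hΩ.inv_weight_le hzm)
          (by positivity)).trans (le_of_eq ?_))
        ring)
  refine ⟨h₀, G₀, he, hm, hGm, hb, hGb, fun φ h1 h2 h3 e => ?_⟩
  have e1 : ∫ z in Ω ×ˢ univ, h₀ z * fderiv ℝ φ z (e, 0) =
      ∫ z in Ω ×ˢ univ, h z * fderiv ℝ φ z (e, 0) :=
    integral_congr_ae (he.mono fun z hz => by simp only [hz])
  have e2 : ∫ z in Ω ×ˢ univ, inner ℝ (G₀ z) e * φ z =
      ∫ z in Ω ×ˢ univ, inner ℝ (G z) e * φ z :=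
    integral_congr_ae (hGe.mono fun z hz => by simp only [hz])
  rw [e1, e2, hh.weak_x φ h1 h2 h3 e]

lemma ae_slice_ae_eq (hΩ : IsOpen Ω) (he : h₀ =ᵐ[phaseMeasure Ω] h) :
    ∀ᵐ z : E3 × E3, z.1 ∈ Ω → (fun u => h₀ (z.1, u)) =ᵐ[volume] fun u => h (z.1, u) := by
  have h1 := (ae_restrict_iff' (hΩ.prod isOpen_univ).measurableSet).mp he
  rw [Measure.volume_eq_prod] at h1
  have h2 := Measure.ae_ae_of_ae_prod h1
  filter_upwards [Measure.quasiMeasurePreserving_fst.ae h2] with z hz hzΩ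
  filter_upwards [hz] with u hu using hu ⟨hzΩ, mem_univ _⟩

/-! ### The gain of regularity -/

/-- The classical gradient, defined almost everywhere, is the weak one. The factor 6 counts the two
gradients, each bounded with the constant 3. -/
lemma IsRegularSource.fullNorm_opS_le (hΩ : IsRollingDomain Ω R r) (hα : 0 ≤ α)
    (hg : IsRegularSource Ω γ α m₀ m₁ g) (hν : FrequencyBounds γ c L ν) {f : E3 × E3 → ℝ}
    (hf : opS Ω ν (fun z => g z.1 z.2) =ᵐ[phaseMeasure Ω] f) :
    fullNorm Ω α f ≤ ENNReal.ofReal (m₀ / c + 6 * transportConst c L *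
      (m₀ * (1 + Metric.diam Ω) + m₁ * IsRollingDomain.chordConst R r)) := by
  have hc := hν.c_pos
  have hL := hν.L_nonneg
  have hm₀ := hg.nonneg₀
  have hm₁ := hg.nonneg₁
  have hJ := hΩ.chordConst_pos
  have hD : 0 ≤ Metric.diam Ω := Metric.diam_nonneg
  have hT : 0 ≤ transportConst c L := by rw [transportConst]; positivity
  set Q := 3 * transportConst c L *
      (m₀ * (1 + Metric.diam Ω) + m₁ * IsRollingDomain.chordConst R r) with hQ
  have hQ0 : 0 ≤ Q := by positivity
  set F := opS Ω ν fun z => g z.1 z.2 with hF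
  have hlip := hg.locallyLipschitzOn_opS hΩ hα hν
  have hfd : ∀ᵐ z ∂phaseMeasure Ω, z ∈ IsRollingDomain.movingPhase Ω ∧ ∀ e : E3 × E3,
      |fderiv ℝ F z e| ≤ (weight Ω z)⁻¹ * (Q * Real.exp (-α * ‖z.2‖ ^ 2)) *
        (‖e.1‖ + ‖e.2‖) := by
    have a1 := ae_mono (Measure.restrict_le_self (s := (Ω ×ˢ univ : Set (E3 × E3))))
      (LocallyLipschitzOn.ae_differentiableAt (μ := volume) hΩ.isOpen_movingPhase hlip)
    have a2 := ae_mono (Measure.restrict_le_self (s := (Ω ×ˢ univ : Set (E3 × E3))))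
      (LocallyLipschitzOn.ae_differentiableAt (μ := volume) hΩ.isOpen_movingPhase
        hΩ.locallyLipschitzOn_exitTime)
    filter_upwards [a1, a2, ae_phaseMeasure_mem hΩ.isOpen] with z h1 h2 hz
    refine ⟨hz, fun e => ?_⟩
    have := hg.abs_fderiv_opS_le hΩ hν hz.1 hz.2 (h2 hz) (h1 hz) e
    rw [mul_assoc, le_inv_mul_iff₀ (hΩ.weight_pos hz)]
    refine this.trans (le_of_eq ?_)
    rw [hQ]; ring
  have hbd : ∀ z ∈ IsRollingDomain.movingPhase Ω, |F z| ≤ m₀ / c * Real.exp (-α * ‖z.2‖ ^ 2) :=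
    fun z hz => hg.abs_opS_le hΩ hν hz.1 hz.2
  have hweak : HasWeakGradients Ω F (gradX F) (gradV F) := by
    refine hΩ.hasWeakGradients hlip (m := m₀ / c) (by positivity) (fun z hz => ?_)
      (B := Q * Real.sqrt R) (by positivity) ?_
    · exact (hbd z hz).trans (mul_le_of_le_one_right (by positivity) (exp_neg_mul_sq_le_one hα _))
    · filter_upwards [hfd] with z hz e
      refine (hz.2 e).trans (mul_le_mul_of_nonneg_right ?_ (by positivity))
      calc (weight Ω z)⁻¹ * (Q * Real.exp (-α * ‖z.2‖ ^ 2))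
          ≤ (Real.sqrt R * ((1 + (1 + ‖z.2‖) / ‖z.2‖) *
              (Real.sqrt (Metric.infDist z.1 Ωᶜ))⁻¹)) * (Q * 1) := by
            gcongr
            · exact hΩ.inv_weight_le hz.1
            · exact exp_neg_mul_sq_le_one hα _
        _ = _ := by ring
  have hw := hweak.congr hΩ.isOpen hf
  have s0 : supNorm Ω α f ≤ ENNReal.ofReal (m₀ / c) := by
    refine supNorm_le_of_ae_norm_le ?_
    filter_upwards [hf, ae_phaseMeasure_mem hΩ.isOpen] with z hz hzm
    rw [← hz]
    exact hbd z hzm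
  have s1 : weightedSupNorm Ω α (gradX F) ≤ ENNReal.ofReal Q := by
    refine supNorm_le_of_ae_norm_le ?_
    filter_upwards [hfd] with z hz
    have hwp := hΩ.weight_pos hz.1
    rw [norm_smul, Real.norm_of_nonneg hwp.le, ← le_inv_mul_iff₀ hwp]
    exact norm_gradX_le hz.2 (by positivity)
  have s2 : weightedSupNorm Ω α (gradV F) ≤ ENNReal.ofReal Q := by
    refine supNorm_le_of_ae_norm_le ?_
    filter_upwards [hfd] with z hz
    have hwp := hΩ.weight_pos hz.1
    rw [norm_smul, Real.norm_of_nonneg hwp.le, ← le_inv_mul_iff₀ hwp]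
    exact norm_gradV_le hz.2 (by positivity)
  calc fullNorm Ω α f
      ≤ supNorm Ω α f + weightedSupNorm Ω α (gradX F) + weightedSupNorm Ω α (gradV F) :=
        iInf_le_of_le _ (iInf_le_of_le _ (iInf_le _ hw))
    _ ≤ ENNReal.ofReal (m₀ / c) + ENNReal.ofReal Q + ENNReal.ofReal Q := by gcongr
    _ = ENNReal.ofReal (m₀ / c + Q + Q) := by
        rw [ENNReal.ofReal_add (by positivity) hQ0, ENNReal.ofReal_add (by positivity) hQ0]
    _ = _ := by congr 1; rw [hQ]; ring

/-- The constant in the smoothing estimate, in terms of the constants in the bounds for the kernel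
and for the collision frequency. -/
def smoothingConst (C c L : ℝ) : ℝ := C * (1 / c + 18 * transportConst c L)

lemma HasWeakGradients.fullNorm_opS_opK_le {H : E3 × E3 → E3} (hΩ : IsRollingDomain Ω R r)
    (hα : 0 ≤ α) (hk : KernelBounds γ α C k) (hν : FrequencyBounds γ c L ν)
    (hM : 0 ≤ M) (hA : 0 ≤ A) (hh : HasWeakGradients Ω h G H)
    (hs : supNorm Ω α h ≤ ENNReal.ofReal M) (hw : weightedSupNorm Ω α G ≤ ENNReal.ofReal A) :
    (∀ᵐ z ∂(phaseMeasure Ω),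
      Integrable (fun u => k z.2 u * h (z.1, u)) ∧
      IntervalIntegrable
        (fun s : ℝ => Real.exp (-ν z.2 * s) * opK k h (z.1 - s • z.2, z.2))
        volume 0 (exitTime Ω z.1 z.2)) ∧
    fullNorm Ω α (opS Ω ν (opK k h)) ≤ ENNReal.ofReal (smoothingConst C c L *
      ((1 + Metric.diam Ω) * M + Real.sqrt (R * r) * (1 + R / r) * A)) := by
  have hc := hν.c_pos
  have hL := hν.L_nonneg
  have hC := hk.pos
  have hR := hΩ.R_pos
  have hr := hΩ.r_pos
  have hD : 0 ≤ Metric.diam Ω := Metric.diam_nonneg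
  have hT : 0 ≤ transportConst c L := by rw [transportConst]; positivity
  obtain ⟨h₀, G₀, he, hp⟩ := hh.exists_isBoundedWeakPair hΩ hM hA hs hw
  obtain ⟨g, hg, hgK⟩ := hp.exists_regularSource hΩ hα hM (by positivity) hk
  have hslice := ae_slice_ae_eq hΩ.isOpen he
  have hgF : ∀ᵐ z : E3 × E3, z.1 ∈ Ω → g z.1 z.2 = opK k h z := by
    filter_upwards [hslice, hg.ae_eq_of_forall_ae hΩ hα hν.gamma_nonneg
      (hp.stronglyMeasurable_opK hk).measurable hgK] with z h1 h2 hz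
    rw [h2 hz]
    exact integral_congr_ae ((h1 hz).mono fun u hu => by simp only [hu])
  have hS := hg.ae_opS_eq hΩ ν hgF
  refine ⟨?_, ?_⟩
  · filter_upwards [hS, ae_phaseMeasure_mem hΩ.isOpen, ae_mono Measure.restrict_le_self hslice]
      with z h1 h2 h3
    refine ⟨(hp.integrable_mul hk z.1 z.2).congr ?_, h1.1⟩
    filter_upwards [h3 h2.1] with u hu
    rw [hu]
  · refine (hg.fullNorm_opS_le hΩ hα hν (hS.mono fun z hz => hz.2)).trans
      (ENNReal.ofReal_le_ofReal ?_)
    -- The √R from the inverse weight meets the √r from the chord estimate; the remaining 3 turns 6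
    -- into the 18 of `smoothingConst`.
    have e1 : C * (A * Real.sqrt R) * IsRollingDomain.chordConst R r =
        3 * C * (Real.sqrt (R * r) * (1 + R / r) * A) := by
      rw [IsRollingDomain.chordConst, Real.sqrt_mul hR.le]; ring
    rw [e1, smoothingConst]
    set Y := Real.sqrt (R * r) * (1 + R / r) * A with hY
    have hY0 : 0 ≤ Y := by positivity
    have e2 : C * M / c ≤ C * (1 / c) * ((1 + Metric.diam Ω) * M) := by
      have : 0 ≤ C * (1 / c) * (Metric.diam Ω * M) := by positivity
      calc C * M / c = C * (1 / c) * M := by ring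
        _ ≤ _ := by linarith
    have e3 : 0 ≤ C * transportConst c L * ((1 + Metric.diam Ω) * M) := by positivity
    have e4 : 0 ≤ C * (1 / c) * Y := by positivity
    linarith

end

end KineticBoltzmann

end

/-! ### The smoothing estimate. -/

open KineticBoltzmann in
theorem mainTheorem4 (γ ρ α : ℝ) (ν : E3 → ℝ) (k : E3 → E3 → ℝ)
    (hA : PropertyA γ ρ ν k) (hα₀ : 0 ≤ α) (hα₁ : α < (1 - ρ) / 2) :
    ∃ C : ℝ≥0, ∀ (Ω : Set E3) (R r : ℝ), AssumptionOmega Ω →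
      IsUniformCircumscribedRadius Ω R → IsUniformInteriorRadius Ω r →
      ∀ h : E3 × E3 → ℝ, MemHatLInfty Ω α h →
        (∀ᵐ z ∂(phaseMeasure Ω),
          Integrable (fun u => k z.2 u * h (z.1, u)) ∧
          IntervalIntegrable
            (fun s : ℝ => Real.exp (-ν z.2 * s) * opK k h (z.1 - s • z.2, z.2))
            volume 0 (exitTime Ω z.1 z.2)) ∧
        fullNorm Ω α (opS Ω ν (opK k h)) ≤
          C * (ENNReal.ofReal (1 + Metric.diam Ω) * supNorm Ω α h +
            ENNReal.ofReal (Real.sqrt (R * r) * (1 + R / r)) * fullNorm Ω α h) := by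
  obtain ⟨C, hk⟩ := hA.exists_kernelBounds hα₀ hα₁
  obtain ⟨c, L, hν⟩ := hA.exists_frequencyBounds
  have hc := hν.c_pos
  have hL := hν.L_nonneg
  have hC := hk.pos
  have hS : 0 ≤ smoothingConst C c L := by rw [smoothingConst, transportConst]; positivity
  refine ⟨(smoothingConst C c L).toNNReal, fun Ω R r hΩ' hR' hr' h hh => ?_⟩
  have hΩ := hΩ'.isRollingDomain hR' hr'
  have hR := hΩ.R_pos
  have hr := hΩ.r_pos
  have hD : 0 ≤ Metric.diam Ω := Metric.diam_nonneg
  -- The full norm is an infimum over weak gradients. Any X above it is realised by some pair, and X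
  -- then decreases to the norm; this avoids proving that the weak gradients are unique.
  have key : ∀ X : ℝ≥0∞, fullNorm Ω α h < X →
      (∀ᵐ z ∂(phaseMeasure Ω),
        Integrable (fun u => k z.2 u * h (z.1, u)) ∧
        IntervalIntegrable
          (fun s : ℝ => Real.exp (-ν z.2 * s) * opK k h (z.1 - s • z.2, z.2))
          volume 0 (exitTime Ω z.1 z.2)) ∧
      fullNorm Ω α (opS Ω ν (opK k h)) ≤
        (smoothingConst C c L).toNNReal * (ENNReal.ofReal (1 + Metric.diam Ω) * supNorm Ω α h +
          ENNReal.ofReal (Real.sqrt (R * r) * (1 + R / r)) * X) := by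
    intro X hX
    simp only [fullNorm, iInf_lt_iff] at hX
    obtain ⟨G, H, hGH, hlt⟩ := hX
    have hs : supNorm Ω α h ≠ ⊤ :=
      ne_top_of_lt ((le_self_add.trans le_self_add).trans_lt hlt)
    have hw : weightedSupNorm Ω α G ≠ ⊤ :=
      ne_top_of_lt ((le_add_self.trans le_self_add).trans_lt hlt)
    obtain ⟨h1, h2⟩ := hGH.fullNorm_opS_opK_le hΩ hα₀ hk hν (M := (supNorm Ω α h).toReal)
      (A := (weightedSupNorm Ω α G).toReal) ENNReal.toReal_nonneg ENNReal.toReal_nonneg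
      (ENNReal.ofReal_toReal hs).ge (ENNReal.ofReal_toReal hw).ge
    refine ⟨h1, h2.trans ?_⟩
    rw [ENNReal.ofReal_mul hS, ENNReal.ofReal_add (by positivity) (by positivity),
      ENNReal.ofReal_mul (by positivity), ENNReal.ofReal_mul (p := _ * _) (by positivity),
      ENNReal.ofReal_toReal hs, ENNReal.ofReal_toReal hw]
    exact mul_le_mul_right (add_le_add_right (mul_le_mul_right
      ((le_add_self.trans le_self_add).trans hlt.le) _) _) _
  refine ⟨(key ⊤ hh).1, ?_⟩
  have hne : (𝓝[>] fullNorm Ω α h).NeBot := nhdsGT_neBot_of_exists_gt ⟨⊤, hh⟩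
  have hcont : Continuous fun X : ℝ≥0∞ =>
      ((smoothingConst C c L).toNNReal : ℝ≥0∞) *
        (ENNReal.ofReal (1 + Metric.diam Ω) * supNorm Ω α h +
          ENNReal.ofReal (Real.sqrt (R * r) * (1 + R / r)) * X) :=
    (ENNReal.continuous_const_mul ENNReal.coe_ne_top).comp
      (continuous_const.add (ENNReal.continuous_const_mul ENNReal.ofReal_ne_top))
  have hlim := (hcont.tendsto (fullNorm Ω α h)).mono_left
    (nhdsWithin_le_nhds (s := Ioi (fullNorm Ω α h)))
  refine ge_of_tendsto hlim ?_
  filter_upwards [self_mem_nhdsWithin] with X hX using (key X hX).2
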